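/- **Setting.** Let $b\in\mathbb R$, $\sigma\neq0$, $r>0$, $K\in\mathbb R$, let $W$ be a standard Brownian motion and, for $x>0$, let $X_t=x\exp\big((b-\sigma^2)t+\sqrt2\,\sigma W_t\big)$, so that $dX_t=bX_t\,dt+\sqrt2\,\sigma X_t\,dW_t$, $X_0=x$. Let $h:(0,\infty)\to\mathbb R$ be right-continuous and increasing (not necessarily strictly), with $\lim_{x\to\infty}h(x)=\infty$ and $\mathbb E\int_0^\infty e^{-rt}|h(X_t)|\,dt<\infty$ for every $x>0$. Put $h(0)=\lim_{x\downarrow0}h(x)\in[-\infty,\infty)$, $$m,n=\frac{1}{2\sigma^2}\Big[\sigma^2-b\mp\sqrt{(b-\sigma^2)^2+4\sigma^2r}\Big],\quad m<0<n,\qquad c=\frac1{\sigma^2(n-m)},$$ $$R_h(x)=c\Big[x^m\int_0^xs^{-m-1}h(s)\,ds+x^n\int_x^\infty s^{-n-1}h(s)\,ds\Big].$$ For $K_1,K_0>0$, the HJB equation is the pair of coupled variational inequalities on $(0,\infty)$ $$\max\{\sigma^2x^2w_1''+bxw_1'-rw_1+h,\ w_0-w_1-K_0,\ -w_1-K\}=0,$$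 $$\max\{\sigma^2x^2w_0''+bxw_0'-rw_0,\ w_1-w_0-K_1,\ -w_0-K\}=0.$$ It is satisfied by $w_1,w_0$ if both functions are $C^1$ on $(0,\infty)$ and if there is a finite set outside which, at every continuity point of $h$, both are twice differentiable and both equalities hold. **The system.** Consider, for $\zeta>0$ and $0<\delta<\gamma<\beta<\alpha$, the five equations $$m\int_\beta^\alpha s^{-m-1}h(s)\,ds+rK_0\beta^{-m}+rK_1\alpha^{-m}=0,\qquad n\int_\beta^\alpha s^{-n-1}h(s)\,ds+rK_0\beta^{-n}+rK_1\alpha^{-n}=0,$$ $$n\int_\delta^\infty s^{-n-1}[h(s)+rK]\,ds-n\int_\gamma^\beta s^{-n-1}[h(s)+rK_0]\,ds=0,$$ $$n\int_\beta^\infty s^{-n-1}[h(s)+rK_0]\,ds+rK\zeta^{-n}=0,$$ $$m\int_0^\gamma s^{-m-1}[h(s)+rK_0]\,ds-m\int_0^\delta s^{-m-1}[h(s)+rK]\,ds-rK\zeta^{-m}=0,$$ and put $$\Gamma_1=-c\int_0^\delta s^{-m-1}[h(s)+rK]\,ds,\quad \Gamma_2=-c\int_\delta^\infty s^{-n-1}[h(s)+rK]\,ds,$$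 $$\Delta_1=\frac{rK\zeta^{-m}}{\sigma^2m(n-m)},\quad\Delta_2=-\frac{rK\zeta^{-n}}{\sigma^2n(n-m)},\quad A=\Delta_1-c\int_0^\alpha s^{-m-1}[h(s)-rK_1]\,ds,$$ $$w_1(x)=\begin{cases}-K,&x\le\delta\\ \Gamma_1x^m+\Gamma_2x^n+R_h(x),&\delta<x<\gamma\\ \Delta_1x^m+\Delta_2x^n-K_0,&\gamma\le x\le\beta\\ Ax^m+R_h(x),&x>\beta\end{cases}\qquad w_0(x)=\begin{cases}-K,&x\le\zeta\\ \Delta_1x^m+\Delta_2x^n,&\zeta<x<\alpha\\ Ax^m+R_h(x)-K_1,&x\ge\alpha.\end{cases}$$ **The critical values.** (a) If $h(0)<-rK$, there is a unique $\delta_\dagger>0$ with $\int_{\delta_\dagger}^\infty s^{-n-1}[h(s)+rK]\,ds=0$. (b) If moreover $K<0$, then for every $K_1>0$ there is a unique pair $(\zeta,\alpha)=(\zeta(K_1),\alpha(K_1))$ with $0<\zeta<\alpha$, $\delta_\dagger<\alpha$ and $$m\int_{\delta_\dagger}^\alpha s^{-m-1}[h(s)-rK_1]\,ds+r(K_1+K)\delta_\dagger^{-m}-rK\zeta^{-m}=0,$$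 $$-n\int_{\delta_\dagger}^\alpha s^{-n-1}[h(s)-rK_1]\,ds-r(K_1+K)\delta_\dagger^{-n}+rK\zeta^{-n}=0.$$ (c) If moreover $h(\delta_\dagger)<0$, there is a unique $K_1^\dagger>0$ such that $\zeta(K_1)<\delta_\dagger$ for all $K_1\in(0,K_1^\dagger)$ and $\delta_\dagger<\zeta(K_1)$ for all $K_1>K_1^\dagger$. (d) If moreover $0<K_1<K_1^\dagger$ and $\alpha=\alpha(K_1)$, there is a unique $\hat x\in(\delta_\dagger,\alpha)$ such that the function $$x\mapsto cmx^{m-1}\int_x^\alpha s^{-m-1}[h(s)-rK_1]\,ds-cnx^{n-1}\int_x^\alpha s^{-n-1}[h(s)-rK_1]\,ds$$ is strictly positive on $[\delta_\dagger,\hat x)$ and strictly negative on $(\hat x,\alpha)$, and $$K_0^\dagger:=-K_1-\frac{n\hat x^n}{r}\int_{\hat x}^\alpha s^{-n-1}[h(s)-rK_1]\,ds>0.$$ Thus $\delta_\dagger$ and $K_1^\dagger$ depend on neither $K_1$ nor $K_0$, and $K_0^\dagger$ does not depend on $K_0$. **The characterisation.** For all $K_1,K_0>0$ the following are equivalent.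 1. The system has a unique solution $(\zeta,\delta,\gamma,\beta,\alpha)$ with $\zeta>0$ and $0<\delta<\gamma<\beta<\alpha$, and, for this solution, $\Gamma_1,\Gamma_2,A,\Delta_1,\Delta_2>0$, the functions $w_1,w_0$ are increasing (not necessarily strictly), and they satisfy the HJB equation. 2. $K<0$, $h(0)<-rK_0$, $h(\delta_\dagger)<0$, $K_1<K_1^\dagger$ and $K_0<K_0^\dagger$. In 2 each condition is read under the preceding ones, which ensure that the critical value it mentions exists. -/

import Mathlib

open Set Filter Topology MeasureTheory ProbabilityTheory
open scoped NNReal ENNReal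

noncomputable section

/-- The data of the switching problem apart from the two switching costs: the drift `b` and the
volatility `√2 σ` of the geometric Brownian motion, the discount rate `r`, the abandonment cost `K`
and the running payoff `h` (only its values on `(0, ∞)` matter).  The switching costs `K₁`, `K₀`
are kept as separate arguments, so that it is visible what depends on them. -/
structure SwitchingModel where
  b : ℝ
  σ : ℝ
  r : ℝ
  K : ℝ
  h : ℝ → ℝ

/-- The free boundary points of the case with abandonment in both modes. -/
@[ext] structure FreeBoundary where
  ζ : ℝ
  δ : ℝ
  γ : ℝ
  β : ℝ
  α : ℝ

namespace SwitchingModel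

variable (M : SwitchingModel)

/-- The geometric Brownian motion started at `x`, i.e. the solution of
`dX = b X dt + √2 σ X dW`, `X₀ = x`. -/
def X {Ω : Type*} (W : ℝ≥0 → Ω → ℝ) (x t : ℝ) (ω : Ω) : ℝ :=
  x * Real.exp ((M.b - M.σ ^ 2) * t + Real.sqrt 2 * M.σ * W t.toNNReal ω)

/-- The standing assumptions on the data, for a Brownian motion `W` under `P`. -/
structure Standing {Ω : Type*} [MeasurableSpace Ω] (P : Measure Ω) (W : ℝ≥0 → Ω → ℝ) : Prop where
  sigma_ne : M.σ ≠ 0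
  r_pos : 0 < M.r
  right_cont : ∀ x, 0 < x → ContinuousWithinAt M.h (Ici x) x
  mono : MonotoneOn M.h (Ioi 0)
  tendsto_top : Tendsto M.h atTop atTop
  integrable : ∀ x, 0 < x →
    (∫⁻ ω, (∫⁻ t in Ioi (0 : ℝ),
      ENNReal.ofReal (Real.exp (-M.r * t) * |M.h (M.X W x t ω)|)) ∂P) < ∞

/-- The negative exponent `m` of the Euler equation `σ² x² w'' + b x w' - r w = 0`. -/
def m : ℝ :=
  (M.σ ^ 2 - M.b - Real.sqrt ((M.b - M.σ ^ 2) ^ 2 + 4 * M.σ ^ 2 * M.r)) / (2 * M.σ ^ 2)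

/-- The positive exponent `n` of the Euler equation `σ² x² w'' + b x w' - r w = 0`. -/
def n : ℝ :=
  (M.σ ^ 2 - M.b + Real.sqrt ((M.b - M.σ ^ 2) ^ 2 + 4 * M.σ ^ 2 * M.r)) / (2 * M.σ ^ 2)

/-- `h(0) = lim_{x ↓ 0} h(x)`, which may be `-∞`. -/
def hZero : EReal := limUnder (𝓝[>] (0 : ℝ)) (fun x => (M.h x : EReal))

theorem tendsto_hZero (hm : MonotoneOn M.h (Ioi 0)) :
    Tendsto (fun x => (M.h x : EReal)) (𝓝[>] (0 : ℝ)) (𝓝 M.hZero) := by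
  have hm' : MonotoneOn (fun x => (M.h x : EReal)) (Ioi 0) :=
    fun x hx y hy hxy => EReal.coe_le_coe_iff.2 (hm hx hy hxy)
  exact tendsto_nhds_limUnder ⟨_, hm'.tendsto_nhdsGT (OrderBot.bddBelow _)⟩

/-- The particular solution `R_h` of `σ² x² w'' + b x w' - r w + h = 0`. -/
def R (x : ℝ) : ℝ :=
  1 / (M.σ ^ 2 * (M.n - M.m)) *
    (x ^ M.m * (∫ s in (0 : ℝ)..x, s ^ (-M.m - 1) * M.h s) +
      x ^ M.n * (∫ s in Ioi x, s ^ (-M.n - 1) * M.h s))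

/-- `(w₁, w₀)` satisfies the HJB equation: both functions are `C¹` on `(0, ∞)` and, away from
finitely many points and from the jumps of `h`, they are twice differentiable and the two
variational inequalities hold.  At a jump of `h` the second derivative of a solution of
`σ² x² w'' + b x w' - r w + h = 0` does not exist. -/
structure SolvesHJB (K₁ K₀ : ℝ) (w₁ w₀ : ℝ → ℝ) : Prop where
  contDiff_one : ContDiffOn ℝ 1 w₁ (Ioi 0)
  contDiff_zero : ContDiffOn ℝ 1 w₀ (Ioi 0)
  eqn : ∃ F : Set ℝ, F.Finite ∧ ∀ x, 0 < x → x ∉ F → ContinuousAt M.h x →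
    DifferentiableAt ℝ (deriv w₁) x ∧ DifferentiableAt ℝ (deriv w₀) x ∧
    max (M.σ ^ 2 * x ^ 2 * deriv (deriv w₁) x + M.b * x * deriv w₁ x - M.r * w₁ x + M.h x)
      (max (w₀ x - w₁ x - K₀) (-w₁ x - M.K)) = 0 ∧
    max (M.σ ^ 2 * x ^ 2 * deriv (deriv w₀) x + M.b * x * deriv w₀ x - M.r * w₀ x)
      (max (w₁ x - w₀ x - K₁) (-w₀ x - M.K)) = 0

/-! ### The system of equations and the candidate solution -/

/-- `p` solves the five free boundary equations, with `ζ > 0` and `0 < δ < γ < β < α`. -/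
structure IsSolution (K₁ K₀ : ℝ) (p : FreeBoundary) : Prop where
  zeta_pos : 0 < p.ζ
  delta_pos : 0 < p.δ
  delta_lt_gamma : p.δ < p.γ
  gamma_lt_beta : p.γ < p.β
  beta_lt_alpha : p.β < p.α
  eq1 : M.m * (∫ s in p.β..p.α, s ^ (-M.m - 1) * M.h s)
    + M.r * K₀ * p.β ^ (-M.m) + M.r * K₁ * p.α ^ (-M.m) = 0
  eq2 : M.n * (∫ s in p.β..p.α, s ^ (-M.n - 1) * M.h s)
    + M.r * K₀ * p.β ^ (-M.n) + M.r * K₁ * p.α ^ (-M.n) = 0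
  eq3 : M.n * (∫ s in Ioi p.δ, s ^ (-M.n - 1) * (M.h s + M.r * M.K))
    - M.n * (∫ s in p.γ..p.β, s ^ (-M.n - 1) * (M.h s + M.r * K₀)) = 0
  eq4 : M.n * (∫ s in Ioi p.β, s ^ (-M.n - 1) * (M.h s + M.r * K₀))
    + M.r * M.K * p.ζ ^ (-M.n) = 0
  eq5 : M.m * (∫ s in (0 : ℝ)..p.γ, s ^ (-M.m - 1) * (M.h s + M.r * K₀))
    - M.m * (∫ s in (0 : ℝ)..p.δ, s ^ (-M.m - 1) * (M.h s + M.r * M.K))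
    - M.r * M.K * p.ζ ^ (-M.m) = 0

def Gamma₁ (p : FreeBoundary) : ℝ :=
  -(1 / (M.σ ^ 2 * (M.n - M.m))) *
    ∫ s in (0 : ℝ)..p.δ, s ^ (-M.m - 1) * (M.h s + M.r * M.K)

def Gamma₂ (p : FreeBoundary) : ℝ :=
  -(1 / (M.σ ^ 2 * (M.n - M.m))) * ∫ s in Ioi p.δ, s ^ (-M.n - 1) * (M.h s + M.r * M.K)

def Delta₁ (p : FreeBoundary) : ℝ :=
  M.r * M.K * p.ζ ^ (-M.m) / (M.σ ^ 2 * M.m * (M.n - M.m))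

def Delta₂ (p : FreeBoundary) : ℝ :=
  -(M.r * M.K * p.ζ ^ (-M.n) / (M.σ ^ 2 * M.n * (M.n - M.m)))

def A (K₁ : ℝ) (p : FreeBoundary) : ℝ :=
  M.Delta₁ p - 1 / (M.σ ^ 2 * (M.n - M.m)) *
    ∫ s in (0 : ℝ)..p.α, s ^ (-M.m - 1) * (M.h s - M.r * K₁)

/-- The candidate for the value function of the open mode. -/
def w₁ (K₁ K₀ : ℝ) (p : FreeBoundary) (x : ℝ) : ℝ :=
  if x ≤ p.δ then -M.K
  else if x < p.γ then M.Gamma₁ p * x ^ M.m + M.Gamma₂ p * x ^ M.n + M.R x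
  else if x ≤ p.β then M.Delta₁ p * x ^ M.m + M.Delta₂ p * x ^ M.n - K₀
  else M.A K₁ p * x ^ M.m + M.R x

/-- The candidate for the value function of the closed mode. -/
def w₀ (K₁ : ℝ) (p : FreeBoundary) (x : ℝ) : ℝ :=
  if x ≤ p.ζ then -M.K
  else if x < p.α then M.Delta₁ p * x ^ M.m + M.Delta₂ p * x ^ M.n
  else M.A K₁ p * x ^ M.m + M.R x - K₁

/-! ### The critical values -/

/-- `d = δ†`: a positive solution of `∫_d^∞ s^{-n-1} (h(s) + r K) ds = 0`. -/
def IsDeltaDagger (d : ℝ) : Prop :=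
  0 < d ∧ ∫ s in Ioi d, s ^ (-M.n - 1) * (M.h s + M.r * M.K) = 0

/-- The two equations for `(ζ, α)` of the simpler case without switch-out region, in which the open
project is abandoned at `d = δ†`, the closed one is abandoned at `ζ` and opened at `α`. -/
structure IsNoSwitchOutPair (d K₁ ζ α : ℝ) : Prop where
  zeta_pos : 0 < ζ
  zeta_lt : ζ < α
  d_lt : d < α
  eq1 : M.m * (∫ s in d..α, s ^ (-M.m - 1) * (M.h s - M.r * K₁))
    + M.r * (K₁ + M.K) * d ^ (-M.m) - M.r * M.K * ζ ^ (-M.m) = 0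
  eq2 : -M.n * (∫ s in d..α, s ^ (-M.n - 1) * (M.h s - M.r * K₁))
    - M.r * (K₁ + M.K) * d ^ (-M.n) + M.r * M.K * ζ ^ (-M.n) = 0

/-- `k = K₁†`: the positive number such that the point `ζ = ζ(K₁)` of the simpler case is below
`d = δ†` for positive `K₁ < k` and above it for `K₁ > k`. -/
def IsK₁Dagger (d k : ℝ) : Prop :=
  0 < k ∧ ∀ K₁, 0 < K₁ → ∀ ζ α, M.IsNoSwitchOutPair d K₁ ζ α →
    (K₁ < k → ζ < d) ∧ (k < K₁ → d < ζ)

/-- The derivative of `w₀ - w₁` to the left of `α` and to the right of `d` and `ζ`, for the functions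
`w₁`, `w₀` of the simpler case. -/
def gapDeriv (K₁ α x : ℝ) : ℝ :=
  M.m * x ^ (M.m - 1) / (M.σ ^ 2 * (M.n - M.m)) *
      (∫ s in x..α, s ^ (-M.m - 1) * (M.h s - M.r * K₁))
    - M.n * x ^ (M.n - 1) / (M.σ ^ 2 * (M.n - M.m)) *
      (∫ s in x..α, s ^ (-M.n - 1) * (M.h s - M.r * K₁))

/-- `y` is the point of `(d, α)` at which `gapDeriv` changes its sign from plus to minus. -/
def IsSignChange (d K₁ α y : ℝ) : Prop :=
  d < y ∧ y < α ∧ (∀ x, d ≤ x → x < y → 0 < M.gapDeriv K₁ α x) ∧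
    (∀ x, y < x → x < α → M.gapDeriv K₁ α x < 0)

/-- `k = K₀†`, a quantity that depends on `K₁` but not on `K₀`. -/
def IsK₀Dagger (d K₁ k : ℝ) : Prop :=
  ∃ ζ α y, M.IsNoSwitchOutPair d K₁ ζ α ∧ M.IsSignChange d K₁ α y ∧
    k = -K₁ - M.n * y ^ M.n / M.r * ∫ s in y..α, s ^ (-M.n - 1) * (M.h s - M.r * K₁)

end SwitchingModel

end

/-!
Put `μ = -m` and, for a constant `c`, `P c x = μ ∫₀ˣ s^{μ-1} (h + c) ds` and
`Q c x = n ∫ₓ^∞ s^{-n-1} (h + c) ds`. Smooth fit at the free boundary points says that the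
difference of two points of the plane curves `x ↦ (P c x, Q c x)`, for two values of `c`, is zero or
a point of the curve `x ↦ E (x^μ, x^{-n})`, where `E = -r K`. All these curves have the slope
`-(n/μ) x^{-n-μ}` at `x`, whatever `h` and `c` are, and `h + c` changes sign at most once. Comparing
chords with tangents therefore shows that each pair of equations has at most one solution, and the
intermediate value theorem decides when it has one. The critical values are the parameters at which
the ordering of the free boundary points degenerates: at `K₁ = K₁†` the points `ζ` and `δ†`
coincide, at `K₀ = K₀†` the points `γ` and `β` do.

Between the free boundary points, `w₁'`, `w₀'` and `w₀' - w₁'` are, up to sign, `x^{-μ-1}` times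
a concave function of `x^{n+μ}`, because `x^{n+μ} Q 0 x - P 0 x` has the derivative
`∫ₓ^∞ (h(s) - h(x)) d(-s^{-n})` with respect to `x^{n+μ}`, which decreases when `h` increases. Hence
each of them changes sign at most twice, which gives monotonicity and the variational inequalities.
-/

/-- The moments of order `μ` at `0` and of order `-n` at `∞` of the function `h` exist. -/
structure HasMoments (μ n : ℝ) (h : ℝ → ℝ) : Prop where
  mu_pos : 0 < μ
  n_pos : 0 < n
  integrableOn_low : ∀ x, 0 < x → IntegrableOn (fun s => s ^ (μ - 1) * h s) (Ioc 0 x)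
  integrableOn_high : ∀ x, 0 < x → IntegrableOn (fun s => s ^ (-n - 1) * h s) (Ioi x)

/-- The moment `∫_0^x (h(s) + c) d(s^μ)`, with the contribution of the constant `c` integrated. -/
noncomputable def lowMoment (μ : ℝ) (h : ℝ → ℝ) (c x : ℝ) : ℝ :=
  μ * (∫ s in (0 : ℝ)..x, s ^ (μ - 1) * h s) + c * x ^ μ

/-- The moment `∫_x^∞ (h(s) + c) d(-s^{-n})`, with the contribution of the constant `c`
integrated. -/
noncomputable def highMoment (n : ℝ) (h : ℝ → ℝ) (c x : ℝ) : ℝ :=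
  n * (∫ s in Ioi x, s ^ (-n - 1) * h s) + c * x ^ (-n)

section moments

variable {μ n : ℝ} {h : ℝ → ℝ}

lemma lowMoment_eq_add (c c' x : ℝ) :
    lowMoment μ h c x = lowMoment μ h c' x + (c - c') * x ^ μ := by
  unfold lowMoment; ring

lemma highMoment_eq_add (c c' x : ℝ) :
    highMoment n h c x = highMoment n h c' x + (c - c') * x ^ (-n) := by
  unfold highMoment; ring

lemma lowMoment_neg (c x : ℝ) : lowMoment μ (-h) (-c) x = -lowMoment μ h c x := by
  simp only [lowMoment, Pi.neg_apply, mul_neg, intervalIntegral.integral_neg]; ring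

lemma highMoment_neg (c x : ℝ) : highMoment n (-h) (-c) x = -highMoment n h c x := by
  simp only [highMoment, Pi.neg_apply, mul_neg, integral_neg]; ring

lemma intervalIntegral_nonneg_of_Ioo {f : ℝ → ℝ} {a b : ℝ} (hab : a ≤ b)
    (hf : ∀ s ∈ Ioo a b, 0 ≤ f s) : 0 ≤ ∫ s in a..b, f s := by
  rw [intervalIntegral.integral_of_le hab, integral_Ioc_eq_integral_Ioo]
  exact setIntegral_nonneg measurableSet_Ioo hf

end moments

namespace HasMoments

variable {μ n : ℝ} {h : ℝ → ℝ} (H : HasMoments μ n h)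

local notation "P" => lowMoment μ h
local notation "Q" => highMoment n h

include H

lemma neg : HasMoments μ n (-h) where
  mu_pos := H.mu_pos
  n_pos := H.n_pos
  integrableOn_low x hx := by
    simpa only [Pi.neg_apply, Pi.neg_def, mul_neg] using (H.integrableOn_low x hx).neg
  integrableOn_high x hx := by
    simpa only [Pi.neg_apply, Pi.neg_def, mul_neg] using (H.integrableOn_high x hx).neg

lemma add_pos : 0 < n + μ := _root_.add_pos H.n_pos H.mu_pos

lemma intervalIntegrable_low {a b : ℝ} (ha : 0 ≤ a) (hb : 0 ≤ b) :
    IntervalIntegrable (fun s => s ^ (μ - 1) * h s) volume a b := by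
  have from_zero : ∀ x, 0 ≤ x → IntervalIntegrable (fun s => s ^ (μ - 1) * h s) volume 0 x := by
    intro x hx
    rcases hx.eq_or_lt with rfl | hx
    · exact IntervalIntegrable.refl
    · exact (intervalIntegrable_iff_integrableOn_Ioc_of_le hx.le).2 (H.integrableOn_low x hx)
  exact (from_zero a ha).symm.trans (from_zero b hb)

lemma intervalIntegrable_high {a b : ℝ} (ha : 0 < a) (hb : 0 < b) :
    IntervalIntegrable (fun s => s ^ (-n - 1) * h s) volume a b := by
  rw [intervalIntegrable_iff]
  exact (H.integrableOn_high (min a b) (lt_min ha hb)).mono_set fun x hx => hx.1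

lemma intervalIntegrable_low_add (c : ℝ) {a b : ℝ} (ha : 0 ≤ a) (hb : 0 ≤ b) :
    IntervalIntegrable (fun s => μ * s ^ (μ - 1) * (h s + c)) volume a b := by
  have hpow : IntervalIntegrable (fun s : ℝ => s ^ (μ - 1)) volume a b :=
    intervalIntegral.intervalIntegrable_rpow' (by linarith [H.mu_pos])
  refine (((H.intervalIntegrable_low ha hb).const_mul μ).add (hpow.const_mul (μ * c))).congr ?_
  intro s _
  ring

lemma intervalIntegrable_high_add (c : ℝ) {a b : ℝ} (ha : 0 < a) (hb : 0 < b) :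
    IntervalIntegrable (fun s => n * s ^ (-n - 1) * (h s + c)) volume a b := by
  have hpow : IntervalIntegrable (fun s : ℝ => s ^ (-n - 1)) volume a b :=
    intervalIntegral.intervalIntegrable_rpow (Or.inr (notMem_uIcc_of_lt ha hb))
  refine (((H.intervalIntegrable_high ha hb).const_mul n).add (hpow.const_mul (n * c))).congr ?_
  intro s _
  ring

lemma lowMoment_sub (c : ℝ) {a b : ℝ} (ha : 0 ≤ a) (hb : 0 ≤ b) :
    P c b - P c a = ∫ s in a..b, μ * s ^ (μ - 1) * (h s + c) := by
  have hμ := H.mu_pos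
  have hpow : IntervalIntegrable (fun s : ℝ => s ^ (μ - 1)) volume a b :=
    intervalIntegral.intervalIntegrable_rpow' (by linarith)
  have split : (fun s => μ * s ^ (μ - 1) * (h s + c)) =
      fun s => μ * (s ^ (μ - 1) * h s) + μ * c * s ^ (μ - 1) := by
    funext s; ring
  rw [split, intervalIntegral.integral_add ((H.intervalIntegrable_low ha hb).const_mul μ)
      (hpow.const_mul _), intervalIntegral.integral_const_mul,
    intervalIntegral.integral_const_mul, integral_rpow (Or.inl (by linarith)),
    ← intervalIntegral.integral_interval_sub_left (H.intervalIntegrable_low le_rfl hb)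
      (H.intervalIntegrable_low le_rfl ha)]
  unfold lowMoment
  rw [sub_add_cancel]
  field_simp
  ring

lemma highMoment_eq_integral (c : ℝ) {x : ℝ} (hx : 0 < x) :
    Q c x = ∫ s in Ioi x, n * s ^ (-n - 1) * (h s + c) := by
  have hn := H.n_pos
  have hpow : IntegrableOn (fun s : ℝ => s ^ (-n - 1)) (Ioi x) :=
    integrableOn_Ioi_rpow_of_lt (by linarith) hx
  have split : (fun s => n * s ^ (-n - 1) * (h s + c)) =
      fun s => n * (s ^ (-n - 1) * h s) + n * c * s ^ (-n - 1) := by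
    funext s; ring
  rw [split, integral_add ((H.integrableOn_high x hx).const_mul n) (hpow.const_mul _),
    integral_const_mul, integral_const_mul, integral_Ioi_rpow_of_lt (by linarith) hx]
  unfold highMoment
  rw [sub_add_cancel]
  field_simp

lemma highMoment_sub (c : ℝ) {a b : ℝ} (ha : 0 < a) (hb : 0 < b) :
    Q c a - Q c b = ∫ s in a..b, n * s ^ (-n - 1) * (h s + c) := by
  have hn := H.n_pos
  have integrable : ∀ x, 0 < x → IntegrableOn (fun s => n * s ^ (-n - 1) * (h s + c)) (Ioi x) := by
    intro x hx
    refine (((H.integrableOn_high x hx).const_mul n).add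
      ((integrableOn_Ioi_rpow_of_lt (show -n - 1 < -1 by linarith) hx).const_mul (n * c))).congr ?_
    exact Eventually.of_forall fun s => by simp only [Pi.add_apply]; ring
  rw [H.highMoment_eq_integral c ha, H.highMoment_eq_integral c hb,
    intervalIntegral.integral_Ioi_sub_Ioi' (integrable a ha) (integrable b hb)]

section increments

variable {c a b : ℝ}

lemma lowMoment_le_of_nonneg (ha : 0 ≤ a) (hab : a ≤ b) (hc : ∀ s ∈ Ioo a b, 0 ≤ h s + c) :
    P c a ≤ P c b := by
  rw [← sub_nonneg, H.lowMoment_sub c ha (ha.trans hab)]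
  exact intervalIntegral_nonneg_of_Ioo hab fun s hs =>
    mul_nonneg (mul_nonneg H.mu_pos.le (Real.rpow_nonneg (ha.trans hs.1.le) _)) (hc s hs)

lemma lowMoment_lt_of_pos (ha : 0 ≤ a) (hab : a < b) (hc : ∀ s ∈ Ioo a b, 0 < h s + c) :
    P c a < P c b := by
  rw [← sub_pos, H.lowMoment_sub c ha (ha.trans hab.le)]
  exact intervalIntegral.intervalIntegral_pos_of_pos_on
    (H.intervalIntegrable_low_add c ha (ha.trans hab.le)) (fun s hs => mul_pos
      (mul_pos H.mu_pos (Real.rpow_pos_of_pos (ha.trans_lt hs.1) _)) (hc s hs)) hab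

lemma highMoment_le_of_nonneg (ha : 0 < a) (hab : a ≤ b) (hc : ∀ s ∈ Ioo a b, 0 ≤ h s + c) :
    Q c b ≤ Q c a := by
  rw [← sub_nonneg, H.highMoment_sub c ha (ha.trans_le hab)]
  exact intervalIntegral_nonneg_of_Ioo hab fun s hs =>
    mul_nonneg (mul_nonneg H.n_pos.le (Real.rpow_nonneg (ha.trans hs.1).le _)) (hc s hs)

lemma highMoment_lt_of_pos (ha : 0 < a) (hab : a < b) (hc : ∀ s ∈ Ioo a b, 0 < h s + c) :
    Q c b < Q c a := by
  rw [← sub_pos, H.highMoment_sub c ha (ha.trans hab)]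
  exact intervalIntegral.intervalIntegral_pos_of_pos_on
    (H.intervalIntegrable_high_add c ha (ha.trans hab)) (fun s hs => mul_pos
      (mul_pos H.n_pos (Real.rpow_pos_of_pos (ha.trans hs.1) _)) (hc s hs)) hab

/- At `x = T` the curve `x ↦ (P c x, Q c x)` satisfies `dP = -μ / n * T ^ (n + μ) * dQ`. The next
lemmas compare its chord over `[a, b]` with this slope, through the sign of
`(s ^ (n + μ) - T ^ (n + μ)) * (h s + c)`. -/

lemma slope_integrand (c T : ℝ) {s : ℝ} (hs : 0 < s) :
    μ * s ^ (μ - 1) * (h s + c) - μ / n * T ^ (n + μ) * (n * s ^ (-n - 1) * (h s + c)) =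
      μ * s ^ (-n - 1) * ((s ^ (n + μ) - T ^ (n + μ)) * (h s + c)) := by
  have hn := H.n_pos
  have hpow : s ^ (μ - 1) = s ^ (-n - 1) * s ^ (n + μ) := by
    rw [← Real.rpow_add hs]; ring_nf
  rw [hpow]
  field_simp

lemma slope_eq_integral (c T : ℝ) {a b : ℝ} (ha : 0 < a) (hb : 0 < b) :
    P c b - P c a - μ / n * T ^ (n + μ) * (Q c a - Q c b) =
      ∫ s in a..b, μ * s ^ (μ - 1) * (h s + c)
        - μ / n * T ^ (n + μ) * (n * s ^ (-n - 1) * (h s + c)) := by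
  rw [intervalIntegral.integral_sub (H.intervalIntegrable_low_add c ha.le hb.le)
    ((H.intervalIntegrable_high_add c ha hb).const_mul _), intervalIntegral.integral_const_mul,
    H.lowMoment_sub c ha.le hb.le, H.highMoment_sub c ha hb]

lemma slope_le_of_nonneg {T : ℝ} (ha : 0 < a) (hab : a ≤ b)
    (hc : ∀ s ∈ Ioo a b, 0 ≤ (s ^ (n + μ) - T ^ (n + μ)) * (h s + c)) :
    μ / n * T ^ (n + μ) * (Q c a - Q c b) ≤ P c b - P c a := by
  rw [← sub_nonneg, H.slope_eq_integral c T ha (ha.trans_le hab)]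
  refine intervalIntegral_nonneg_of_Ioo hab fun s hs => ?_
  have hs0 : 0 < s := ha.trans hs.1
  rw [H.slope_integrand c T hs0]
  exact mul_nonneg (mul_nonneg H.mu_pos.le (Real.rpow_nonneg hs0.le _)) (hc s hs)

lemma slope_lt_of_pos {T : ℝ} (ha : 0 < a) (hab : a < b)
    (hc : ∀ s ∈ Ioo a b, 0 < (s ^ (n + μ) - T ^ (n + μ)) * (h s + c)) :
    μ / n * T ^ (n + μ) * (Q c a - Q c b) < P c b - P c a := by
  rw [← sub_pos, H.slope_eq_integral c T ha (ha.trans hab)]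
  have hb := ha.trans hab
  refine intervalIntegral.intervalIntegral_pos_of_pos_on
    ((H.intervalIntegrable_low_add c ha.le hb.le).sub
      ((H.intervalIntegrable_high_add c ha hb).const_mul _)) (fun s hs => ?_) hab
  have hs0 : 0 < s := ha.trans hs.1
  rw [H.slope_integrand c T hs0]
  exact mul_pos (mul_pos H.mu_pos (Real.rpow_pos_of_pos hs0 _)) (hc s hs)

lemma lowMoment_le_of_nonpos (ha : 0 ≤ a) (hab : a ≤ b) (hc : ∀ s ∈ Ioo a b, h s + c ≤ 0) :
    P c b ≤ P c a := by
  have := H.neg.lowMoment_le_of_nonneg (c := -c) ha hab fun s hs => by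
    simpa only [Pi.neg_apply, ← neg_add, neg_nonneg] using hc s hs
  rwa [lowMoment_neg, lowMoment_neg, neg_le_neg_iff] at this

lemma lowMoment_lt_of_neg (ha : 0 ≤ a) (hab : a < b) (hc : ∀ s ∈ Ioo a b, h s + c < 0) :
    P c b < P c a := by
  have := H.neg.lowMoment_lt_of_pos (c := -c) ha hab fun s hs => by
    simpa only [Pi.neg_apply, ← neg_add, neg_pos] using hc s hs
  rwa [lowMoment_neg, lowMoment_neg, neg_lt_neg_iff] at this

lemma highMoment_le_of_nonpos (ha : 0 < a) (hab : a ≤ b) (hc : ∀ s ∈ Ioo a b, h s + c ≤ 0) :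
    Q c a ≤ Q c b := by
  have := H.neg.highMoment_le_of_nonneg (c := -c) ha hab fun s hs => by
    simpa only [Pi.neg_apply, ← neg_add, neg_nonneg] using hc s hs
  rwa [highMoment_neg, highMoment_neg, neg_le_neg_iff] at this

lemma highMoment_lt_of_neg (ha : 0 < a) (hab : a < b) (hc : ∀ s ∈ Ioo a b, h s + c < 0) :
    Q c a < Q c b := by
  have := H.neg.highMoment_lt_of_pos (c := -c) ha hab fun s hs => by
    simpa only [Pi.neg_apply, ← neg_add, neg_pos] using hc s hs
  rwa [highMoment_neg, highMoment_neg, neg_lt_neg_iff] at this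

lemma le_slope_of_nonpos {T : ℝ} (ha : 0 < a) (hab : a ≤ b)
    (hc : ∀ s ∈ Ioo a b, (s ^ (n + μ) - T ^ (n + μ)) * (h s + c) ≤ 0) :
    P c b - P c a ≤ μ / n * T ^ (n + μ) * (Q c a - Q c b) := by
  have := H.neg.slope_le_of_nonneg (c := -c) ha hab fun s hs => by
    simpa only [Pi.neg_apply, ← neg_add, mul_neg, neg_nonneg] using hc s hs
  simp only [lowMoment_neg, highMoment_neg] at this
  linarith

lemma lt_slope_of_neg {T : ℝ} (ha : 0 < a) (hab : a < b)
    (hc : ∀ s ∈ Ioo a b, (s ^ (n + μ) - T ^ (n + μ)) * (h s + c) < 0) :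
    P c b - P c a < μ / n * T ^ (n + μ) * (Q c a - Q c b) := by
  have := H.neg.slope_lt_of_pos (c := -c) ha hab fun s hs => by
    simpa only [Pi.neg_apply, ← neg_add, mul_neg, neg_pos] using hc s hs
  simp only [lowMoment_neg, highMoment_neg] at this
  linarith

end increments

lemma highMoment_nonneg {c x : ℝ} (hx : 0 < x) (hc : ∀ s, x < s → 0 ≤ h s + c) : 0 ≤ Q c x := by
  rw [H.highMoment_eq_integral c hx]
  exact setIntegral_nonneg measurableSet_Ioi fun s hs =>
    mul_nonneg (mul_nonneg H.n_pos.le (Real.rpow_nonneg (hx.trans hs).le _)) (hc s hs)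

lemma tendsto_highMoment (c : ℝ) : Tendsto (Q c) atTop (𝓝 0) := by
  have hlim : Tendsto (fun x => ∫ s in (1 : ℝ)..x, s ^ (-n - 1) * h s) atTop
      (𝓝 (∫ s in Ioi 1, s ^ (-n - 1) * h s)) :=
    intervalIntegral_tendsto_integral_Ioi 1 (H.integrableOn_high 1 one_pos) tendsto_id
  have htail := ((hlim.const_sub (∫ s in Ioi 1, s ^ (-n - 1) * h s)).const_mul n).add
    ((tendsto_rpow_neg_atTop H.n_pos).const_mul c)
  rw [sub_self, mul_zero, mul_zero, add_zero] at htail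
  refine htail.congr' ?_
  filter_upwards [eventually_gt_atTop 0] with x hx
  rw [← intervalIntegral.integral_Ioi_sub_Ioi' (H.integrableOn_high 1 one_pos)
    (H.integrableOn_high x hx)]
  unfold highMoment
  ring

lemma lowMoment_zero (c : ℝ) : P c 0 = 0 := by
  simp [lowMoment, Real.zero_rpow H.mu_pos.ne']

lemma continuousAt_lowMoment (c : ℝ) {x : ℝ} (hx : 0 < x) : ContinuousAt (P c) x := by
  have hprim : ContinuousAt (fun y => ∫ s in (0 : ℝ)..y, s ^ (μ - 1) * h s) x := by
    refine (intervalIntegral.continuousOn_primitive_interval'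
      (H.intervalIntegrable_low le_rfl (by linarith)) left_mem_uIcc).continuousAt
      (s := uIcc 0 (x + 1)) ?_
    rw [uIcc_of_le (by linarith)]
    exact Icc_mem_nhds hx (by linarith)
  exact (hprim.const_mul μ).add ((Real.continuousAt_rpow_const x μ (Or.inl hx.ne')).const_mul c)

lemma continuousAt_highMoment (c : ℝ) {x : ℝ} (hx : 0 < x) : ContinuousAt (Q c) x := by
  have hprim : ContinuousAt (fun y => ∫ s in (x / 2)..y, s ^ (-n - 1) * h s) x := by
    refine (intervalIntegral.continuousOn_primitive_interval'
      (H.intervalIntegrable_high (by linarith) (by linarith)) left_mem_uIcc).continuousAt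
      (s := uIcc (x / 2) (x + 1)) ?_
    rw [uIcc_of_le (by linarith)]
    exact Icc_mem_nhds (by linarith) (by linarith)
  have htail : ContinuousAt (fun y => ∫ s in Ioi y, s ^ (-n - 1) * h s) x := by
    refine ((continuousAt_const (y := ∫ s in Ioi (x / 2), s ^ (-n - 1) * h s)).sub hprim).congr ?_
    filter_upwards [eventually_gt_nhds hx] with y hy
    simp only [Pi.sub_apply]
    rw [← intervalIntegral.integral_Ioi_sub_Ioi' (H.integrableOn_high _ (half_pos hx))
      (H.integrableOn_high y hy)]
    ring
  exact (htail.const_mul n).add ((Real.continuousAt_rpow_const x (-n) (Or.inl hx.ne')).const_mul c)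

lemma continuousOn_lowMoment (c : ℝ) {s : Set ℝ} (hs : ∀ x ∈ s, 0 < x) : ContinuousOn (P c) s :=
  fun x hx => (H.continuousAt_lowMoment c (hs x hx)).continuousWithinAt

lemma continuousOn_highMoment (c : ℝ) {s : Set ℝ} (hs : ∀ x ∈ s, 0 < x) : ContinuousOn (Q c) s :=
  fun x hx => (H.continuousAt_highMoment c (hs x hx)).continuousWithinAt

lemma rpow_lt {x y : ℝ} (hx : 0 ≤ x) (hxy : x < y) : x ^ (n + μ) < y ^ (n + μ) :=
  Real.rpow_lt_rpow hx hxy H.add_pos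

lemma rpow_le {x y : ℝ} (hx : 0 ≤ x) (hxy : x ≤ y) : x ^ (n + μ) ≤ y ^ (n + μ) :=
  Real.rpow_le_rpow hx hxy H.add_pos.le

end HasMoments

/-- `h` is a payoff for the exponents `-μ` and `n`: it has the corresponding moments, increases to
`∞` and is right-continuous on `(0, ∞)`. -/
structure Payoff (μ n : ℝ) (h : ℝ → ℝ) : Prop extends HasMoments μ n h where
  right_cont : ∀ x, 0 < x → ContinuousWithinAt h (Ici x) x
  mono : MonotoneOn h (Ioi 0)
  tendsto_top : Tendsto h atTop atTop

/-- Up to a positive factor `x ^ (-μ - 1)` this is the derivative at `x` of the resolvent of `h`. As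
a function of `x ^ (n + μ)` it is concave. -/
noncomputable def resolventSlope (μ n : ℝ) (h : ℝ → ℝ) (x : ℝ) : ℝ :=
  x ^ (n + μ) * highMoment n h 0 x - lowMoment μ h 0 x

/-- The position of the point `(a, b)` of the plane relative to the line through
`(lowMoment μ h c x, highMoment n h c x)` of direction `(x ^ μ, x ^ (-n))`: it vanishes when the
point is on this line, which does not depend on `c`. -/
noncomputable def lineGap (μ n : ℝ) (h : ℝ → ℝ) (a b x : ℝ) : ℝ :=
  resolventSlope μ n h x + a - b * x ^ (n + μ)

section realAnalysis

lemma strictMonoOn_of_eventually_lt_right {X Y : Type*} [ConditionallyCompleteLinearOrder X]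
    [DenselyOrdered X] [TopologicalSpace X] [OrderTopology X] [LinearOrder Y] [TopologicalSpace Y]
    [OrderClosedTopology Y] {f : X → Y} {s : Set X} (hs : s.OrdConnected) (hf : ContinuousOn f s)
    (hlt : ∀ x ∈ s, ∀ᶠ y in 𝓝[>] x, y ∈ s → f x < f y) : StrictMonoOn f s := by
  have le_of_lt : ∀ a ∈ s, ∀ b ∈ s, a < b → f a ≤ f b := by
    intro a ha b hb hab
    have hIcc : Icc a b ⊆ s := hs.out ha hb
    have hclosed : IsClosed ({x | f a ≤ f x} ∩ Icc a b) := by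
      rw [inter_comm]
      exact (hf.mono hIcc).preimage_isClosed_of_isClosed isClosed_Icc isClosed_Ici
    refine hclosed.Icc_subset_of_forall_exists_gt (le_refl (f a)) ?_ (right_mem_Icc.2 hab.le)
    rintro x ⟨hax, hx⟩ y hy
    have := nhdsGT_neBot_of_exists_gt ⟨y, hy⟩
    obtain ⟨z, hxz, hz⟩ :=
      ((hlt x (hIcc (Ico_subset_Icc_self hx))).and (Ioc_mem_nhdsGT (lt_min hy hx.2))).exists
    have hzs := hIcc ⟨hx.1.trans hz.1.le, hz.2.trans (min_le_right y b)⟩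
    exact ⟨z, le_trans hax (hxz hzs).le, hz.1, hz.2.trans (min_le_left y b)⟩
  intro a ha b hb hab
  have := nhdsGT_neBot_of_exists_gt ⟨b, hab⟩
  obtain ⟨z, haz, hz⟩ := ((hlt a ha).and (Ioo_mem_nhdsGT hab)).exists
  have hzs := hs.out ha hb (Ioo_subset_Icc_self hz)
  exact (haz hzs).trans_le (le_of_lt z hzs b hb hz.2)

lemma continuousOn_invFunOn_image {X Y : Type*} [TopologicalSpace X] [TopologicalSpace Y]
    [T2Space Y] [Nonempty X] {f : X → Y} {s : Set X} (hs : IsCompact s) (hf : ContinuousOn f s)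
    (hinj : InjOn f s) : ContinuousOn (Function.invFunOn f s) (f '' s) := by
  rw [continuousOn_iff_isClosed]
  intro t ht
  refine ⟨f '' (s ∩ t),
    ((hs.inter_right ht).image_of_continuousOn (hf.mono inter_subset_left)).isClosed, ?_⟩
  ext y
  constructor
  · rintro ⟨hyt, hy⟩
    exact ⟨⟨_, ⟨Function.invFunOn_mem hy, hyt⟩, Function.invFunOn_eq hy⟩, hy⟩
  · rintro ⟨⟨x, ⟨hxs, hxt⟩, rfl⟩, hy⟩
    exact ⟨by rwa [mem_preimage, hinj.leftInvOn_invFunOn hxs], hy⟩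

lemma rpow_add_mul_rpow_neg (μ n : ℝ) {x : ℝ} (hx : 0 < x) :
    x ^ (n + μ) * x ^ (-n) = x ^ μ := by
  rw [← Real.rpow_add hx]; ring_nf

/- The curve `z ↦ (z ^ μ, z ^ (-n))` lies strictly on one side of its tangent at `z = d`. -/
lemma rpow_slope_lt {μ n z d : ℝ} (hμ : 0 < μ) (hn : 0 < n) (hz : 0 < z) (hd : 0 < d)
    (hzd : z ≠ d) :
    μ / n * d ^ (n + μ) * (d ^ (-n) - z ^ (-n)) < z ^ μ - d ^ μ := by
  set u := Real.log z - Real.log d with hu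
  have hu0 : u ≠ 0 := fun h0 => hzd (Real.log_injOn_pos hz hd (by linarith))
  have rpow_eq : ∀ e : ℝ, z ^ e = d ^ e * Real.exp (e * u) := by
    intro e
    rw [Real.rpow_def_of_pos hz, Real.rpow_def_of_pos hd, ← Real.exp_add, hu]; ring_nf
  have exp_gt := Real.add_one_lt_exp (mul_ne_zero hμ.ne' hu0)
  have exp_neg_gt := Real.add_one_lt_exp (mul_ne_zero (neg_ne_zero.2 hn.ne') hu0)
  calc μ / n * d ^ (n + μ) * (d ^ (-n) - z ^ (-n))
      = d ^ μ * (μ / n * (1 - Real.exp (-n * u))) := by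
        rw [rpow_eq (-n), ← rpow_add_mul_rpow_neg μ n hd]; ring
    _ < d ^ μ * (μ / n * (n * u)) := by gcongr; linarith
    _ = d ^ μ * (μ * u) := by field_simp
    _ < d ^ μ * (Real.exp (μ * u) - 1) := by gcongr; linarith
    _ = z ^ μ - d ^ μ := by rw [rpow_eq μ]; ring

lemma rpow_slope_le {μ n z d : ℝ} (hμ : 0 < μ) (hn : 0 < n) (hz : 0 < z) (hd : 0 < d) :
    μ / n * d ^ (n + μ) * (d ^ (-n) - z ^ (-n)) ≤ z ^ μ - d ^ μ := by
  rcases eq_or_ne z d with rfl | hzd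
  · simp
  · exact (rpow_slope_lt hμ hn hz hd hzd).le

end realAnalysis

namespace HasMoments

variable {μ n : ℝ} {h : ℝ → ℝ} (H : HasMoments μ n h)
include H

lemma rpow_neg_lt {x y : ℝ} (hx : 0 < x) (hxy : x < y) : y ^ (-n) < x ^ (-n) :=
  Real.rpow_lt_rpow_of_neg hx hxy (neg_lt_zero.2 H.n_pos)

lemma rpow_neg_le {x y : ℝ} (hx : 0 < x) (hxy : x ≤ y) : y ^ (-n) ≤ x ^ (-n) :=
  Real.rpow_le_rpow_of_nonpos hx hxy (neg_nonpos.2 H.n_pos.le)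

lemma rpow_mu_lt {x y : ℝ} (hx : 0 ≤ x) (hxy : x < y) : x ^ μ < y ^ μ :=
  Real.rpow_lt_rpow hx hxy H.mu_pos

lemma lt_of_rpow_neg_lt {x y : ℝ} (hy : 0 < y) (hxy : y ^ (-n) < x ^ (-n)) : x < y := by
  contrapose! hxy
  exact H.rpow_neg_le hy hxy

end HasMoments

section lineGap

variable {μ n : ℝ} {h : ℝ → ℝ}

local notation "P" => lowMoment μ h
local notation "Q" => highMoment n h

lemma resolventSlope_eq (c : ℝ) {x : ℝ} (hx : 0 < x) :
    resolventSlope μ n h x = x ^ (n + μ) * Q c x - P c x := by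
  rw [resolventSlope, highMoment_eq_add c 0, lowMoment_eq_add c 0]
  linear_combination (-c) * rpow_add_mul_rpow_neg μ n hx

lemma lineGap_eq (c a b : ℝ) {x : ℝ} (hx : 0 < x) :
    lineGap μ n h a b x = (a - P c x) + x ^ (n + μ) * (Q c x - b) := by
  rw [lineGap, resolventSlope_eq c hx]; ring

lemma lineGap_eq_zero {c a b x : ℝ} (hx : 0 < x) (ha : P c x = a) (hb : Q c x = b) :
    lineGap μ n h a b x = 0 := by
  rw [lineGap_eq c a b hx, ha, hb]; ring

lemma exists_moments_eq_of_lineGap_eq_zero {a b x : ℝ} (hx : 0 < x) (hg : lineGap μ n h a b x = 0) :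
    ∃ c, P c x = a ∧ Q c x = b := by
  have hlow : P ((a - P 0 x) / x ^ μ) x = a := by
    rw [lowMoment_eq_add _ 0, sub_zero, div_mul_cancel₀ _ (Real.rpow_pos_of_pos hx μ).ne']
    ring
  refine ⟨_, hlow, sub_eq_zero.1 ?_⟩
  rw [lineGap_eq _ a b hx, hlow, sub_self, zero_add] at hg
  exact (mul_eq_zero.1 hg).resolve_left (Real.rpow_pos_of_pos hx _).ne'

end lineGap

namespace HasMoments

variable {μ n : ℝ} {h : ℝ → ℝ} (H : HasMoments μ n h)

local notation "P" => lowMoment μ h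
local notation "Q" => highMoment n h

include H

lemma lineGap_neg_left {c x y : ℝ} (hx : 0 < x) (hxy : x < y) (hc : ∀ s ∈ Ioo x y, h s + c < 0) :
    lineGap μ n h (P c y) (Q c y) x < 0 := by
  rw [lineGap_eq c _ _ hx]
  have := Real.rpow_pos_of_pos hx (n + μ)
  nlinarith [H.lowMoment_lt_of_neg hx.le hxy hc, H.highMoment_lt_of_neg hx hxy hc]

lemma lineGap_pos_left {c x y : ℝ} (hx : 0 < x) (hxy : x < y) (hc : ∀ s ∈ Ioo x y, 0 < h s + c) :
    0 < lineGap μ n h (P c y) (Q c y) x := by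
  rw [lineGap_eq c _ _ hx]
  have := Real.rpow_pos_of_pos hx (n + μ)
  nlinarith [H.lowMoment_lt_of_pos hx.le hxy hc, H.highMoment_lt_of_pos hx hxy hc]

lemma continuousOn_lineGap (a b : ℝ) {s : Set ℝ} (hs : ∀ x ∈ s, 0 < x) :
    ContinuousOn (lineGap μ n h a b) s := by
  have hpow : ContinuousOn (fun x : ℝ => x ^ (n + μ)) s := fun x hx =>
    (Real.continuousAt_rpow_const x _ (Or.inl (hs x hx).ne')).continuousWithinAt
  exact (((hpow.mul (H.continuousOn_highMoment 0 hs)).sub (H.continuousOn_lowMoment 0 hs)).add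
    continuousOn_const).sub (continuousOn_const.mul hpow)

end HasMoments

namespace Payoff

variable {μ n : ℝ} {h : ℝ → ℝ} (H : Payoff μ n h)

local notation "P" => lowMoment μ h
local notation "Q" => highMoment n h
local notation "V" => resolventSlope μ n h

include H

lemma apply_le {x y : ℝ} (hx : 0 < x) (hxy : x ≤ y) : h x ≤ h y := H.mono hx (hx.trans_le hxy) hxy

lemma exists_crossing (c : ℝ) :
    ∃ t, 0 ≤ t ∧ (∀ s, 0 < s → s < t → h s ≤ c) ∧ ∀ s, t < s → c < h s := by
  set S := {s : ℝ | 0 < s ∧ c < h s}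
  have hne : S.Nonempty := by
    obtain ⟨x, hcx, hx⟩ :=
      ((H.tendsto_top.eventually_gt_atTop c).and (eventually_gt_atTop (0 : ℝ))).exists
    exact ⟨x, hx, hcx⟩
  have hbdd : BddBelow S := ⟨0, fun x hx => hx.1.le⟩
  refine ⟨sInf S, le_csInf hne fun x hx => hx.1.le, fun s hs hst => ?_, fun s hs => ?_⟩
  · by_contra! hc
    exact (csInf_le hbdd (show s ∈ S from ⟨hs, hc⟩)).not_gt hst
  · obtain ⟨x, hx, hxs⟩ := exists_lt_of_csInf_lt hne hs
    exact hx.2.trans_le (H.apply_le hx.1 hxs.le)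

section zero

variable {e d x y : ℝ}

lemma highMoment_pos_of_le (hx : 0 < x) (he : e ≤ h x) : 0 < Q (-e) x := by
  obtain ⟨y, hey, hxy⟩ :=
    ((H.tendsto_top.eventually_gt_atTop e).and (eventually_gt_atTop x)).exists
  have hy : 0 < y := hx.trans hxy
  calc 0 ≤ Q (-e) (y + 1) := H.highMoment_nonneg (by linarith) fun s hs => by
        linarith [H.apply_le hy (show y ≤ s by linarith)]
    _ < Q (-e) y := H.highMoment_lt_of_pos hy (by linarith) fun s hs => by
        linarith [H.apply_le hy hs.1.le]
    _ ≤ Q (-e) x := H.highMoment_le_of_nonneg hx hxy.le fun s hs => by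
        linarith [H.apply_le hx hs.1.le]

lemma highMoment_lt_of_lt (hx : 0 < x) (hxy : x < y) (he : h y < e) : Q (-e) x < Q (-e) y :=
  H.highMoment_lt_of_neg hx hxy fun s hs => by linarith [H.apply_le (hx.trans hs.1) hs.2.le]

lemma exists_highMoment_neg (hy : 0 < y) (he : h y < e) : ∃ x, 0 < x ∧ x < y ∧ Q (-e) x < 0 := by
  have hblow : Tendsto (fun x : ℝ => x ^ (-n)) (𝓝[>] 0) atTop :=
    tendsto_rpow_neg_nhdsGT_zero (neg_lt_zero.2 H.n_pos)
  obtain ⟨x, hlarge, hx, hxy⟩ := ((hblow.eventually_gt_atTop (Q (-h y) y / (e - h y))).and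
    (Ioo_mem_nhdsGT hy)).exists
  refine ⟨x, hx, hxy, ?_⟩
  have hle : Q (-h y) x ≤ Q (-h y) y := H.highMoment_le_of_nonpos hx hxy.le fun s hs => by
    linarith [H.apply_le (hx.trans hs.1) hs.2.le]
  rw [div_lt_iff₀ (sub_pos.2 he)] at hlarge
  linarith [highMoment_eq_add (n := n) (h := h) (-e) (-h y) x]

lemma exists_highMoment_eq_zero (hy : 0 < y) (he : h y < e) : ∃ d, 0 < d ∧ Q (-e) d = 0 := by
  obtain ⟨x, hx, -, hQx⟩ := H.exists_highMoment_neg hy he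
  obtain ⟨z, hez, hxz⟩ :=
    ((H.tendsto_top.eventually_gt_atTop e).and (eventually_gt_atTop x)).exists
  obtain ⟨d, hd, hQd⟩ := intermediate_value_Ioo hxz.le
    (H.continuousOn_highMoment (-e) fun s (hs : s ∈ Icc x z) => hx.trans_le hs.1)
    ⟨hQx, H.highMoment_pos_of_le (hx.trans hxz) hez.le⟩
  exact ⟨d, hx.trans hd.1, hQd⟩

lemma lt_of_highMoment_eq_zero (hd : 0 < d) (hQ : Q (-e) d = 0) : h d < e := by
  by_contra! hc
  exact (H.highMoment_pos_of_le hd hc).ne' hQ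

lemma highMoment_neg_of_lt (hd : 0 < d) (hQ : Q (-e) d = 0) (hx : 0 < x) (hxd : x < d) :
    Q (-e) x < 0 :=
  hQ ▸ H.highMoment_lt_of_lt hx hxd (H.lt_of_highMoment_eq_zero hd hQ)

lemma highMoment_pos_of_lt (hd : 0 < d) (hQ : Q (-e) d = 0) (hdx : d < x) : 0 < Q (-e) x := by
  rcases lt_or_ge (h x) e with he | he
  · exact hQ ▸ H.highMoment_lt_of_lt hd hdx he
  · exact H.highMoment_pos_of_le (hd.trans hdx) he

lemma highMoment_neg_iff (hd : 0 < d) (hQ : Q (-e) d = 0) (hx : 0 < x) : Q (-e) x < 0 ↔ x < d := by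
  refine ⟨fun hneg => ?_, H.highMoment_neg_of_lt hd hQ hx⟩
  by_contra! hdx
  rcases hdx.eq_or_lt with rfl | hdx
  · exact hneg.ne hQ
  · exact hneg.not_gt (H.highMoment_pos_of_lt hd hQ hdx)

lemma highMoment_pos_iff (hd : 0 < d) (hQ : Q (-e) d = 0) (hx : 0 < x) : 0 < Q (-e) x ↔ d < x := by
  refine ⟨fun hpos => ?_, H.highMoment_pos_of_lt hd hQ⟩
  by_contra! hxd
  rcases hxd.eq_or_lt with rfl | hxd
  · exact hpos.ne' hQ
  · exact hpos.not_gt (H.highMoment_neg_of_lt hd hQ hx hxd)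

lemma eq_of_highMoment_eq_zero (hd : 0 < d) (hQ : Q (-e) d = 0) (hx : 0 < x)
    (hQx : Q (-e) x = 0) : x = d :=
  le_antisymm (not_lt.1 fun hdx => (H.highMoment_pos_of_lt hd hQ hdx).ne' hQx)
    (not_lt.1 fun hxd => (H.highMoment_neg_of_lt hd hQ hx hxd).ne hQx)

end zero

lemma tendsto_lowMoment (c : ℝ) : Tendsto (P c) atTop atTop := by
  obtain ⟨y, hc, hy⟩ :=
    ((H.tendsto_top.eventually_ge_atTop (1 - c)).and (eventually_gt_atTop (0 : ℝ))).exists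
  have hpow : Tendsto (fun x : ℝ => P (c - 1) y + x ^ μ) atTop atTop :=
    tendsto_atTop_add_const_left _ _ (tendsto_rpow_atTop H.mu_pos)
  refine tendsto_atTop_mono' _ ?_ hpow
  filter_upwards [eventually_ge_atTop y] with x hx
  have hle : P (c - 1) y ≤ P (c - 1) x := H.lowMoment_le_of_nonneg hy.le hx fun s hs => by
    linarith [H.apply_le hy hs.1.le]
  rw [lowMoment_eq_add c (c - 1)]
  linarith

lemma highMoment_self_nonneg {x : ℝ} (hx : 0 < x) : 0 ≤ Q (-h x) x :=
  H.highMoment_nonneg hx fun s hs => by linarith [H.apply_le hx hs.le]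

lemma resolventSlope_le_tangent {x z : ℝ} (hx : 0 < x) (hz : 0 < z) :
    V z ≤ V x + (z ^ (n + μ) - x ^ (n + μ)) * Q (-h x) x := by
  rw [resolventSlope_eq (-h x) hx, resolventSlope_eq (-h x) hz]
  have hzpow : 0 ≤ z ^ (n + μ) := Real.rpow_nonneg hz.le _
  rcases le_total x z with hxz | hxz
  · have hs : ∀ s ∈ Ioo x z, 0 ≤ h s + -h x := fun s hs => by
      linarith [H.apply_le hx hs.1.le]
    nlinarith [H.lowMoment_le_of_nonneg hx.le hxz hs, H.highMoment_le_of_nonneg hx hxz hs]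
  · have hs : ∀ s ∈ Ioo z x, h s + -h x ≤ 0 := fun s hs => by
      linarith [H.apply_le (hz.trans hs.1) hs.2.le]
    nlinarith [H.lowMoment_le_of_nonpos hz.le hxz hs, H.highMoment_le_of_nonpos hz hxz hs]

lemma resolventSlope_mono {x z : ℝ} (hx : 0 < x) (hxz : x ≤ z) : V x ≤ V z := by
  have hz : 0 < z := hx.trans_le hxz
  nlinarith [H.resolventSlope_le_tangent hz hx, H.rpow_le hx.le hxz, H.highMoment_self_nonneg hz]

lemma lineGap_le_tangent (a b : ℝ) {x z : ℝ} (hx : 0 < x) (hz : 0 < z) :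
    lineGap μ n h a b z ≤
      lineGap μ n h a b x + (z ^ (n + μ) - x ^ (n + μ)) * (Q (-h x) x - b) := by
  unfold lineGap
  linarith [H.resolventSlope_le_tangent hx hz]

lemma lineGap_pos_of_mem_Ioo {a b x y z : ℝ} (hx : 0 < x) (hxy : x < y) (hyz : y < z)
    (hgx : 0 ≤ lineGap μ n h a b x) (hgz : 0 ≤ lineGap μ n h a b z)
    (hpos : 0 < lineGap μ n h a b x ∨ 0 < lineGap μ n h a b z) : 0 < lineGap μ n h a b y := by
  have hy := hx.trans hxy
  have tangent_x := H.lineGap_le_tangent a b hy hx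
  have tangent_z := H.lineGap_le_tangent a b hy (hy.trans hyz)
  have hxy' := H.rpow_lt hx.le hxy
  have hyz' := H.rpow_lt hy.le hyz
  rcases lt_trichotomy (Q (-h y) y - b) 0 with hψ | hψ | hψ
  · nlinarith
  · rw [hψ, mul_zero, add_zero] at tangent_x tangent_z
    rcases hpos with hpos | hpos <;> linarith
  · nlinarith

lemma lineGap_nonneg {a b x y z : ℝ} (hx : 0 < x) (hxy : x ≤ y) (hyz : y ≤ z)
    (hgx : 0 ≤ lineGap μ n h a b x) (hgz : 0 ≤ lineGap μ n h a b z) : 0 ≤ lineGap μ n h a b y := by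
  have hy := hx.trans_le hxy
  have tangent_x := H.lineGap_le_tangent a b hy hx
  have tangent_z := H.lineGap_le_tangent a b hy (hy.trans_le hyz)
  have hxy' := H.rpow_le hx.le hxy
  have hyz' := H.rpow_le hy.le hyz
  rcases le_total (Q (-h y) y - b) 0 with hψ | hψ <;> nlinarith

end Payoff

/-- The solution `z > 0` of `E * z ^ (-n) = y`. -/
noncomputable def negPowRoot (n E y : ℝ) : ℝ := (y / E) ^ (-(1 / n))

section negPowRoot

variable {n E y z : ℝ}

lemma negPowRoot_pos (hE : 0 < E) (hy : 0 < y) : 0 < negPowRoot n E y :=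
  Real.rpow_pos_of_pos (div_pos hy hE) _

lemma mul_negPowRoot (hn : 0 < n) (hE : 0 < E) (hy : 0 < y) : E * negPowRoot n E y ^ (-n) = y := by
  have hexp : -(1 / n) * -n = 1 := by field_simp
  rw [negPowRoot, ← Real.rpow_mul (div_pos hy hE).le, hexp, Real.rpow_one]
  field_simp

lemma negPowRoot_eq (hn : 0 < n) (hE : 0 < E) (hz : 0 < z) (hy : E * z ^ (-n) = y) :
    negPowRoot n E y = z := by
  have hexp : -n * -(1 / n) = 1 := by field_simp
  rw [negPowRoot, ← hy, mul_div_cancel_left₀ _ hE.ne', ← Real.rpow_mul hz.le, hexp, Real.rpow_one]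

lemma negPowRoot_lt_iff (hn : 0 < n) (hE : 0 < E) (hy : 0 < y) (hz : 0 < z) :
    negPowRoot n E y < z ↔ E * z ^ (-n) < y := by
  conv_rhs => rw [← mul_negPowRoot hn hE hy]
  rw [mul_lt_mul_iff_right₀ hE,
    Real.rpow_lt_rpow_iff_of_neg hz (negPowRoot_pos hE hy) (neg_lt_zero.2 hn)]

lemma continuousAt_negPowRoot (hE : 0 < E) (hy : 0 < y) : ContinuousAt (negPowRoot n E) y :=
  (continuousAt_id.div_const E).rpow_const (Or.inl (div_pos hy hE).ne')

end negPowRoot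

/-- `(z, a)` solves the equations of the case without switch-out region for the points `ζ`, `α`: the
curve `C_c = (lowMoment μ h c, highMoment n h c)` satisfies
`C_{-k}(a) - C_{-E}(d) = E (z ^ μ, z ^ (-n))`, where `C_{-E}(d)` has second coordinate `0`. -/
structure IsEntryPair (μ n : ℝ) (h : ℝ → ℝ) (E k d z a : ℝ) : Prop where
  z_pos : 0 < z
  z_lt : z < a
  d_lt : d < a
  lowMoment_eq : lowMoment μ h (-k) a - lowMoment μ h (-E) d = E * z ^ μ
  highMoment_eq : highMoment n h (-k) a = E * z ^ (-n)

/-- The amount by which the first equation of `IsEntryPair` fails at `a = x`, when `z` is chosen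
such that the second one holds. -/
noncomputable def pairExcess (μ n : ℝ) (h : ℝ → ℝ) (E k d x : ℝ) : ℝ :=
  lowMoment μ h (-k) x - lowMoment μ h (-E) d - E * negPowRoot n E (highMoment n h (-k) x) ^ μ

namespace Payoff

variable {μ n : ℝ} {h : ℝ → ℝ} (H : Payoff μ n h) {E k d x z : ℝ}

local notation "P" => lowMoment μ h
local notation "Q" => highMoment n h
local notation "F" => pairExcess μ n h

lemma lowMoment_neg_add (E k x : ℝ) : P (-(E + k)) x = P (-k) x - E * x ^ μ := by
  rw [lowMoment_eq_add (-(E + k)) (-k)]; ring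

lemma highMoment_neg_add (E k x : ℝ) : Q (-(E + k)) x = Q (-k) x - E * x ^ (-n) := by
  rw [highMoment_eq_add (-(E + k)) (-k)]; ring

include H

lemma continuousAt_negPowRoot_highMoment (hE : 0 < E) (hx : 0 < x) (hQ : 0 < Q (-k) x) :
    ContinuousAt (fun y => negPowRoot n E (Q (-k) y)) x :=
  ContinuousAt.comp (f := Q (-k)) (continuousAt_negPowRoot hE hQ) (H.continuousAt_highMoment _ hx)

lemma continuousAt_pairExcess (hE : 0 < E) (hx : 0 < x) (hQ : 0 < Q (-k) x) :
    ContinuousAt (F E k d) x :=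
  ((H.continuousAt_lowMoment _ hx).sub continuousAt_const).sub
    (((H.continuousAt_negPowRoot_highMoment hE hx hQ).rpow_const
      (Or.inl (negPowRoot_pos hE hQ).ne')).const_mul E)

lemma pairExcess_eq (hE : 0 < E) (hz : 0 < z) (hQ : Q (-k) x = E * z ^ (-n)) :
    F E k d x = P (-k) x - P (-E) d - E * z ^ μ := by
  rw [pairExcess, negPowRoot_eq H.n_pos hE hz hQ.symm]

lemma pairExcess_neg_of_le (hE : 0 < E) (hk : 0 < k) (hd : 0 < d) (hQd : Q (-E) d = 0)
    (hdx : d < x) (hQ : 0 < Q (-k) x) (hx : ∀ s ∈ Ioo d x, h s ≤ k) : F E k d x < 0 := by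
  have hn := H.n_pos
  have hμ := H.mu_pos
  have hz := negPowRoot_pos (n := n) hE hQ
  have hzQ := mul_negPowRoot hn hE hQ
  set z := negPowRoot n E (Q (-k) x)
  rw [H.pairExcess_eq hE hz hzQ.symm]
  have chord := H.le_slope_of_nonpos (c := -k) (T := d) hd hdx.le fun s hs =>
    mul_nonpos_of_nonneg_of_nonpos (sub_nonneg.2 (H.rpow_le hd.le hs.1.le))
      (by linarith [hx s hs])
  have hQk := highMoment_eq_add (n := n) (h := h) (-k) (-E) d
  rw [hQd, zero_add] at hQk
  rw [lowMoment_eq_add (-k) (-E) d, hQk, ← hzQ] at chord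
  have tangent := mul_le_mul_of_nonneg_left (rpow_slope_le hμ hn hz hd) hE.le
  have hcost : 0 < k * (d ^ μ + μ / n * d ^ (n + μ) * d ^ (-n)) := by positivity
  linear_combination chord + tangent + hcost

lemma pairExcess_lt_of_near {w v : ℝ} (hE : 0 < E) (hw : 0 < w) (hwv : w < v)
    (hk : ∀ s ∈ Ioo w v, k < h s) (hQv : 0 < Q (-k) v) (hz : negPowRoot n E (Q (-k) v) ≤ w) :
    F E k d w < F E k d v := by
  have hn := H.n_pos
  have hμ := H.mu_pos
  have hQlt : Q (-k) v < Q (-k) w := H.highMoment_lt_of_pos hw hwv fun s hs => by linarith [hk s hs]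
  have hQw := hQv.trans hQlt
  have hy := negPowRoot_pos (n := n) hE hQv
  have hyQ := mul_negPowRoot hn hE hQv
  have hz' := negPowRoot_pos (n := n) hE hQw
  have hzQ := mul_negPowRoot hn hE hQw
  set y := negPowRoot n E (Q (-k) v)
  set z := negPowRoot n E (Q (-k) w)
  rw [H.pairExcess_eq hE hy hyQ.symm, H.pairExcess_eq hE hz' hzQ.symm]
  have chord := H.slope_lt_of_pos (c := -k) (T := w) hw hwv fun s hs =>
    mul_pos (sub_pos.2 (H.rpow_lt hw.le hs.1)) (by linarith [hk s hs])
  have tangent := mul_le_mul_of_nonneg_left (rpow_slope_le hμ hn hz' hy) hE.le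
  have slopes : μ / n * y ^ (n + μ) * (Q (-k) w - Q (-k) v) ≤
      μ / n * w ^ (n + μ) * (Q (-k) w - Q (-k) v) := by
    have := H.rpow_le hy.le hz
    have := sub_pos.2 hQlt
    gcongr
  have tangent_eq : E * (μ / n * y ^ (n + μ) * (y ^ (-n) - z ^ (-n))) =
      -(μ / n * y ^ (n + μ) * (Q (-k) w - Q (-k) v)) := by
    rw [← hyQ, ← hzQ]; ring
  linarith

lemma strictMonoOn_pairExcess {a : ℝ} (hE : 0 < E) (ha : 0 < a)
    (hQ : ∀ x, a < x → E * x ^ (-n) < Q (-k) x) (hk : ∀ x, a < x → k < h x) :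
    StrictMonoOn (F E k d) (Ioi a) := by
  have hpos : ∀ x, a < x → 0 < x := fun x hx => ha.trans hx
  have hQpos : ∀ x, a < x → 0 < Q (-k) x := fun x hx =>
    (mul_pos hE (Real.rpow_pos_of_pos (hpos x hx) _)).trans (hQ x hx)
  refine strictMonoOn_of_eventually_lt_right ordConnected_Ioi (fun x hx =>
    (H.continuousAt_pairExcess hE (hpos x hx) (hQpos x hx)).continuousWithinAt) fun w hw => ?_
  have hroot : negPowRoot n E (Q (-k) w) < w :=
    (negPowRoot_lt_iff H.n_pos hE (hQpos w hw) (hpos w hw)).2 (hQ w hw)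
  have hcont := H.continuousAt_negPowRoot_highMoment hE (hpos w hw) (hQpos w hw)
  filter_upwards [(hcont.eventually_lt continuousAt_const hroot).filter_mono nhdsWithin_le_nhds,
    self_mem_nhdsWithin] with v hv hwv _
  exact H.pairExcess_lt_of_near hE (hpos w hw) hwv (fun s hs => hk s (lt_trans hw hs.1))
    (hQpos v (lt_trans hw hwv)) hv.le

lemma lt_pairExcess (hE : 0 < E) (hx : 0 < x) (hQ : E * x ^ (-n) < Q (-k) x) :
    P (-(E + k)) x - P (-E) d < F E k d x := by
  have hQpos : 0 < Q (-k) x := (mul_pos hE (Real.rpow_pos_of_pos hx _)).trans hQ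
  have hroot := (negPowRoot_lt_iff H.n_pos hE hQpos hx).2 hQ
  have hpow := H.rpow_mu_lt (negPowRoot_pos hE hQpos).le hroot
  rw [lowMoment_neg_add]
  unfold pairExcess
  nlinarith

section entry

variable (hE : 0 < E) (hk : 0 < k) (hd : 0 < d) (hQd : highMoment n h (-E) d = 0)
include hE hk hd hQd

omit hE in
lemma exists_entryRegion : ∃ a, d < a ∧ Q (-k) a = E * a ^ (-n) ∧
    ∀ x, 0 < x → (E * x ^ (-n) < Q (-k) x ↔ a < x) := by
  have hde : h d < E + k := by linarith [H.lt_of_highMoment_eq_zero hd hQd]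
  obtain ⟨a, ha, hQa⟩ := H.exists_highMoment_eq_zero hd hde
  have hQd' : Q (-(E + k)) d < 0 := by
    have := highMoment_neg_add (n := n) (h := h) k E d
    rw [add_comm k E, hQd] at this
    linarith [mul_pos hk (Real.rpow_pos_of_pos hd (-n))]
  refine ⟨a, (H.highMoment_neg_iff ha hQa hd).1 hQd',
    by linarith [highMoment_neg_add (n := n) (h := h) E k a], fun x hx => ?_⟩
  rw [← H.highMoment_pos_iff ha hQa hx, highMoment_neg_add, sub_pos]

omit hQd in
lemma pairExcess_neg_of_eq {a : ℝ} (hda : d < a) (hQa : Q (-k) a = E * a ^ (-n)) :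
    F E k d a < 0 := by
  have ha := hd.trans hda
  have hhd : h a < E + k :=
    H.lt_of_highMoment_eq_zero ha (by rw [highMoment_neg_add, hQa, sub_self])
  have hle : P (-(E + k)) a ≤ P (-(E + k)) d := H.lowMoment_le_of_nonpos hd.le hda.le fun s hs => by
    linarith [H.apply_le (hd.trans hs.1) hs.2.le]
  have hd_eq : P (-(E + k)) d = P (-E) d - k * d ^ μ := by rw [add_comm, lowMoment_neg_add]
  rw [H.pairExcess_eq hE ha hQa]
  linarith [lowMoment_neg_add (μ := μ) (h := h) E k a, mul_pos hk (Real.rpow_pos_of_pos hd μ)]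

lemma exists_pairExcess_neg_and_strictMonoOn :
    ∃ a₀ a₁, d < a₀ ∧ a₀ ≤ a₁ ∧ (∀ x, 0 < x → (E * x ^ (-n) < Q (-k) x ↔ a₀ < x)) ∧
      (∀ x ∈ Icc a₀ a₁, 0 < Q (-k) x ∧ F E k d x < 0) ∧ StrictMonoOn (F E k d) (Ioi a₁) ∧
      ∃ t ≤ a₁, ∀ x, t < x → k < h x := by
  obtain ⟨a₀, hda₀, hQa₀, region⟩ := H.exists_entryRegion hk hd hQd
  obtain ⟨t, -, h_le, lt_h⟩ := H.exists_crossing k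
  have ha₀ := hd.trans hda₀
  refine ⟨a₀, max a₀ t, hda₀, le_max_left _ _, region, fun x hx => ?_, ?_,
    t, le_max_right _ _, lt_h⟩
  · have hpow := mul_pos hE (Real.rpow_pos_of_pos (ha₀.trans_le hx.1) (-n))
    rcases hx.1.eq_or_lt with rfl | hax
    · exact ⟨hQa₀ ▸ hpow, H.pairExcess_neg_of_eq hE hk hd hda₀ hQa₀⟩
    · have hQx := hpow.trans ((region x (ha₀.trans hax)).2 hax)
      have hxt : x ≤ t := (le_max_iff.1 hx.2).resolve_left hax.not_ge
      exact ⟨hQx, H.pairExcess_neg_of_le hE hk hd hQd (hda₀.trans hax) hQx fun s hs =>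
        h_le s (hd.trans hs.1) (hs.2.trans_le hxt)⟩
  · refine H.strictMonoOn_pairExcess hE (ha₀.trans_le (le_max_left a₀ t)) (fun x hx => ?_)
      fun x hx => lt_h x ((le_max_right a₀ t).trans_lt hx)
    have hax := (le_max_left a₀ t).trans_lt hx
    exact (region x (ha₀.trans hax)).2 hax

lemma exists_pairExcess_sign :
    ∃ a, d < a ∧ (∃ t < a, ∀ x, t < x → k < h x) ∧ E * a ^ (-n) < Q (-k) a ∧ F E k d a = 0 ∧
      ∀ x, 0 < x → E * x ^ (-n) < Q (-k) x →
        (x < a → F E k d x < 0) ∧ (a < x → 0 < F E k d x) := by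
  obtain ⟨a₀, a₁, hda₀, ha₀₁, region, hneg, hmono, t, hta₁, lt_h⟩ :=
    H.exists_pairExcess_neg_and_strictMonoOn hE hk hd hQd
  have ha₀ := hd.trans hda₀
  have ha₁ := ha₀.trans_le ha₀₁
  have in_region : ∀ x, a₁ < x → E * x ^ (-n) < Q (-k) x := fun x hx =>
    (region x (ha₁.trans hx)).2 (ha₀₁.trans_lt hx)
  have cont : ∀ x, a₁ ≤ x → ContinuousAt (F E k d) x := by
    intro x hx
    refine H.continuousAt_pairExcess hE (ha₁.trans_le hx) ?_
    rcases hx.eq_or_lt with rfl | hx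
    · exact (hneg _ (right_mem_Icc.2 ha₀₁)).1
    · exact (mul_pos hE (Real.rpow_pos_of_pos (ha₁.trans hx) _)).trans (in_region x hx)
  obtain ⟨y, hPy, hy⟩ := (((H.tendsto_lowMoment (-(E + k))).eventually_gt_atTop (P (-E) d)).and
    (eventually_gt_atTop a₁)).exists
  have hFy : 0 < F E k d y := by
    linarith [H.lt_pairExcess (d := d) hE (ha₁.trans hy) (in_region y hy)]
  obtain ⟨a, ha, hFa⟩ := intermediate_value_Ioo hy.le
    (fun x (hx : x ∈ Icc a₁ y) => (cont x hx.1).continuousWithinAt)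
    ⟨(hneg a₁ (right_mem_Icc.2 ha₀₁)).2, hFy⟩
  refine ⟨a, hda₀.trans (ha₀₁.trans_lt ha.1), ⟨t, hta₁.trans_lt ha.1, lt_h⟩, in_region a ha.1, hFa,
    fun x hx hxQ => ⟨fun hxa => ?_, fun hax => hFa ▸ hmono ha.1 (ha.1.trans hax) hax⟩⟩
  rcases le_or_gt x a₁ with hxa₁ | hxa₁
  · exact (hneg x ⟨((region x hx).1 hxQ).le, hxa₁⟩).2
  · exact hFa ▸ hmono hxa₁ ha.1 hxa

lemma exists_isEntryPair_and_unique :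
    ∃ z a, IsEntryPair μ n h E k d z a ∧
      (∀ z' a', IsEntryPair μ n h E k d z' a' → z' = z ∧ a' = a) ∧
      (∃ t < a, ∀ x, t < x → k < h x) ∧ ∀ x, 0 < x → E * x ^ (-n) < Q (-k) x →
        (x < a → F E k d x < 0) ∧ (a < x → 0 < F E k d x) := by
  have hn := H.n_pos
  obtain ⟨a, hda, hka, hQa, hFa, hF⟩ := H.exists_pairExcess_sign hE hk hd hQd
  have ha := hd.trans hda
  have hQa0 : 0 < Q (-k) a := (mul_pos hE (Real.rpow_pos_of_pos ha _)).trans hQa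
  refine ⟨negPowRoot n E (Q (-k) a), a, ⟨negPowRoot_pos hE hQa0,
    (negPowRoot_lt_iff hn hE hQa0 ha).2 hQa, hda, sub_eq_zero.1 hFa,
    (mul_negPowRoot hn hE hQa0).symm⟩, fun z' a' hp => ?_, hka, hF⟩
  have hFa' : F E k d a' = 0 := by
    rw [H.pairExcess_eq hE hp.z_pos hp.highMoment_eq, hp.lowMoment_eq, sub_self]
  have hsign := hF a' (hd.trans hp.d_lt) (by
    rw [hp.highMoment_eq]; exact mul_lt_mul_of_pos_left (H.rpow_neg_lt hp.z_pos hp.z_lt) hE)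
  obtain rfl : a' = a := le_antisymm (not_lt.1 fun haa' => (hsign.2 haa').ne' hFa')
    (not_lt.1 fun haa' => (hsign.1 haa').ne hFa')
  exact ⟨(negPowRoot_eq hn hE hp.z_pos hp.highMoment_eq.symm).symm, rfl⟩

end entry

end Payoff

namespace IsEntryPair

variable {μ n : ℝ} {h : ℝ → ℝ} {E k d z a x : ℝ}

local notation "Q" => highMoment n h

variable (hp : IsEntryPair μ n h E k d z a) (H : Payoff μ n h) (hE : 0 < E) (hk : 0 < k)
  (hd : 0 < d) (hQd : highMoment n h (-E) d = 0)
include hp H hE hk hd hQd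

lemma pairExcess_neg (hx : 0 < x) (hxQ : E * x ^ (-n) < Q (-k) x) (hxa : x < a) :
    pairExcess μ n h E k d x < 0 := by
  obtain ⟨z', a', -, unique, -, hsign⟩ := H.exists_isEntryPair_and_unique hE hk hd hQd
  obtain ⟨rfl, rfl⟩ := unique z a hp
  exact (hsign x hx hxQ).1 hxa

lemma pairExcess_pos (hxQ : E * x ^ (-n) < Q (-k) x) (hax : a < x) :
    0 < pairExcess μ n h E k d x := by
  obtain ⟨z', a', -, unique, -, hsign⟩ := H.exists_isEntryPair_and_unique hE hk hd hQd
  obtain ⟨rfl, rfl⟩ := unique z a hp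
  exact (hsign x (hd.trans (hp.d_lt.trans hax)) hxQ).2 hax

lemma exists_lt_apply : ∃ t < a, ∀ x, t < x → k < h x := by
  obtain ⟨z', a', -, unique, hlt, -⟩ := H.exists_isEntryPair_and_unique hE hk hd hQd
  obtain ⟨rfl, rfl⟩ := unique z a hp
  exact hlt

lemma lt_apply (hax : a ≤ x) : k < h x := by
  obtain ⟨t, hta, ht⟩ := hp.exists_lt_apply H hE hk hd hQd
  exact ht x (hta.trans_le hax)

lemma unique {z' a' : ℝ} (hp' : IsEntryPair μ n h E k d z' a') : z = z' ∧ a = a' := by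
  obtain ⟨_, _, -, unique, -⟩ := H.exists_isEntryPair_and_unique hE hk hd hQd
  obtain ⟨rfl, rfl⟩ := unique z a hp
  obtain ⟨rfl, rfl⟩ := unique z' a' hp'
  exact ⟨rfl, rfl⟩

lemma lt_and_lt {k' z' a' : ℝ} (hp' : IsEntryPair μ n h E k' d z' a') (hkk' : k < k') :
    z < z' ∧ a < a' := by
  have hn := H.n_pos
  have ha' := hd.trans hp'.d_lt
  have hz' := hp'.z_pos
  have hQ' : E * z' ^ (-n) < Q (-k) a' := by
    rw [highMoment_eq_add (-k) (-k'), hp'.highMoment_eq]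
    linarith [mul_pos (show 0 < -k - -k' by linarith) (Real.rpow_pos_of_pos ha' (-n))]
  have hQpos : 0 < Q (-k) a' := (mul_pos hE (Real.rpow_pos_of_pos hz' _)).trans hQ'
  have hroot := (negPowRoot_lt_iff hn hE hQpos hz').2 hQ'
  have in_region : E * a' ^ (-n) < Q (-k) a' :=
    (mul_lt_mul_of_pos_left (H.rpow_neg_lt hz' hp'.z_lt) hE).trans hQ'
  have excess_pos : 0 < pairExcess μ n h E k d a' := by
    have hpow := mul_lt_mul_of_pos_left (H.rpow_mu_lt (negPowRoot_pos hE hQpos).le hroot) hE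
    have hcost := mul_pos (show 0 < -k - -k' by linarith) (Real.rpow_pos_of_pos ha' μ)
    rw [pairExcess, lowMoment_eq_add (-k) (-k') a']
    linarith [hp'.lowMoment_eq]
  have haa' : a < a' := by
    rcases lt_trichotomy a a' with haa' | rfl | haa'
    · exact haa'
    · rw [H.pairExcess_eq hE hp.z_pos hp.highMoment_eq, hp.lowMoment_eq, sub_self] at excess_pos
      exact (lt_irrefl _ excess_pos).elim
    · linarith [hp.pairExcess_neg H hE hk hd hQd ha' in_region haa']
  have hQlt : Q (-k) a' < Q (-k) a := H.highMoment_lt_of_pos (hd.trans hp.d_lt) haa' fun s hs => by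
    linarith [hp.lt_apply H hE hk hd hQd hs.1.le]
  rw [hp.highMoment_eq] at hQlt
  exact ⟨H.lt_of_rpow_neg_lt hz' (lt_of_mul_lt_mul_left (hQ'.trans hQlt) hE.le), haa'⟩

end IsEntryPair

namespace Payoff

variable {μ n : ℝ} {h : ℝ → ℝ} (H : Payoff μ n h)
include H

local notation "P" => lowMoment μ h
local notation "Q" => highMoment n h

lemma exists_lineGap_eq_zero {d y : ℝ} (hd : 0 < d) (hdy : d < y) (hhy : h y < 0)
    (hQd : 0 < Q 0 d) : ∃ a, y < a ∧ lineGap μ n h (P 0 d) (Q 0 d) a = 0 := by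
  have hy := hd.trans hdy
  have hneg : ∀ s ∈ Ioo d y, h s + 0 < 0 := fun s hs => by
    linarith [H.apply_le (hd.trans hs.1) hs.2.le]
  have gap_y : 0 < lineGap μ n h (P 0 d) (Q 0 d) y := by
    rw [lineGap_eq 0 _ _ hy]
    nlinarith [Real.rpow_pos_of_pos hy (n + μ), H.lowMoment_lt_of_neg hd.le hdy hneg,
      H.highMoment_lt_of_neg hd hdy hneg]
  obtain ⟨x, ⟨hQx, hPx⟩, hyx⟩ := ((((H.tendsto_highMoment 0).eventually_lt_const hQd).and
    ((H.tendsto_lowMoment 0).eventually_gt_atTop (P 0 d))).and (eventually_gt_atTop y)).exists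
  have gap_x : lineGap μ n h (P 0 d) (Q 0 d) x < 0 := by
    rw [lineGap_eq 0 _ _ (hy.trans hyx)]
    nlinarith [Real.rpow_pos_of_pos (hy.trans hyx) (n + μ)]
  obtain ⟨a, ha, hgap⟩ := intermediate_value_Ioo' hyx.le
    (H.continuousOn_lineGap (P 0 d) (Q 0 d) fun s (hs : s ∈ Icc y x) => hy.trans_le hs.1)
    ⟨gap_x, gap_y⟩
  exact ⟨a, ha.1, hgap⟩

/- Beyond the point `t` where `h` becomes positive this compares the slope of the chord of the curve
between `d` and `a` with the slope of the curve at `t`. -/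
lemma neg_of_moments_eq {d y a c : ℝ} (hd : 0 < d) (hdy : d < y) (hhy : h y < 0) (hya : y < a)
    (hP : P c a = P 0 d) (hQ : Q c a = Q 0 d) : c < 0 := by
  have hn := H.n_pos
  have hμ := H.mu_pos
  have hy := hd.trans hdy
  have ha := hy.trans hya
  have hP' := lowMoment_eq_add (μ := μ) (h := h) c 0 a
  have hQ' := highMoment_eq_add (n := n) (h := h) c 0 a
  obtain ⟨t, -, h_le, lt_h⟩ := H.exists_crossing 0
  have hyt : y ≤ t := by
    by_contra! hty
    linarith [lt_h y hty]
  rcases lt_or_ge t a with hta | hat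
  · have ht := hy.trans_le hyt
    have chord_left := H.slope_le_of_nonneg (c := 0) (T := t) hd (hdy.le.trans hyt) fun s hs =>
      mul_nonneg_of_nonpos_of_nonpos (sub_nonpos.2 (H.rpow_le (hd.trans hs.1).le hs.2.le))
        (by linarith [h_le s (hd.trans hs.1) hs.2])
    have chord_right := H.slope_lt_of_pos (c := 0) (T := t) ht hta fun s hs =>
      mul_pos (sub_pos.2 (H.rpow_lt ht.le hs.1)) (by linarith [lt_h s hs.1])
    have hcost : 0 < -c * (a ^ μ + μ / n * t ^ (n + μ) * a ^ (-n)) := by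
      linear_combination chord_left + chord_right + hP - hP' + μ / n * t ^ (n + μ) * (hQ - hQ')
    exact neg_pos.1 (pos_of_mul_pos_left hcost (by positivity))
  · have hle : Q 0 y ≤ Q 0 a := H.highMoment_le_of_nonpos hy hya.le fun s hs => by
      linarith [h_le s (hy.trans hs.1) (hs.2.trans_le hat)]
    have hlt : Q 0 d < Q 0 y := H.highMoment_lt_of_neg hd hdy fun s hs => by
      linarith [H.apply_le (hd.trans hs.1) hs.2.le]
    have hcost : 0 < -c * a ^ (-n) := by linarith
    exact neg_pos.1 (pos_of_mul_pos_left hcost (by positivity))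

lemma exists_isEntryPair_self {E d : ℝ} (hE : 0 < E) (hd : 0 < d) (hQd : Q (-E) d = 0)
    (hhd : h d < 0) : ∃ k a, 0 < k ∧ IsEntryPair μ n h E k d d a := by
  obtain ⟨y, hhy, hdy⟩ : ∃ y, h y < 0 ∧ d < y := by
    have hneg : ∀ᶠ y in 𝓝[≥] d, h y < 0 :=
      (H.right_cont d hd).eventually_lt continuousWithinAt_const hhd
    exact ((hneg.filter_mono (nhdsWithin_mono _ Ioi_subset_Ici_self)).and
      self_mem_nhdsWithin).exists
  have hQ0 : Q 0 d = E * d ^ (-n) := by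
    linarith [highMoment_eq_add (n := n) (h := h) (-E) 0 d]
  have hP0 : P 0 d = P (-E) d + E * d ^ μ := by
    linarith [lowMoment_eq_add (μ := μ) (h := h) (-E) 0 d]
  obtain ⟨a, hya, hgap⟩ := H.exists_lineGap_eq_zero hd hdy hhy
    (hQ0 ▸ mul_pos hE (Real.rpow_pos_of_pos hd _))
  obtain ⟨c, hPc, hQc⟩ :=
    exists_moments_eq_of_lineGap_eq_zero ((hd.trans hdy).trans hya) hgap
  refine ⟨-c, a, neg_pos.2 (H.neg_of_moments_eq hd hdy hhy hya hPc hQc), hd, hdy.trans hya,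
    hdy.trans hya, ?_, ?_⟩
  · rw [neg_neg, hPc, hP0]; ring
  · rw [neg_neg, hQc, hQ0]

end Payoff

namespace IsEntryPair

variable {μ n : ℝ} {h : ℝ → ℝ} {E k d z a : ℝ}

local notation "P" => lowMoment μ h
local notation "Q" => highMoment n h
local notation "G" => lineGap μ n h (lowMoment μ h (-k) a) (highMoment n h (-k) a)

variable (hp : IsEntryPair μ n h E k d z a) (H : Payoff μ n h) (hE : 0 < E)
  (hd : 0 < d) (hQd : highMoment n h (-E) d = 0) (hzd : z < d)
include hp H hE hd hQd hzd

lemma lineGap_neg : G d < 0 := by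
  have hz := hp.z_pos
  rw [lineGap_eq (-E) _ _ hd, hQd, hp.lowMoment_eq, hp.highMoment_eq,
    ← rpow_add_mul_rpow_neg μ n hz]
  nlinarith [H.rpow_lt hz.le hzd, mul_pos hE (Real.rpow_pos_of_pos hz (-n))]

lemma exists_lineGap_signChange (hk : 0 < k) :
    ∃ y, d < y ∧ y < a ∧ G y = 0 ∧ (∀ x, d ≤ x → x < y → G x < 0) ∧
      ∀ x, y < x → x < a → 0 < G x := by
  have ha := hd.trans hp.d_lt
  obtain ⟨t, hta, lt_h⟩ := hp.exists_lt_apply H hE hk hd hQd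
  obtain ⟨v, hv, hva⟩ := exists_between (max_lt hta hp.d_lt)
  have htv : t < v := (le_max_left _ _).trans_lt hv
  have hdv : d < v := (le_max_right _ _).trans_lt hv
  have gap_v : 0 < G v := H.lineGap_pos_left (hd.trans hdv) hva fun s hs => by
    linarith [lt_h s (htv.trans hs.1)]
  have gap_a : G a = 0 := lineGap_eq_zero ha rfl rfl
  obtain ⟨y, ⟨hdy, hyv⟩, gap_y⟩ := intermediate_value_Ioo hdv.le
    (H.continuousOn_lineGap (P (-k) a) (Q (-k) a) fun s (hs : s ∈ Icc d v) => hd.trans_le hs.1)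
    ⟨hp.lineGap_neg H hE hd hQd hzd, gap_v⟩
  have hy := hd.trans hdy
  refine ⟨y, hdy, hyv.trans hva, gap_y, fun x hdx hxy => ?_, fun x hyx hxa => ?_⟩
  · by_contra! gap_x
    exact (H.lineGap_pos_of_mem_Ioo (hd.trans_le hdx) hxy hyv gap_x gap_v.le (Or.inr gap_v)).ne'
      gap_y
  · rcases lt_trichotomy x v with hxv | rfl | hvx
    · exact H.lineGap_pos_of_mem_Ioo hy hyx hxv gap_y.ge gap_v.le (Or.inr gap_v)
    · exact gap_v
    · exact H.lineGap_pos_of_mem_Ioo (hd.trans hdv) hvx hxa gap_v.le gap_a.ge (Or.inl gap_v)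

lemma pos_of_moments_eq {y k₀ : ℝ} (hdy : d < y)
    (hP : P k₀ y = P (-k) a) (hQ : Q k₀ y = Q (-k) a) (hle : ∀ s, 0 < s → s < y → h s + k₀ ≤ 0) :
    0 < k₀ := by
  have hn := H.n_pos
  have hμ := H.mu_pos
  have chord := H.le_slope_of_nonpos (c := k₀) (T := d) hd hdy.le fun s hs =>
    mul_nonpos_of_nonneg_of_nonpos (sub_nonneg.2 (H.rpow_le hd.le hs.1.le))
      (hle s (hd.trans hs.1) hs.2)
  have tangent := mul_lt_mul_of_pos_left (rpow_slope_lt hμ hn hp.z_pos hd hzd.ne) hE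
  rw [hP, hQ, lowMoment_eq_add k₀ (-E) d, highMoment_eq_add k₀ (-E) d, hQd,
    hp.highMoment_eq] at chord
  have hcost : 0 < k₀ * (d ^ μ + μ / n * d ^ (n + μ) * d ^ (-n)) := by
    linear_combination chord + tangent - hp.lowMoment_eq
  exact pos_of_mul_pos_left hcost (by positivity)

lemma exists_signChange (hk : 0 < k) :
    ∃ y k₀, d < y ∧ y < a ∧ (∀ x, d ≤ x → x < y → G x < 0) ∧ (∀ x, y < x → x < a → 0 < G x) ∧
      0 < k₀ ∧ P k₀ y = P (-k) a ∧ Q k₀ y = Q (-k) a ∧ ∀ s, 0 < s → s < y → h s + k₀ ≤ 0 := by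
  obtain ⟨y, hdy, hya, gap_y, left, right⟩ :=
    hp.exists_lineGap_signChange H hE hd hQd hzd hk
  obtain ⟨k₀, hP, hQ⟩ := exists_moments_eq_of_lineGap_eq_zero (hd.trans hdy) gap_y
  have hle_mid : ∀ s, d ≤ s → s < y → h s + k₀ ≤ 0 := by
    intro s hds hsy
    by_contra! hpos
    have hs := hd.trans_le hds
    have gap_s := H.lineGap_pos_left (c := k₀) hs hsy fun r hr => by
      linarith [H.apply_le hs hr.1.le]
    rw [hP, hQ] at gap_s
    exact (left s hds hsy).not_gt gap_s
  have hle : ∀ s, 0 < s → s < y → h s + k₀ ≤ 0 := by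
    intro s hs hsy
    rcases le_total d s with hds | hsd
    · exact hle_mid s hds hsy
    · linarith [hle_mid d le_rfl hdy, H.apply_le hs hsd]
  exact ⟨y, k₀, hdy, hya, left, right, hp.pos_of_moments_eq H hE hd hQd hzd hdy hP hQ hle,
    hP, hQ, hle⟩

end IsEntryPair

/-- `(b, a)` solves the two equations of the pure switching problem for `β`, `α`: the curves
`C_{k₀}` and `C_{-k₁}` meet at the parameters `b` and `a`. -/
structure IsSwitchPair (μ n : ℝ) (h : ℝ → ℝ) (k₀ k₁ b a : ℝ) : Prop where
  b_pos : 0 < b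
  b_lt : b < a
  lowMoment_eq : lowMoment μ h k₀ b = lowMoment μ h (-k₁) a
  highMoment_eq : highMoment n h k₀ b = highMoment n h (-k₁) a

namespace IsSwitchPair

variable {μ n : ℝ} {h : ℝ → ℝ} {k₀ k₁ b a b' a' : ℝ}

local notation "P" => lowMoment μ h
local notation "Q" => highMoment n h

lemma a_pos (hs : IsSwitchPair μ n h k₀ k₁ b a) : 0 < a := hs.b_pos.trans hs.b_lt

variable (hs : IsSwitchPair μ n h k₀ k₁ b a) (H : Payoff μ n h) (hk : 0 < k₀ + k₁)
include hs H hk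

lemma apply_b_lt : h b + k₀ < 0 := by
  by_contra! hnonneg
  have hle : Q k₀ a ≤ Q k₀ b := H.highMoment_le_of_nonneg hs.b_pos hs.b_lt.le fun s hs' => by
    linarith [H.apply_le hs.b_pos hs'.1.le]
  have hcost : 0 < (k₀ - -k₁) * a ^ (-n) :=
    mul_pos (by linarith) (Real.rpow_pos_of_pos hs.a_pos _)
  linarith [hs.highMoment_eq, highMoment_eq_add (n := n) (h := h) k₀ (-k₁) a]

lemma exists_lt_apply : ∃ t < a, ∀ x, t < x → k₁ < h x := by
  by_contra! hle
  have hP : P (-k₁) a ≤ P (-k₁) b :=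
    H.lowMoment_le_of_nonpos hs.b_pos.le hs.b_lt.le fun s hs' => by
      obtain ⟨x, hsx, hx⟩ := hle s hs'.2
      linarith [H.apply_le (hs.b_pos.trans hs'.1) hsx.le]
  have hcost : 0 < (k₀ - -k₁) * b ^ μ := mul_pos (by linarith) (Real.rpow_pos_of_pos hs.b_pos _)
  linarith [hs.lowMoment_eq, lowMoment_eq_add (μ := μ) (h := h) k₀ (-k₁) b]

/- The arcs of the two curves from the meeting point for `(b', a')` to that for `(b, a)` cannot have
the same chord: one has slopes below, the other above the slope at the parameter `b'`. -/
lemma le_b (hs' : IsSwitchPair μ n h k₀ k₁ b' a') : b' ≤ b := by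
  by_contra! hbb'
  have hb := hs.b_pos
  obtain ⟨t, hta, lt_h⟩ := hs.exists_lt_apply H hk
  obtain ⟨t', hta', lt_h'⟩ := hs'.exists_lt_apply H hk
  have hneg : ∀ s ∈ Ioo b b', h s + k₀ < 0 := fun s hsb => by
    linarith [hs'.apply_b_lt H hk, H.apply_le (hb.trans hsb.1) hsb.2.le]
  have haa' : a' < a := by
    by_contra! haa'
    have hle : P (-k₁) a ≤ P (-k₁) a' := H.lowMoment_le_of_nonneg hs.a_pos.le haa' fun s hsa => by
      linarith [lt_h s (hta.trans hsa.1)]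
    linarith [H.lowMoment_lt_of_neg hb.le hbb' hneg, hs.lowMoment_eq, hs'.lowMoment_eq]
  have chord_b := H.slope_lt_of_pos (c := k₀) (T := b') hb hbb' fun s hsb =>
    mul_pos_of_neg_of_neg (sub_neg.2 (H.rpow_lt (hb.trans hsb.1).le hsb.2)) (hneg s hsb)
  have chord_a := H.slope_lt_of_pos (c := -k₁) (T := b') hs'.a_pos haa' fun s hsa =>
    mul_pos (sub_pos.2 (H.rpow_lt hs'.b_pos.le (hs'.b_lt.trans hsa.1)))
      (by linarith [lt_h' s (hta'.trans hsa.1)])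
  rw [← hs.lowMoment_eq, ← hs'.lowMoment_eq, ← hs.highMoment_eq, ← hs'.highMoment_eq] at chord_a
  linarith

lemma strictMonoOn_lowMoment : StrictMonoOn (P (-k₁)) (Ici a) := fun u hu v _ huv => by
  obtain ⟨t, hta, lt_h⟩ := hs.exists_lt_apply H hk
  exact H.lowMoment_lt_of_pos (hs.a_pos.trans_le hu).le huv fun s hsu => by
    linarith [lt_h s ((hta.trans_le hu).trans hsu.1)]

lemma unique (hs' : IsSwitchPair μ n h k₀ k₁ b' a') : b = b' ∧ a = a' := by
  obtain rfl : b = b' := le_antisymm (hs'.le_b H hk hs) (hs.le_b H hk hs')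
  have hP : P (-k₁) a = P (-k₁) a' := hs.lowMoment_eq.symm.trans hs'.lowMoment_eq
  refine ⟨rfl, ?_⟩
  rcases le_total a a' with haa' | haa'
  · exact (hs.strictMonoOn_lowMoment H hk).injOn self_mem_Ici haa' hP
  · exact (hs'.strictMonoOn_lowMoment H hk).injOn haa' self_mem_Ici hP

end IsSwitchPair

lemma exists_eq_and_eq_of_injOn {X : Type*} [TopologicalSpace X] {p₀ q₀ : ℝ → ℝ} {p₁ q₁ : X → ℝ}
    {y t : ℝ} {S : Set X} (hyt : y ≤ t) (hS : IsCompact S) (hp₀ : ContinuousOn p₀ (Icc y t))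
    (hq₀ : ContinuousOn q₀ (Icc y t)) (hp₁ : ContinuousOn p₁ S) (hq₁ : ContinuousOn q₁ S)
    (hinj : InjOn p₁ S) (hmaps : MapsTo p₀ (Icc y t) (p₁ '' S)) (hy : ∀ u ∈ S, q₀ y < q₁ u)
    (ht : ∀ u ∈ S, q₁ u < q₀ t) : ∃ b ∈ Ioo y t, ∃ u ∈ S, p₁ u = p₀ b ∧ q₁ u = q₀ b := by
  obtain ⟨u₀, -, -⟩ := hmaps (left_mem_Icc.2 hyt)
  have : Nonempty X := ⟨u₀⟩
  set g := Function.invFunOn p₁ S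
  have hg_mem : MapsTo (fun x => g (p₀ x)) (Icc y t) S := fun x hx =>
    Function.invFunOn_mem (hmaps hx)
  have hg_cont : ContinuousOn (fun x => g (p₀ x)) (Icc y t) :=
    (continuousOn_invFunOn_image hS hp₁ hinj).comp hp₀ hmaps
  obtain ⟨b, hb, hqb⟩ := intermediate_value_Ioo hyt (hq₀.sub (hq₁.comp hg_cont hg_mem))
    ⟨sub_neg.2 (hy _ (hg_mem (left_mem_Icc.2 hyt))),
      sub_pos.2 (ht _ (hg_mem (right_mem_Icc.2 hyt)))⟩
  exact ⟨b, hb, _, hg_mem (Ioo_subset_Icc_self hb),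
    Function.invFunOn_eq (hmaps (Ioo_subset_Icc_self hb)), (sub_eq_zero.1 hqb).symm⟩

lemma moments_lt_of_lt {μ n c c' x : ℝ} {h : ℝ → ℝ} (hc : c < c') (hx : 0 < x) :
    lowMoment μ h c x < lowMoment μ h c' x ∧ highMoment n h c x < highMoment n h c' x :=
  ⟨add_lt_add_right (mul_lt_mul_of_pos_right hc (Real.rpow_pos_of_pos hx μ)) _,
    add_lt_add_right (mul_lt_mul_of_pos_right hc (Real.rpow_pos_of_pos hx (-n))) _⟩

namespace Payoff

variable {μ n : ℝ} {h : ℝ → ℝ} (H : Payoff μ n h)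
include H

local notation "P" => lowMoment μ h
local notation "Q" => highMoment n h

lemma exists_crossing_pair {k₀ k₁ y a : ℝ} (hk : 0 < k₀ + k₁) (ha : 0 < a)
    (hle : ∀ s, 0 < s → s < y → h s ≤ -k₀) (hka : k₁ < h a) :
    ∃ t₀ t₁, y ≤ t₀ ∧ t₀ ≤ t₁ ∧ t₁ ≤ a ∧ (∀ s, 0 < s → s < t₀ → h s ≤ -k₀) ∧
      (∀ s, t₀ < s → -k₀ < h s) ∧ (∀ s, 0 < s → s < t₁ → h s ≤ k₁) ∧ ∀ s, t₁ < s → k₁ < h s := by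
  obtain ⟨t₀, ht₀, h_le₀, lt_h₀⟩ := H.exists_crossing (-k₀)
  obtain ⟨t₁, ht₁, h_le₁, lt_h₁⟩ := H.exists_crossing k₁
  refine ⟨t₀, t₁, ?_, ?_, ?_, h_le₀, lt_h₀, h_le₁, lt_h₁⟩
  · by_contra! hlt
    obtain ⟨s, hs₀, hsy⟩ := exists_between hlt
    linarith [hle s (ht₀.trans_lt hs₀) hsy, lt_h₀ s hs₀]
  · by_contra! hlt
    obtain ⟨s, hs₁, hs₀⟩ := exists_between hlt
    linarith [h_le₀ s (ht₁.trans_lt hs₁) hs₀, lt_h₁ s hs₁]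
  · by_contra! hlt
    linarith [h_le₁ a ha hlt]

lemma moments_lt_of_crossing {k₀ k₁ t₀ t₁ : ℝ} (hk : 0 < k₀ + k₁) (ht₀ : 0 < t₀) (ht : t₀ ≤ t₁)
    (h_le : ∀ s ∈ Ioo t₀ t₁, h s ≤ k₁) (lt_h : ∀ s ∈ Ioo t₀ t₁, -k₀ < h s) :
    P (-k₁) t₁ < P k₀ t₀ ∧ Q (-k₁) t₁ < Q k₀ t₀ := by
  have hP : P (-k₁) t₁ ≤ P (-k₁) t₀ := H.lowMoment_le_of_nonpos ht₀.le ht fun s hs => by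
    linarith [h_le s hs]
  have hQ : Q k₀ t₁ ≤ Q k₀ t₀ := H.highMoment_le_of_nonneg ht₀ ht fun s hs => by
    linarith [lt_h s hs]
  have hcost : -k₁ < k₀ := by linarith
  exact ⟨hP.trans_lt (moments_lt_of_lt (n := n) hcost ht₀).1,
    (moments_lt_of_lt (μ := μ) hcost (ht₀.trans_le ht)).2.trans_le hQ⟩

lemma exists_isSwitchPair {k₀ k₀' k₁ y a : ℝ} (hk : 0 < k₀ + k₁) (hk₀ : k₀ < k₀') (hy : 0 < y)
    (ha : 0 < a) (hP : P k₀' y = P (-k₁) a) (hQ : Q k₀' y = Q (-k₁) a)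
    (hle : ∀ s, 0 < s → s < y → h s + k₀' ≤ 0) (hka : k₁ < h a) :
    ∃ b a', IsSwitchPair μ n h k₀ k₁ b a' ∧ y < b ∧ a' < a := by
  obtain ⟨t₀, t₁, hyt₀, ht₀₁, ht₁a, h_le₀, lt_h₀, h_le₁, lt_h₁⟩ :=
    H.exists_crossing_pair hk ha (fun s hs hsy => by linarith [hle s hs hsy]) hka
  have ht₀ := hy.trans_le hyt₀
  have ht₁ := ht₀.trans_le ht₀₁
  obtain ⟨hPy, hQy⟩ : P k₀ y < P (-k₁) a ∧ Q k₀ y < Q (-k₁) a :=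
    hP ▸ hQ ▸ moments_lt_of_lt hk₀ hy
  obtain ⟨hPt, hQt⟩ := H.moments_lt_of_crossing hk ht₀ ht₀₁
    (fun s hs => h_le₁ s (ht₀.trans hs.1) hs.2) fun s hs => lt_h₀ s hs.1
  have hPle : ∀ x ∈ Icc y t₀, P k₀ x ≤ P k₀ y := fun x hx =>
    H.lowMoment_le_of_nonpos hy.le hx.1 fun s hs => by
      linarith [h_le₀ s (hy.trans hs.1) (hs.2.trans_le hx.2)]
  have hPge : ∀ x ∈ Icc y t₀, P k₀ t₀ ≤ P k₀ x := fun x hx =>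
    H.lowMoment_le_of_nonpos (hy.trans_le hx.1).le hx.2 fun s hs => by
      linarith [h_le₀ s (hy.trans_le (hx.1.trans hs.1.le)) hs.2]
  have hmono : StrictMonoOn (P (-k₁)) (Icc t₁ a) := fun u hu v _ huv =>
    H.lowMoment_lt_of_pos (ht₁.le.trans hu.1) huv fun s hs => by
      linarith [lt_h₁ s (hu.1.trans_lt hs.1)]
  have hQanti : AntitoneOn (Q (-k₁)) (Icc t₁ a) := fun u hu v _ huv =>
    H.highMoment_le_of_nonneg (ht₁.trans_le hu.1) huv fun s hs => by
      linarith [lt_h₁ s (hu.1.trans_lt hs.1)]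
  have posI₀ : ∀ s ∈ Icc y t₀, 0 < s := fun s hs => hy.trans_le hs.1
  have posI₁ : ∀ s ∈ Icc t₁ a, 0 < s := fun s hs => ht₁.trans_le hs.1
  obtain ⟨b, hb, a', ha', hPb, hQb⟩ := exists_eq_and_eq_of_injOn (p₀ := P k₀) hyt₀ isCompact_Icc
    (H.continuousOn_lowMoment k₀ posI₀) (H.continuousOn_highMoment k₀ posI₀)
    (H.continuousOn_lowMoment (-k₁) posI₁) (H.continuousOn_highMoment (-k₁) posI₁) hmono.injOn
    (fun x hx => intermediate_value_Icc ht₁a (H.continuousOn_lowMoment _ posI₁)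
      ⟨hPt.le.trans (hPge x hx), (hPle x hx).trans hPy.le⟩)
    (fun u hu => hQy.trans_le (hQanti hu (right_mem_Icc.2 ht₁a) hu.2))
    (fun u hu => (hQanti (left_mem_Icc.2 ht₁a) hu hu.1).trans_lt hQt)
  refine ⟨b, a', ⟨hy.trans hb.1, hb.2.trans_le (ht₀₁.trans ha'.1), hPb.symm, hQb.symm⟩, hb.1,
    lt_of_le_of_ne ha'.2 ?_⟩
  rintro rfl
  exact (hPle b (Ioo_subset_Icc_self hb)).not_gt (hPb ▸ hPy)

end Payoff

/-- `(x, g)` solves the two equations for `δ`, `γ` in which the entry point `z` of the inactive mode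
is given: the curves satisfy `C_{k₀}(g) - C_{-E}(x) = E (z ^ μ, z ^ (-n))`. -/
structure IsInnerPair (μ n : ℝ) (h : ℝ → ℝ) (E k₀ z x g : ℝ) : Prop where
  x_pos : 0 < x
  x_lt : x < g
  lowMoment_eq : lowMoment μ h k₀ g - lowMoment μ h (-E) x = E * z ^ μ
  highMoment_eq : highMoment n h k₀ g - highMoment n h (-E) x = E * z ^ (-n)

/-- The parameters of the equations for `δ`, `γ`, together with the point `d = δ†` where the second
coordinate of `C_{-E}` vanishes and the point `b = β` where that of `C_{k₀}` is `E z ^ (-n)`. -/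
structure IsInnerData (n : ℝ) (h : ℝ → ℝ) (E k₀ z b d : ℝ) : Prop where
  E_pos : 0 < E
  k₀_pos : 0 < k₀
  z_pos : 0 < z
  d_pos : 0 < d
  highMoment_d : highMoment n h (-E) d = 0
  highMoment_b : highMoment n h k₀ b = E * z ^ (-n)
  apply_b : h b + k₀ < 0

/-- The value of `x` for which `g = x` solves the second equation of `IsInnerPair`. -/
noncomputable def innerStart (n E k₀ z : ℝ) : ℝ := negPowRoot n (k₀ + E) (E * z ^ (-n))

/-- The solution `g` of the second equation of `IsInnerPair` as a function of `x`. -/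
noncomputable def innerEnd (n : ℝ) (h : ℝ → ℝ) (E k₀ z b x : ℝ) : ℝ :=
  Function.invFunOn (highMoment n h k₀) (Icc (innerStart n E k₀ z) b)
    (E * z ^ (-n) + highMoment n h (-E) x)

lemma Payoff.strictMonoOn_highMoment {μ n : ℝ} {h : ℝ → ℝ} (H : Payoff μ n h) {k b : ℝ}
    (hb : h b + k < 0) : StrictMonoOn (highMoment n h k) (Ioc 0 b) := fun x hx y hy hxy =>
  H.highMoment_lt_of_neg hx.1 hxy fun s hs => by
    linarith [H.apply_le (hx.1.trans hs.1) (hs.2.le.trans hy.2)]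

namespace IsInnerPair

variable {μ n : ℝ} {h : ℝ → ℝ} {E k₀ z x g b d : ℝ}

local notation "P" => lowMoment μ h
local notation "Q" => highMoment n h

lemma g_pos (hi : IsInnerPair μ n h E k₀ z x g) : 0 < g := hi.x_pos.trans hi.x_lt

variable (hi : IsInnerPair μ n h E k₀ z x g) (D : IsInnerData n h E k₀ z b d) (H : Payoff μ n h)
include hi D H

lemma mul_rpow_lt (hgb : g ≤ b) : (k₀ + E) * x ^ (-n) < E * z ^ (-n) := by
  have hlt := H.strictMonoOn_highMoment D.apply_b ⟨hi.x_pos, hi.x_lt.le.trans hgb⟩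
    ⟨hi.g_pos, hgb⟩ hi.x_lt
  linarith [hi.highMoment_eq, highMoment_eq_add (n := n) (h := h) k₀ (-E) x]

lemma x_lt_d (hgb : g < b) : x < d := by
  have hb := hi.g_pos.trans hgb
  have hlt := H.strictMonoOn_highMoment D.apply_b ⟨hi.g_pos, hgb.le⟩ (right_mem_Ioc.2 hb) hgb
  rw [← H.highMoment_neg_iff D.d_pos D.highMoment_d hi.x_pos]
  linarith [hi.highMoment_eq, D.highMoment_b]

lemma z_lt_x (hgb : g ≤ b) : z < x := by
  refine H.lt_of_rpow_neg_lt hi.x_pos (lt_of_mul_lt_mul_left ?_ D.E_pos.le)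
  linarith [hi.mul_rpow_lt D H hgb, mul_pos D.k₀_pos (Real.rpow_pos_of_pos hi.x_pos (-n))]

lemma d_lt_b (hgb : g < b) : d < b := by
  have hxb := hi.x_lt.trans hgb
  rw [← H.highMoment_pos_iff D.d_pos D.highMoment_d (hi.x_pos.trans hxb)]
  have hcost := mul_lt_mul_of_pos_left (H.rpow_neg_lt hi.x_pos hxb)
    (add_pos D.k₀_pos D.E_pos)
  linarith [hi.mul_rpow_lt D H hgb.le, D.highMoment_b,
    highMoment_eq_add (n := n) (h := h) k₀ (-E) b]

end IsInnerPair

namespace IsInnerData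

variable {μ n : ℝ} {h : ℝ → ℝ} {E k₀ z b d x g : ℝ}

local notation "P" => lowMoment μ h
local notation "Q" => highMoment n h
local notation "x₀" => innerStart n E k₀ z
local notation "γ" => innerEnd n h E k₀ z b

lemma mul_rpow_pos (D : IsInnerData n h E k₀ z b d) : 0 < E * z ^ (-n) :=
  mul_pos D.E_pos (Real.rpow_pos_of_pos D.z_pos _)

lemma innerStart_pos (D : IsInnerData n h E k₀ z b d) : 0 < x₀ :=
  negPowRoot_pos (add_pos D.k₀_pos D.E_pos) D.mul_rpow_pos

variable (D : IsInnerData n h E k₀ z b d) (H : Payoff μ n h)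
include D H

lemma mul_innerStart : (k₀ + E) * x₀ ^ (-n) = E * z ^ (-n) :=
  mul_negPowRoot H.n_pos (add_pos D.k₀_pos D.E_pos) D.mul_rpow_pos

lemma innerStart_lt_iff (hx : 0 < x) : x₀ < x ↔ (k₀ + E) * x ^ (-n) < E * z ^ (-n) :=
  negPowRoot_lt_iff H.n_pos (add_pos D.k₀_pos D.E_pos) D.mul_rpow_pos hx

lemma lt_innerStart : z < x₀ := by
  refine H.lt_of_rpow_neg_lt D.innerStart_pos (lt_of_mul_lt_mul_left ?_ D.E_pos.le)
  linarith [D.mul_innerStart H, mul_pos D.k₀_pos (Real.rpow_pos_of_pos D.innerStart_pos (-n))]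

lemma highMoment_innerStart : Q k₀ x₀ = E * z ^ (-n) + Q (-E) x₀ := by
  rw [highMoment_eq_add k₀ (-E), sub_neg_eq_add, D.mul_innerStart H, add_comm]

lemma strictMonoOn_highMoment_add : StrictMonoOn (fun x => E * z ^ (-n) + Q (-E) x) (Ioc 0 d) :=
  (H.strictMonoOn_highMoment
    (by linarith [H.lt_of_highMoment_eq_zero D.d_pos D.highMoment_d])).const_add _

lemma strictMonoOn_highMoment : StrictMonoOn (Q k₀) (Icc x₀ b) :=
  (H.strictMonoOn_highMoment D.apply_b).mono fun _ hx => ⟨D.innerStart_pos.trans_le hx.1, hx.2⟩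

variable (hdb : d < b)
include hdb

lemma innerStart_lt : x₀ < d := by
  rw [D.innerStart_lt_iff H D.d_pos, ← D.highMoment_b]
  have hlt := H.strictMonoOn_highMoment D.apply_b ⟨D.d_pos, hdb.le⟩
    (right_mem_Ioc.2 (D.d_pos.trans hdb)) hdb
  linarith [D.highMoment_d, highMoment_eq_add (n := n) (h := h) k₀ (-E) d]

lemma mapsTo_highMoment_add :
    MapsTo (fun x => E * z ^ (-n) + Q (-E) x) (Icc x₀ d) (Q k₀ '' Icc x₀ b) := by
  intro x hx
  have hx₀ := D.innerStart_pos
  have hx₀d := D.innerStart_lt H hdb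
  have hmono := (D.strictMonoOn_highMoment_add H).monotoneOn
  refine intermediate_value_Icc (hx₀d.trans hdb).le
    (H.continuousOn_highMoment k₀ fun s hs => hx₀.trans_le hs.1) ⟨?_, ?_⟩
  · rw [D.highMoment_innerStart H]
    exact hmono ⟨hx₀, hx₀d.le⟩ ⟨hx₀.trans_le hx.1, hx.2⟩ hx.1
  · have hle : E * z ^ (-n) + Q (-E) x ≤ E * z ^ (-n) + Q (-E) d :=
      hmono ⟨hx₀.trans_le hx.1, hx.2⟩ (right_mem_Ioc.2 D.d_pos) hx.2
    exact hle.trans_eq (by rw [D.highMoment_d, add_zero, D.highMoment_b])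

lemma innerEnd_mem (hx : x ∈ Icc x₀ d) : γ x ∈ Icc x₀ b :=
  Function.invFunOn_mem (D.mapsTo_highMoment_add H hdb hx)

lemma highMoment_innerEnd (hx : x ∈ Icc x₀ d) : Q k₀ (γ x) = E * z ^ (-n) + Q (-E) x :=
  Function.invFunOn_eq (D.mapsTo_highMoment_add H hdb hx)

lemma eq_innerEnd (hx : x ∈ Icc x₀ d) (hg : g ∈ Icc x₀ b)
    (hQ : Q k₀ g = E * z ^ (-n) + Q (-E) x) : g = γ x :=
  (D.strictMonoOn_highMoment H).injOn hg (D.innerEnd_mem H hdb hx)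
    (hQ.trans (D.highMoment_innerEnd H hdb hx).symm)

lemma innerEnd_start : γ x₀ = x₀ :=
  have hx₀d := D.innerStart_lt H hdb
  (D.eq_innerEnd H hdb (left_mem_Icc.2 hx₀d.le) (left_mem_Icc.2 (hx₀d.trans hdb).le)
    (D.highMoment_innerStart H)).symm

lemma innerEnd_d : γ d = b :=
  have hx₀d := D.innerStart_lt H hdb
  (D.eq_innerEnd H hdb (right_mem_Icc.2 hx₀d.le) (right_mem_Icc.2 (hx₀d.trans hdb).le)
    (by rw [D.highMoment_b, D.highMoment_d, add_zero])).symm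

lemma lt_innerEnd (hx : x ∈ Ioc x₀ d) : x < γ x := by
  have hxI := Ioc_subset_Icc_self hx
  rw [← (D.strictMonoOn_highMoment H).lt_iff_lt ⟨hx.1.le, hx.2.trans hdb.le⟩
    (D.innerEnd_mem H hdb hxI), D.highMoment_innerEnd H hdb hxI]
  linarith [(D.innerStart_lt_iff H (D.innerStart_pos.trans hx.1)).1 hx.1,
    highMoment_eq_add (n := n) (h := h) k₀ (-E) x]

lemma continuousOn_innerEnd : ContinuousOn γ (Icc x₀ d) := by
  have hpos : ∀ s : ℝ, x₀ ≤ s → 0 < s := fun s hs => D.innerStart_pos.trans_le hs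
  exact (continuousOn_invFunOn_image isCompact_Icc
    (H.continuousOn_highMoment k₀ fun s hs => hpos s hs.1)
    (D.strictMonoOn_highMoment H).injOn).comp
    (continuousOn_const.add (H.continuousOn_highMoment (-E) fun s hs => hpos s hs.1))
    (D.mapsTo_highMoment_add H hdb)

lemma strictMonoOn_innerEnd : StrictMonoOn γ (Icc x₀ d) := fun x hx y hy hxy => by
  have hx₀ := D.innerStart_pos
  rw [← (D.strictMonoOn_highMoment H).lt_iff_lt (D.innerEnd_mem H hdb hx)
    (D.innerEnd_mem H hdb hy), D.highMoment_innerEnd H hdb hx, D.highMoment_innerEnd H hdb hy]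
  exact D.strictMonoOn_highMoment_add H ⟨hx₀.trans_le hx.1, hx.2⟩ ⟨hx₀.trans_le hy.1, hy.2⟩ hxy

lemma continuousOn_lowMoment_sub :
    ContinuousOn (fun x => P k₀ (γ x) - P (-E) x) (Icc x₀ d) := by
  have hpos : ∀ s : ℝ, x₀ ≤ s → 0 < s := fun s hs => D.innerStart_pos.trans_le hs
  exact ((H.continuousOn_lowMoment k₀ fun s (hs : s ∈ Icc x₀ b) => hpos s hs.1).comp
    (D.continuousOn_innerEnd H hdb) fun x hx => D.innerEnd_mem H hdb hx).sub
    (H.continuousOn_lowMoment (-E) fun s hs => hpos s hs.1)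

/- As long as `y < γ x`, the arcs of the two curves over the parameter intervals `[x, y]` and
`[γ x, γ y]` have slopes on different sides of the slope at `γ x`, while their second coordinates
change by the same amount. -/
lemma lowMoment_sub_lt {y : ℝ} (hx : x ∈ Ioc x₀ d) (hxy : x < y) (hyd : y ≤ d) (hyg : y < γ x) :
    P k₀ (γ y) - P (-E) y < P k₀ (γ x) - P (-E) x := by
  have hxpos := D.innerStart_pos.trans hx.1
  have hxI := Ioc_subset_Icc_self hx
  have hyI : y ∈ Icc x₀ d := ⟨hx.1.le.trans hxy.le, hyd⟩
  have hgpos := hxpos.trans (hxy.trans hyg)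
  have hgyb := (D.innerEnd_mem H hdb hyI).2
  have hd := H.lt_of_highMoment_eq_zero D.d_pos D.highMoment_d
  have chord_x := H.slope_lt_of_pos (c := -E) (T := γ x) hxpos hxy fun s hs =>
    mul_pos_of_neg_of_neg (sub_neg.2 (H.rpow_lt (hxpos.trans hs.1).le (hs.2.trans hyg)))
      (by linarith [H.apply_le (hxpos.trans hs.1) (hs.2.le.trans hyd)])
  have chord_g := H.lt_slope_of_neg (c := k₀) (T := γ x) hgpos
    (D.strictMonoOn_innerEnd H hdb hxI hyI hxy) fun s hs =>
      mul_neg_of_pos_of_neg (sub_pos.2 (H.rpow_lt hgpos.le hs.1))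
        (by linarith [D.apply_b, H.apply_le (hgpos.trans hs.1) (hs.2.le.trans hgyb)])
  rw [D.highMoment_innerEnd H hdb hxI, D.highMoment_innerEnd H hdb hyI,
    add_sub_add_left_eq_sub] at chord_g
  linarith

lemma strictAntiOn_lowMoment_sub :
    StrictAntiOn (fun x => P k₀ (γ x) - P (-E) x) (Ioc x₀ d) := by
  refine strictMonoOn_toDual_comp_iff.1 (strictMonoOn_of_eventually_lt_right ordConnected_Ioc
    ((D.continuousOn_lowMoment_sub H hdb).mono Ioc_subset_Icc_self) fun x hx => ?_)
  filter_upwards [Ioo_mem_nhdsGT (D.lt_innerEnd H hdb hx)] with y hy hyd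
  exact D.lowMoment_sub_lt H hdb hx hy.1 hyd.2 hy.2

lemma exists_isInnerPair (hlt : P k₀ b - P (-E) d < E * z ^ μ) :
    ∃ x g, IsInnerPair μ n h E k₀ z x g ∧ g < b := by
  have hx₀ := D.innerStart_pos
  have hx₀d := (D.innerStart_lt H hdb).le
  have hstart : E * z ^ μ < P k₀ (γ x₀) - P (-E) x₀ := by
    rw [D.innerEnd_start H hdb, lowMoment_eq_add k₀ (-E)]
    linarith [mul_lt_mul_of_pos_left (H.rpow_mu_lt D.z_pos.le (D.lt_innerStart H)) D.E_pos,
      mul_pos D.k₀_pos (Real.rpow_pos_of_pos hx₀ μ)]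
  have hend : P k₀ (γ d) - P (-E) d < E * z ^ μ := by rwa [D.innerEnd_d H hdb]
  obtain ⟨x, hx, hPx⟩ :=
    intermediate_value_Ioo' hx₀d (D.continuousOn_lowMoment_sub H hdb) ⟨hend, hstart⟩
  have hQx := D.highMoment_innerEnd H hdb (Ioo_subset_Icc_self hx)
  have hgb : γ x < b := by
    refine lt_of_lt_of_eq ?_ (D.innerEnd_d H hdb)
    exact D.strictMonoOn_innerEnd H hdb (Ioo_subset_Icc_self hx) (right_mem_Icc.2 hx₀d) hx.2
  exact ⟨x, γ x, ⟨hx₀.trans hx.1, D.lt_innerEnd H hdb (Ioo_subset_Ioc_self hx), hPx,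
    by rw [hQx, add_sub_cancel_right]⟩, hgb⟩

end IsInnerData

namespace IsInnerPair

variable {μ n : ℝ} {h : ℝ → ℝ} {E k₀ z x g x' g' b d : ℝ}
  (hi : IsInnerPair μ n h E k₀ z x g) (D : IsInnerData n h E k₀ z b d) (H : Payoff μ n h)
include hi D H

local notation "P" => lowMoment μ h
local notation "γ" => innerEnd n h E k₀ z b

lemma innerStart_lt (hgb : g ≤ b) : innerStart n E k₀ z < x :=
  (D.innerStart_lt_iff H hi.x_pos).2 (hi.mul_rpow_lt D H hgb)

lemma eq_innerEnd (hgb : g < b) : g = γ x := by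
  have hx₀ := hi.innerStart_lt D H hgb.le
  exact D.eq_innerEnd H (hi.d_lt_b D H hgb) ⟨hx₀.le, (hi.x_lt_d D H hgb).le⟩
    ⟨(hx₀.trans hi.x_lt).le, hgb.le⟩ (by linarith [hi.highMoment_eq])

lemma lowMoment_lt (hgb : g < b) : P k₀ b - P (-E) d < E * z ^ μ := by
  have hx₀ := hi.innerStart_lt D H hgb.le
  have hxd := hi.x_lt_d D H hgb
  have hdb := hi.d_lt_b D H hgb
  have hanti : P k₀ (γ d) - P (-E) d < P k₀ (γ x) - P (-E) x :=
    D.strictAntiOn_lowMoment_sub H hdb ⟨hx₀, hxd.le⟩ ⟨hx₀.trans hxd, le_rfl⟩ hxd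
  rwa [D.innerEnd_d H hdb, ← hi.eq_innerEnd D H hgb, hi.lowMoment_eq] at hanti

lemma unique (hi' : IsInnerPair μ n h E k₀ z x' g') (hgb : g < b) (hgb' : g' < b) :
    x = x' ∧ g = g' := by
  have hinj := (D.strictAntiOn_lowMoment_sub H (hi.d_lt_b D H hgb)).injOn
  have hxx' : x = x' := by
    refine hinj ⟨hi.innerStart_lt D H hgb.le, (hi.x_lt_d D H hgb).le⟩
      ⟨hi'.innerStart_lt D H hgb'.le, (hi'.x_lt_d D H hgb').le⟩ ?_
    simp only [← hi.eq_innerEnd D H hgb, ← hi'.eq_innerEnd D H hgb', hi.lowMoment_eq,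
      hi'.lowMoment_eq]
  subst hxx'
  exact ⟨rfl, (hi.eq_innerEnd D H hgb).trans (hi'.eq_innerEnd D H hgb').symm⟩

end IsInnerPair

/-- `(z, x, g, b, a)` solves the five free boundary equations for `(ζ, δ, γ, β, α)`. -/
structure SolvesSystem (μ n : ℝ) (h : ℝ → ℝ) (E k₀ k₁ z x g b a : ℝ) : Prop where
  z_pos : 0 < z
  inner : IsInnerPair μ n h E k₀ z x g
  g_lt : g < b
  switch : IsSwitchPair μ n h k₀ k₁ b a
  highMoment_b : highMoment n h k₀ b = E * z ^ (-n)

section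

variable {μ n : ℝ} {h : ℝ → ℝ} {E k k₀ k₁ d z x g b a z' a' x' g' b' y : ℝ} (H : Payoff μ n h)

local notation "P" => lowMoment μ h
local notation "Q" => highMoment n h
local notation "G" => lineGap μ n h (lowMoment μ h (-k₁) a') (highMoment n h (-k₁) a')

include H

lemma IsSwitchPair.slope_lt (hs : IsSwitchPair μ n h k₀ k₁ b a) (hk : 0 < k₀ + k₁) (hy : 0 < y)
    (hyb : y < b) (haa' : a < a') :
    μ / n * b ^ (n + μ) * (Q k₀ y - Q (-k₁) a') < P (-k₁) a' - P k₀ y := by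
  obtain ⟨t, hta, lt_h⟩ := hs.exists_lt_apply H hk
  have hhb := hs.apply_b_lt H hk
  have chord_b := H.slope_lt_of_pos (c := k₀) (T := b) hy hyb fun s hsb =>
    mul_pos_of_neg_of_neg (sub_neg.2 (H.rpow_lt (hy.trans hsb.1).le hsb.2))
      (by linarith [H.apply_le (hy.trans hsb.1) hsb.2.le])
  have chord_a := H.slope_lt_of_pos (c := -k₁) (T := b) hs.a_pos haa' fun s hsa =>
    mul_pos (sub_pos.2 (H.rpow_lt hs.b_pos.le (hs.b_lt.trans hsa.1)))
      (by linarith [lt_h s (hta.trans hsa.1)])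
  rw [← hs.lowMoment_eq, ← hs.highMoment_eq] at chord_a
  linarith

lemma IsEntryPair.exists_highMoment_eq (hp : IsEntryPair μ n h E k d z a) (hE : 0 < E) (hk : 0 < k)
    (hd : 0 < d) (hQd : Q (-E) d = 0) (hdz : d ≤ z) (hdy : d < y) (hya : y < a)
    (hQy : E * d ^ (-n) < Q (-k) y) :
    ∃ x, y < x ∧ Q (-k) x = E * d ^ (-n) ∧ P (-k) x ≤ P (-E) d + E * d ^ μ := by
  have hQa : Q (-k) a ≤ E * d ^ (-n) := by
    rw [hp.highMoment_eq]
    exact mul_le_mul_of_nonneg_left (H.rpow_neg_le hd hdz) hE.le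
  obtain ⟨x, hx, hQx⟩ := intermediate_value_Icc' hya.le
    (H.continuousOn_highMoment (-k) fun s hs => hd.trans (hdy.trans_le hs.1)) ⟨hQa, hQy.le⟩
  have hyx : y < x := lt_of_le_of_ne hx.1 (by rintro rfl; exact hQy.ne' hQx)
  refine ⟨x, hyx, hQx, ?_⟩
  rcases hx.2.eq_or_lt with rfl | hxa
  · have hzd : z = d := by
      rw [← negPowRoot_eq H.n_pos hE hp.z_pos hp.highMoment_eq.symm,
        negPowRoot_eq H.n_pos hE hd hQx.symm]
    linarith [hzd ▸ hp.lowMoment_eq]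
  · have hdx := hdy.trans hyx
    have hF := hp.pairExcess_neg H hE hk hd hQd (hd.trans hdx)
      (hQx ▸ mul_lt_mul_of_pos_left (H.rpow_neg_lt hd hdx) hE) hxa
    rw [H.pairExcess_eq hE hd hQx] at hF
    linarith

namespace SolvesSystem

variable (hs : SolvesSystem μ n h E k₀ k₁ z x g b a) (hE : 0 < E) (hk₀ : 0 < k₀) (hk₁ : 0 < k₁)
  (hd : 0 < d) (hQd : highMoment n h (-E) d = 0)
include hs hE hk₀ hk₁ hd hQd

lemma isInnerData : IsInnerData n h E k₀ z b d where
  E_pos := hE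
  k₀_pos := hk₀
  z_pos := hs.z_pos
  d_pos := hd
  highMoment_d := hQd
  highMoment_b := hs.highMoment_b
  apply_b := hs.switch.apply_b_lt H (add_pos hk₀ hk₁)

lemma d_lt_b : d < b := hs.inner.d_lt_b (hs.isInnerData H hE hk₀ hk₁ hd hQd) H hs.g_lt

lemma z_lt_d : z < d :=
  have D := hs.isInnerData H hE hk₀ hk₁ hd hQd
  (hs.inner.z_lt_x D H hs.g_lt.le).trans (hs.inner.x_lt_d D H hs.g_lt)

lemma unique (hs' : SolvesSystem μ n h E k₀ k₁ z' x' g' b' a') :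
    z = z' ∧ x = x' ∧ g = g' ∧ b = b' ∧ a = a' := by
  obtain ⟨rfl, rfl⟩ := hs.switch.unique H (add_pos hk₀ hk₁) hs'.switch
  obtain rfl : z = z' := by
    rw [← negPowRoot_eq H.n_pos hE hs.z_pos hs.highMoment_b.symm,
      negPowRoot_eq H.n_pos hE hs'.z_pos hs'.highMoment_b.symm]
  obtain ⟨hx, hg⟩ :=
    hs.inner.unique (hs.isInnerData H hE hk₀ hk₁ hd hQd) H hs'.inner hs.g_lt hs'.g_lt
  exact ⟨rfl, hx, hg, rfl, rfl⟩

variable (hp : IsEntryPair μ n h E k₁ d z' a')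
include hp

lemma a_lt : a < a' := by
  have hz := hs.z_pos
  have hda := (hs.d_lt_b H hE hk₀ hk₁ hd hQd).trans hs.switch.b_lt
  have hza := (hs.z_lt_d H hE hk₀ hk₁ hd hQd).trans hda
  have hQa : Q (-k₁) a = E * z ^ (-n) := hs.switch.highMoment_eq.symm.trans hs.highMoment_b
  have hQlt : E * a ^ (-n) < Q (-k₁) a :=
    hQa ▸ mul_lt_mul_of_pos_left (H.rpow_neg_lt hz hza) hE
  have hF : pairExcess μ n h E k₁ d a < 0 := by
    rw [H.pairExcess_eq hE hz hQa, ← hs.switch.lowMoment_eq]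
    linarith [hs.inner.lowMoment_lt (hs.isInnerData H hE hk₀ hk₁ hd hQd) H hs.g_lt]
  rcases lt_trichotomy a a' with hlt | rfl | hlt
  · exact hlt
  · rw [H.pairExcess_eq hE hp.z_pos hp.highMoment_eq, hp.lowMoment_eq, sub_self] at hF
    exact absurd hF (lt_irrefl _)
  · exact absurd (hp.pairExcess_pos H hE hk₁ hd hQd hQlt hlt) hF.not_gt

lemma entry_lt_d : z' < d := by
  by_contra! hdz'
  have hμ := H.mu_pos
  have hn := H.n_pos
  have hb := hs.switch.b_pos
  have hdb := hs.d_lt_b H hE hk₀ hk₁ hd hQd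
  have hQa : E * d ^ (-n) < Q (-k₁) a := by
    rw [← hs.switch.highMoment_eq, hs.highMoment_b]
    exact mul_lt_mul_of_pos_left (H.rpow_neg_lt hs.z_pos (hs.z_lt_d H hE hk₀ hk₁ hd hQd)) hE
  obtain ⟨u, hau, hQu, hPu⟩ := hp.exists_highMoment_eq H hE hk₁ hd hQd hdz'
    (hdb.trans hs.switch.b_lt) (hs.a_lt H hE hk₀ hk₁ hd hQd hp) hQa
  have chord := hs.switch.slope_lt H (add_pos hk₀ hk₁) hd hdb hau
  rw [highMoment_eq_add k₀ (-E) d, lowMoment_eq_add k₀ (-E) d, hQd, hQu] at chord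
  have hcost : 0 < k₀ * (d ^ μ + μ / n * b ^ (n + μ) * d ^ (-n)) := by positivity
  linarith

lemma y_lt_b (hneg : ∀ x, d ≤ x → x < y → G x < 0) (hy : 0 < y) (hPy : P k y = P (-k₁) a')
    (hQy : Q k y = Q (-k₁) a') : y < b := by
  have hk := add_pos hk₀ hk₁
  have hb := hs.switch.b_pos
  have haa' := hs.a_lt H hE hk₀ hk₁ hd hQd hp
  obtain ⟨t, hta, lt_h⟩ := hs.switch.exists_lt_apply H hk
  have hpos : ∀ s ∈ Ioo a a', 0 < h s + -k₁ := fun s hsa => by linarith [lt_h s (hta.trans hsa.1)]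
  have hPlt := H.lowMoment_lt_of_pos hs.switch.a_pos.le haa' hpos
  have hQlt := H.highMoment_lt_of_pos hs.switch.a_pos haa' hpos
  have gap_b : 0 < G b := by
    rw [lineGap_eq k₀ _ _ hb, hs.switch.lowMoment_eq, hs.switch.highMoment_eq]
    nlinarith [Real.rpow_pos_of_pos hb (n + μ)]
  have gap_y : G y = 0 := lineGap_eq_zero hy hPy hQy
  rcases lt_trichotomy y b with hlt | rfl | hlt
  · exact hlt
  · exact absurd gap_y gap_b.ne'
  · exact absurd (hneg b (hs.d_lt_b H hE hk₀ hk₁ hd hQd).le hlt) gap_b.not_gt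

lemma k₀_lt (hneg : ∀ x, d ≤ x → x < y → G x < 0) (hy : 0 < y) (hPy : P k y = P (-k₁) a')
    (hQy : Q k y = Q (-k₁) a') : k₀ < k := by
  have hμ := H.mu_pos
  have hn := H.n_pos
  have hb := hs.switch.b_pos
  have chord := hs.switch.slope_lt H (add_pos hk₀ hk₁) hy
    (hs.y_lt_b H hE hk₀ hk₁ hd hQd hp hneg hy hPy hQy) (hs.a_lt H hE hk₀ hk₁ hd hQd hp)
  rw [← hPy, ← hQy, highMoment_eq_add k k₀, lowMoment_eq_add k k₀] at chord
  have hcost : 0 < (k - k₀) * (y ^ μ + μ / n * b ^ (n + μ) * y ^ (-n)) := by linarith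
  exact sub_pos.1 (pos_of_mul_pos_left hcost (by positivity))

end SolvesSystem

lemma IsEntryPair.exists_solvesSystem (hp : IsEntryPair μ n h E k₁ d z' a') (hE : 0 < E)
    (hk₀ : 0 < k₀) (hk₁ : 0 < k₁) (hd : 0 < d) (hQd : Q (-E) d = 0) (hdy : d < y)
    (hle : ∀ s, 0 < s → s < y → h s + k ≤ 0) (hPy : P k y = P (-k₁) a')
    (hQy : Q k y = Q (-k₁) a') (hk : k₀ < k) :
    ∃ z x g b a, SolvesSystem μ n h E k₀ k₁ z x g b a := by
  obtain ⟨b, a, hs, hyb, haa'⟩ := H.exists_isSwitchPair (add_pos hk₀ hk₁) hk (hd.trans hdy)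
    (hd.trans hp.d_lt) hPy hQy hle (hp.lt_apply H hE hk₁ hd hQd le_rfl)
  have hhb := hs.apply_b_lt H (add_pos hk₀ hk₁)
  have hdb := hdy.trans hyb
  have hda := hdb.trans hs.b_lt
  have hQb : (k₀ + E) * d ^ (-n) < Q k₀ b := by
    have hlt := H.strictMonoOn_highMoment hhb ⟨hd, hdb.le⟩ (right_mem_Ioc.2 hs.b_pos) hdb
    linarith [highMoment_eq_add (n := n) (h := h) k₀ (-E) d]
  have hQb_pos : 0 < Q k₀ b := lt_trans (by positivity) hQb
  have hz := negPowRoot_pos (n := n) hE hQb_pos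
  have hQz := mul_negPowRoot H.n_pos hE hQb_pos
  have hF := hp.pairExcess_neg H hE hk₁ hd hQd (hd.trans hda) (by
    rw [← hs.highMoment_eq]
    linarith [mul_lt_mul_of_pos_left (H.rpow_neg_lt hd hda) hE,
      mul_pos hk₀ (Real.rpow_pos_of_pos hd (-n))]) haa'
  rw [H.pairExcess_eq hE hz (hs.highMoment_eq.symm.trans hQz.symm), ← hs.lowMoment_eq] at hF
  have D : IsInnerData n h E k₀ (negPowRoot n E (Q k₀ b)) b d :=
    ⟨hE, hk₀, hz, hd, hQd, hQz.symm, hhb⟩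
  obtain ⟨x, g, hi, hgb⟩ := D.exists_isInnerPair H hdb (sub_neg.1 hF)
  exact ⟨_, x, g, b, a, hz, hi, hgb, hs, hQz.symm⟩

end

/-- The general solution of the Euler equation with roots `-μ`, `n` and right-hand side
`-(n + μ) * (ε * h + c)`, see `HasMoments.exists_hasDerivAt_pieceDeriv`: the free constants `a`, `b`
multiply the two homogeneous solutions. The functions `w₁`, `w₀` are glued from such pieces, with
`ε = 1` or `ε = 0`. -/
noncomputable def piece (μ n : ℝ) (h : ℝ → ℝ) (ε a b c x : ℝ) : ℝ :=
  (ε * lowMoment μ h 0 x + a + c * x ^ μ) * x ^ (-μ) / μ +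
    (ε * highMoment n h 0 x + b + c * x ^ (-n)) * x ^ n / n

/-- The derivative of `piece μ n h ε a b c`, in which `c` cancels. -/
noncomputable def pieceDeriv (μ n : ℝ) (h : ℝ → ℝ) (ε a b x : ℝ) : ℝ :=
  x ^ (-μ - 1) * (ε * resolventSlope μ n h x + b * x ^ (n + μ) - a)

lemma pieceDeriv_eq {μ n : ℝ} {h : ℝ → ℝ} (ε a b c : ℝ) {x : ℝ} (hx : 0 < x) :
    pieceDeriv μ n h ε a b x = x ^ (-μ - 1) *
      (x ^ (n + μ) * (ε * highMoment n h 0 x + b + c * x ^ (-n)) -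
        (ε * lowMoment μ h 0 x + a + c * x ^ μ)) := by
  rw [pieceDeriv, resolventSlope, ← rpow_add_mul_rpow_neg μ n hx]
  ring

lemma hasDerivWithinAt_integral_rpow_mul {f : ℝ → ℝ} {e l x u v : ℝ} {s t : Set ℝ}
    [intervalIntegral.FTCFilter x (𝓝[s] x) (𝓝[t] x)] (hx : 0 < x) (hux : u < x) (hxv : x < v)
    (hint : IntervalIntegrable (fun y => y ^ e * f y) volume u v)
    (hl : Tendsto f (𝓝[t] x ⊓ ae volume) (𝓝 l)) :
    HasDerivWithinAt (fun y => ∫ r in x..y, r ^ e * f r) (x ^ e * l) s x := by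
  have tendsto_rpow : Tendsto (fun y : ℝ => y ^ e) (𝓝[t] x ⊓ ae volume) (𝓝 (x ^ e)) :=
    (Real.continuousAt_rpow_const x _ (Or.inl hx.ne')).tendsto.mono_left
      (inf_le_left.trans nhdsWithin_le_nhds)
  have measurable : StronglyMeasurableAtFilter (fun y => y ^ e * f y) (𝓝[t] x) volume :=
    ⟨Ioc u v, mem_nhdsWithin_of_mem_nhds (mem_of_superset (Ioo_mem_nhds hux hxv)
      Ioo_subset_Ioc_self), hint.1.aestronglyMeasurable⟩
  exact intervalIntegral.integral_hasDerivWithinAt_of_tendsto_ae_right IntervalIntegrable.refl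
    measurable (tendsto_rpow.mul hl)

namespace HasMoments

variable {μ n : ℝ} {h : ℝ → ℝ} (H : HasMoments μ n h)

local notation "P" => lowMoment μ h
local notation "Q" => highMoment n h
local notation "V" => resolventSlope μ n h

include H

section oneSided

variable {x l : ℝ} {s t : Set ℝ} [intervalIntegral.FTCFilter x (𝓝[s] x) (𝓝[t] x)]

lemma hasDerivWithinAt_lowMoment (hx : 0 < x) (hl : Tendsto h (𝓝[t] x ⊓ ae volume) (𝓝 l)) :
    HasDerivWithinAt (P 0) (μ * x ^ (μ - 1) * l) s x := by
  have deriv_integral := hasDerivWithinAt_integral_rpow_mul (s := s) hx (half_lt_self hx)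
    (lt_two_mul_self hx) (H.intervalIntegrable_low (half_pos hx).le (by positivity)) hl
  rw [mul_assoc]
  refine ((deriv_integral.const_mul μ).const_add (P 0 x)).congr_of_eventuallyEq ?_ (by simp)
  filter_upwards [nhdsWithin_le_nhds (Ioi_mem_nhds hx)] with y hy
  have increment := H.lowMoment_sub 0 hx.le (le_of_lt hy)
  simp only [add_zero, mul_assoc, intervalIntegral.integral_const_mul] at increment
  linarith

lemma hasDerivWithinAt_highMoment (hx : 0 < x) (hl : Tendsto h (𝓝[t] x ⊓ ae volume) (𝓝 l)) :
    HasDerivWithinAt (Q 0) (-(n * x ^ (-n - 1) * l)) s x := by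
  have deriv_integral := hasDerivWithinAt_integral_rpow_mul (s := s) hx (half_lt_self hx)
    (lt_two_mul_self hx) (H.intervalIntegrable_high (half_pos hx) (by positivity)) hl
  rw [mul_assoc]
  refine ((deriv_integral.const_mul n).const_sub (Q 0 x)).congr_of_eventuallyEq ?_ (by simp)
  filter_upwards [nhdsWithin_le_nhds (Ioi_mem_nhds hx)] with y hy
  have increment := H.highMoment_sub 0 hx hy
  simp only [add_zero, mul_assoc, intervalIntegral.integral_const_mul] at increment
  linarith

lemma hasDerivWithinAt_piece (ε a b c : ℝ) (hx : 0 < x)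
    (hl : Tendsto h (𝓝[t] x ⊓ ae volume) (𝓝 l)) :
    HasDerivWithinAt (piece μ n h ε a b c) (pieceDeriv μ n h ε a b x) s x := by
  have hμ := H.mu_pos
  have hn := H.n_pos
  have rpow_deriv : ∀ e : ℝ, HasDerivWithinAt (fun y : ℝ => y ^ e) (e * x ^ (e - 1)) s x :=
    fun e => (Real.hasDerivAt_rpow_const (Or.inl hx.ne')).hasDerivWithinAt
  have low_deriv := (((((H.hasDerivWithinAt_lowMoment (s := s) hx hl).const_mul ε).add_const
    a).add ((rpow_deriv μ).const_mul c)).mul (rpow_deriv (-μ))).div_const μ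
  have high_deriv := (((((H.hasDerivWithinAt_highMoment (s := s) hx hl).const_mul ε).add_const
    b).add ((rpow_deriv (-n)).const_mul c)).mul (rpow_deriv n)).div_const n
  refine (low_deriv.add high_deriv).congr_deriv ?_
  rw [pieceDeriv_eq ε a b c hx]
  simp only [Real.rpow_sub_one hx.ne', Real.rpow_neg hx.le, Real.rpow_add hx, Pi.add_apply]
  have hxμ : x ^ μ ≠ 0 := (Real.rpow_pos_of_pos hx _).ne'
  have hxn : x ^ n ≠ 0 := (Real.rpow_pos_of_pos hx _).ne'
  field_simp
  ring

end oneSided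

lemma continuousOn_resolventSlope : ContinuousOn V (Ioi 0) :=
  ((continuousOn_id.rpow_const fun _ hx => Or.inl (ne_of_gt hx)).mul
    (H.continuousOn_highMoment 0 fun _ hx => hx)).sub (H.continuousOn_lowMoment 0 fun _ hx => hx)

lemma continuousOn_pieceDeriv (ε a b : ℝ) : ContinuousOn (pieceDeriv μ n h ε a b) (Ioi 0) := by
  have continuousOn_rpow : ∀ e : ℝ, ContinuousOn (fun x : ℝ => x ^ e) (Ioi 0) := fun e =>
    continuousOn_id.rpow_const fun x hx => Or.inl (ne_of_gt hx)
  exact (continuousOn_rpow _).mul (((continuousOn_const.mul H.continuousOn_resolventSlope).add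
    (continuousOn_const.mul (continuousOn_rpow _))).sub continuousOn_const)

lemma hasDerivAt_resolventSlope {x : ℝ} (hx : 0 < x) (hc : ContinuousAt h x) :
    HasDerivAt V ((n + μ) * x ^ (n + μ - 1) * Q 0 x +
      x ^ (n + μ) * -(n * x ^ (-n - 1) * h x) - μ * x ^ (μ - 1) * h x) x := by
  have hl : Tendsto h (𝓝[univ] x ⊓ ae volume) (𝓝 (h x)) :=
    hc.tendsto.mono_left (inf_le_left.trans nhdsWithin_le_nhds)
  have : intervalIntegral.FTCFilter x (𝓝[univ] x) (𝓝[univ] x) := by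
    rw [nhdsWithin_univ]; infer_instance
  exact ((Real.hasDerivAt_rpow_const (Or.inl hx.ne')).mul (hasDerivWithinAt_univ.1
    (H.hasDerivWithinAt_highMoment (s := univ) hx hl))).sub
    (hasDerivWithinAt_univ.1 (H.hasDerivWithinAt_lowMoment (s := univ) hx hl))

lemma exists_hasDerivAt_pieceDeriv (ε a b c : ℝ) {x : ℝ} (hx : 0 < x) (hc : ContinuousAt h x) :
    ∃ D, HasDerivAt (pieceDeriv μ n h ε a b) D x ∧
      x ^ 2 * D + (1 + μ - n) * x * pieceDeriv μ n h ε a b x - μ * n * piece μ n h ε a b c x =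
        -((n + μ) * (ε * h x + c)) := by
  have hμ := H.mu_pos
  have hn := H.n_pos
  have rpow_deriv : ∀ e : ℝ, HasDerivAt (fun y : ℝ => y ^ e) (e * x ^ (e - 1)) x := fun e =>
    Real.hasDerivAt_rpow_const (Or.inl hx.ne')
  refine ⟨_, (rpow_deriv (-μ - 1)).mul ((((H.hasDerivAt_resolventSlope hx hc).const_mul ε).add
    ((rpow_deriv (n + μ)).const_mul b)).sub_const a), ?_⟩
  rw [pieceDeriv, piece, resolventSlope]
  simp only [Real.rpow_sub_one hx.ne', Real.rpow_neg hx.le, Real.rpow_add hx]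
  have hxμ : x ^ μ ≠ 0 := (Real.rpow_pos_of_pos hx _).ne'
  have hxn : x ^ n ≠ 0 := (Real.rpow_pos_of_pos hx _).ne'
  field_simp
  ring

end HasMoments

/-- `f` is continuously differentiable on `(0, ∞)`, with derivative `f'`. -/
structure HasC1Deriv (f f' : ℝ → ℝ) : Prop where
  hasDerivAt : ∀ x, 0 < x → HasDerivAt f (f' x) x
  continuousOn : ContinuousOn f' (Ioi 0)

namespace Payoff

variable {μ n : ℝ} {h : ℝ → ℝ} (H : Payoff μ n h)

include H

lemma exists_tendsto_nhdsLT {x : ℝ} (hx : 0 < x) : ∃ l, Tendsto h (𝓝[<] x) (𝓝 l) := by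
  have monotone_max : Monotone fun s => h (max s (x / 2)) := fun s t hst =>
    H.apply_le (lt_max_of_lt_right (half_pos hx)) (max_le_max_right _ hst)
  refine ⟨_, (monotone_max.tendsto_nhdsLT x).congr' ?_⟩
  filter_upwards [Ioo_mem_nhdsLT (half_lt_self hx)] with s hs
  rw [max_eq_left hs.1.le]

lemma hasDerivAt_piece (ε a b c : ℝ) {x : ℝ} (hx : 0 < x) :
    HasDerivAt (piece μ n h ε a b c) (pieceDeriv μ n h ε a b x) x := by
  obtain ⟨l, hl⟩ := H.exists_tendsto_nhdsLT hx
  have punctured : 𝓝[≤] x ⊓ ae volume ≤ 𝓝[<] x := by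
    rw [show Iio x = Iic x ∩ {x}ᶜ by ext y; simp [lt_iff_le_and_ne], nhdsWithin_inter']
    exact inf_le_inf_left _ (le_principal_iff.2 (by simp [mem_ae_iff]))
  have deriv_left := H.hasDerivWithinAt_piece (s := Iic x) ε a b c hx (hl.mono_left punctured)
  have deriv_right := H.hasDerivWithinAt_piece (s := Ici x) ε a b c hx
    ((H.right_cont x hx).tendsto.mono_left
      (inf_le_left.trans (nhdsWithin_mono _ Ioi_subset_Ici_self)))
  simpa only [Iic_union_Ici, hasDerivWithinAt_univ] using deriv_left.union deriv_right

lemma hasC1Deriv_piece (ε a b c : ℝ) :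
    HasC1Deriv (piece μ n h ε a b c) (pieceDeriv μ n h ε a b) :=
  ⟨fun _ hx => H.hasDerivAt_piece ε a b c hx, H.continuousOn_pieceDeriv ε a b⟩

end Payoff

/-- The function equal to `f` on `(-∞, a]` and to `g` on `(a, ∞)`. -/
noncomputable def glue (a : ℝ) (f g : ℝ → ℝ) (x : ℝ) : ℝ := if x ≤ a then f x else g x

section glue

variable {a x : ℝ} {f g : ℝ → ℝ}

lemma glue_of_le (hx : x ≤ a) : glue a f g x = f x := if_pos hx

lemma glue_of_lt (hx : a < x) : glue a f g x = g x := if_neg hx.not_ge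

lemma glue_of_ge (hfg : f a = g a) (hx : a ≤ x) : glue a f g x = g x := by
  rcases hx.eq_or_lt with rfl | hx
  · rw [glue_of_le le_rfl, hfg]
  · exact glue_of_lt hx

lemma glue_eventuallyEq_left (hx : x < a) : glue a f g =ᶠ[𝓝 x] f := by
  filter_upwards [Iio_mem_nhds hx] with y hy using glue_of_le (le_of_lt hy)

lemma glue_eventuallyEq_right (hx : a < x) : glue a f g =ᶠ[𝓝 x] g := by
  filter_upwards [Ioi_mem_nhds hx] with y hy using glue_of_lt hy

lemma continuousAt_glue (hfg : f a = g a) (hf : ContinuousAt f x) (hg : ContinuousAt g x) :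
    ContinuousAt (glue a f g) x := by
  rcases lt_trichotomy x a with hxa | rfl | hxa
  · exact hf.congr (glue_eventuallyEq_left hxa).symm
  · have left : ContinuousWithinAt (glue x f g) (Iic x) x :=
      hf.continuousWithinAt.congr (fun _ hy => glue_of_le hy) (glue_of_le le_rfl)
    have right : ContinuousWithinAt (glue x f g) (Ici x) x :=
      hg.continuousWithinAt.congr (fun _ hy => glue_of_ge hfg hy) (glue_of_ge hfg le_rfl)
    simpa only [Iic_union_Ici, continuousWithinAt_univ] using left.union right
  · exact hg.congr (glue_eventuallyEq_right hxa).symm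

lemma hasDerivAt_glue {f' g' : ℝ → ℝ} (hfg : f a = g a) (hfg' : f' a = g' a)
    (hf : HasDerivAt f (f' x) x) (hg : HasDerivAt g (g' x) x) :
    HasDerivAt (glue a f g) (glue a f' g' x) x := by
  rcases lt_trichotomy x a with hxa | rfl | hxa
  · rw [glue_of_le hxa.le]
    exact hf.congr_of_eventuallyEq (glue_eventuallyEq_left hxa)
  · have left : HasDerivWithinAt (glue x f g) (glue x f' g' x) (Iic x) x := by
      rw [glue_of_le le_rfl]
      exact hf.hasDerivWithinAt.congr (fun _ hy => glue_of_le hy) (glue_of_le le_rfl)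
    have right : HasDerivWithinAt (glue x f g) (glue x f' g' x) (Ici x) x := by
      rw [glue_of_ge hfg' le_rfl]
      exact hg.hasDerivWithinAt.congr (fun _ hy => glue_of_ge hfg hy) (glue_of_ge hfg le_rfl)
    simpa only [Iic_union_Ici, hasDerivWithinAt_univ] using left.union right
  · rw [glue_of_lt hxa]
    exact hg.congr_of_eventuallyEq (glue_eventuallyEq_right hxa)

end glue

namespace HasC1Deriv

variable {f f' g g' : ℝ → ℝ}

lemma glue {a : ℝ} (hf : HasC1Deriv f f') (hg : HasC1Deriv g g') (hfg : f a = g a)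
    (hfg' : f' a = g' a) : HasC1Deriv (glue a f g) (glue a f' g') where
  hasDerivAt x hx := hasDerivAt_glue hfg hfg' (hf.hasDerivAt x hx) (hg.hasDerivAt x hx)
  continuousOn _ hx := (continuousAt_glue hfg' (hf.continuousOn.continuousAt (Ioi_mem_nhds hx))
    (hg.continuousOn.continuousAt (Ioi_mem_nhds hx))).continuousWithinAt

lemma sub (hf : HasC1Deriv f f') (hg : HasC1Deriv g g') :
    HasC1Deriv (fun x => f x - g x) (fun x => f' x - g' x) :=
  ⟨fun x hx => (hf.hasDerivAt x hx).sub (hg.hasDerivAt x hx), hf.continuousOn.sub hg.continuousOn⟩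

lemma monotoneOn (hf : HasC1Deriv f f') {D : Set ℝ} (hD : Convex ℝ D) (hD0 : ∀ x ∈ D, 0 < x)
    (hf' : ∀ x ∈ D, 0 ≤ f' x) : MonotoneOn f D :=
  monotoneOn_of_hasDerivWithinAt_nonneg hD
    (fun x hx => (hf.hasDerivAt x (hD0 x hx)).continuousAt.continuousWithinAt)
    (fun x hx => (hf.hasDerivAt x (hD0 x (interior_subset hx))).hasDerivWithinAt)
    fun x hx => hf' x (interior_subset hx)

lemma antitoneOn (hf : HasC1Deriv f f') {D : Set ℝ} (hD : Convex ℝ D) (hD0 : ∀ x ∈ D, 0 < x)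
    (hf' : ∀ x ∈ D, f' x ≤ 0) : AntitoneOn f D :=
  antitoneOn_of_hasDerivWithinAt_nonpos hD
    (fun x hx => (hf.hasDerivAt x (hD0 x hx)).continuousAt.continuousWithinAt)
    (fun x hx => (hf.hasDerivAt x (hD0 x (interior_subset hx))).hasDerivWithinAt)
    fun x hx => hf' x (interior_subset hx)

end HasC1Deriv

section matching

variable {μ n : ℝ} {h : ℝ → ℝ}

lemma piece_const (hμ : μ ≠ 0) (hn : n ≠ 0) (ε a b c c' : ℝ) {x : ℝ} (hx : 0 < x) :
    piece μ n h ε a b c x = piece μ n h ε a b c' x + (c - c') * (1 / μ + 1 / n) := by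
  have hxμ : x ^ μ ≠ 0 := (Real.rpow_pos_of_pos hx _).ne'
  have hxn : x ^ n ≠ 0 := (Real.rpow_pos_of_pos hx _).ne'
  simp only [piece, Real.rpow_neg hx.le]
  field_simp
  ring

lemma piece_zero (hμ : μ ≠ 0) (hn : n ≠ 0) (c : ℝ) {x : ℝ} (hx : 0 < x) :
    piece μ n h 0 0 0 c x = c * (1 / μ + 1 / n) := by
  rw [piece_const hμ hn 0 0 0 c 0 hx]
  simp [piece]

lemma pieceDeriv_zero (x : ℝ) : pieceDeriv μ n h 0 0 0 x = 0 := by simp [pieceDeriv]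

lemma pieceDeriv_sub (a b a' b' x : ℝ) :
    pieceDeriv μ n h 0 a b x - pieceDeriv μ n h 1 a' b' x =
      -(x ^ (-μ - 1) * lineGap μ n h (a - a') (b - b') x) := by
  rw [pieceDeriv, pieceDeriv, lineGap]
  ring

lemma piece_eq_and_pieceDeriv_eq {ε a b c ε' a' b' c' x : ℝ} (hx : 0 < x)
    (hlow : ε * lowMoment μ h 0 x + a + c * x ^ μ = ε' * lowMoment μ h 0 x + a' + c' * x ^ μ)
    (hhigh : ε * highMoment n h 0 x + b + c * x ^ (-n) =
      ε' * highMoment n h 0 x + b' + c' * x ^ (-n)) :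
    piece μ n h ε a b c x = piece μ n h ε' a' b' c' x ∧
      pieceDeriv μ n h ε a b x = pieceDeriv μ n h ε' a' b' x := by
  rw [pieceDeriv_eq ε a b c hx, pieceDeriv_eq ε' a' b' c' hx, piece, piece, hlow, hhigh]
  exact ⟨rfl, rfl⟩

end matching

/-- The candidate `w₁` for the value function of the open mode, multiplied by `σ² (n - m)`. The
names `E` and `k₀` stand for `-r K` and `r K₀`. -/
noncomputable def openValue (μ n : ℝ) (h : ℝ → ℝ) (E k₀ : ℝ) (p : FreeBoundary) : ℝ → ℝ :=
  glue p.δ (piece μ n h 0 0 0 E)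
    (glue p.γ (piece μ n h 1 (-lowMoment μ h (-E) p.δ) (-highMoment n h (-E) p.δ) 0)
      (glue p.β (piece μ n h 0 (E * p.ζ ^ μ) (E * p.ζ ^ (-n)) (-k₀))
        (piece μ n h 1 (E * p.ζ ^ μ - lowMoment μ h k₀ p.β) 0 0)))

/-- The derivative of `openValue μ n h E k₀ p`. -/
noncomputable def openDeriv (μ n : ℝ) (h : ℝ → ℝ) (E k₀ : ℝ) (p : FreeBoundary) : ℝ → ℝ :=
  glue p.δ (pieceDeriv μ n h 0 0 0)
    (glue p.γ (pieceDeriv μ n h 1 (-lowMoment μ h (-E) p.δ) (-highMoment n h (-E) p.δ))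
      (glue p.β (pieceDeriv μ n h 0 (E * p.ζ ^ μ) (E * p.ζ ^ (-n)))
        (pieceDeriv μ n h 1 (E * p.ζ ^ μ - lowMoment μ h k₀ p.β) 0)))

/-- The candidate `w₀` for the value function of the closed mode, multiplied by `σ² (n - m)`, with
`k₁` for `r K₁`. -/
noncomputable def closedValue (μ n : ℝ) (h : ℝ → ℝ) (E k₀ k₁ : ℝ) (p : FreeBoundary) : ℝ → ℝ :=
  glue p.ζ (piece μ n h 0 0 0 E)
    (glue p.α (piece μ n h 0 (E * p.ζ ^ μ) (E * p.ζ ^ (-n)) 0)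
      (piece μ n h 1 (E * p.ζ ^ μ - lowMoment μ h k₀ p.β) 0 (-k₁)))

/-- The derivative of `closedValue μ n h E k₀ k₁ p`. -/
noncomputable def closedDeriv (μ n : ℝ) (h : ℝ → ℝ) (E k₀ : ℝ) (p : FreeBoundary) : ℝ → ℝ :=
  glue p.ζ (pieceDeriv μ n h 0 0 0)
    (glue p.α (pieceDeriv μ n h 0 (E * p.ζ ^ μ) (E * p.ζ ^ (-n)))
      (pieceDeriv μ n h 1 (E * p.ζ ^ μ - lowMoment μ h k₀ p.β) 0))

namespace SolvesSystem

variable {μ n : ℝ} {h : ℝ → ℝ} {E k₀ k₁ : ℝ} {p : FreeBoundary} {x : ℝ}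

local notation "P" => lowMoment μ h
local notation "Q" => highMoment n h
local notation "W₁" => openValue μ n h E k₀ p
local notation "DW₁" => openDeriv μ n h E k₀ p
local notation "W₀" => closedValue μ n h E k₀ k₁ p
local notation "DW₀" => closedDeriv μ n h E k₀ p

lemma match_delta (E : ℝ) (hx : 0 < x) :
    piece μ n h 0 0 0 E x = piece μ n h 1 (-P (-E) x) (-Q (-E) x) 0 x ∧
      pieceDeriv μ n h 0 0 0 x = pieceDeriv μ n h 1 (-P (-E) x) (-Q (-E) x) x :=
  piece_eq_and_pieceDeriv_eq hx (by linarith [lowMoment_eq_add (μ := μ) (h := h) (-E) 0 x])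
    (by linarith [highMoment_eq_add (n := n) (h := h) (-E) 0 x])

lemma match_zeta (E : ℝ) (hx : 0 < x) :
    piece μ n h 0 0 0 E x = piece μ n h 0 (E * x ^ μ) (E * x ^ (-n)) 0 x ∧
      pieceDeriv μ n h 0 0 0 x = pieceDeriv μ n h 0 (E * x ^ μ) (E * x ^ (-n)) x :=
  piece_eq_and_pieceDeriv_eq hx (by ring) (by ring)

variable (hs : SolvesSystem μ n h E k₀ k₁ p.ζ p.δ p.γ p.β p.α)
include hs

lemma match_gamma :
    piece μ n h 1 (-P (-E) p.δ) (-Q (-E) p.δ) 0 p.γ =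
        piece μ n h 0 (E * p.ζ ^ μ) (E * p.ζ ^ (-n)) (-k₀) p.γ ∧
      pieceDeriv μ n h 1 (-P (-E) p.δ) (-Q (-E) p.δ) p.γ =
        pieceDeriv μ n h 0 (E * p.ζ ^ μ) (E * p.ζ ^ (-n)) p.γ :=
  piece_eq_and_pieceDeriv_eq hs.inner.g_pos
    (by linarith [hs.inner.lowMoment_eq, lowMoment_eq_add (μ := μ) (h := h) k₀ 0 p.γ])
    (by linarith [hs.inner.highMoment_eq, highMoment_eq_add (n := n) (h := h) k₀ 0 p.γ])

lemma match_beta :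
    piece μ n h 0 (E * p.ζ ^ μ) (E * p.ζ ^ (-n)) (-k₀) p.β =
        piece μ n h 1 (E * p.ζ ^ μ - P k₀ p.β) 0 0 p.β ∧
      pieceDeriv μ n h 0 (E * p.ζ ^ μ) (E * p.ζ ^ (-n)) p.β =
        pieceDeriv μ n h 1 (E * p.ζ ^ μ - P k₀ p.β) 0 p.β :=
  piece_eq_and_pieceDeriv_eq hs.switch.b_pos
    (by linarith [lowMoment_eq_add (μ := μ) (h := h) k₀ 0 p.β])
    (by linarith [hs.highMoment_b, highMoment_eq_add (n := n) (h := h) k₀ 0 p.β])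

lemma match_alpha :
    piece μ n h 0 (E * p.ζ ^ μ) (E * p.ζ ^ (-n)) 0 p.α =
        piece μ n h 1 (E * p.ζ ^ μ - P k₀ p.β) 0 (-k₁) p.α ∧
      pieceDeriv μ n h 0 (E * p.ζ ^ μ) (E * p.ζ ^ (-n)) p.α =
        pieceDeriv μ n h 1 (E * p.ζ ^ μ - P k₀ p.β) 0 p.α :=
  piece_eq_and_pieceDeriv_eq hs.switch.a_pos
    (by linarith [hs.switch.lowMoment_eq, lowMoment_eq_add (μ := μ) (h := h) (-k₁) 0 p.α])
    (by linarith [hs.switch.highMoment_eq, hs.highMoment_b,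
      highMoment_eq_add (n := n) (h := h) (-k₁) 0 p.α])

lemma zeta_lt_beta (hζδ : p.ζ < p.δ) : p.ζ < p.β := hζδ.trans (hs.inner.x_lt.trans hs.g_lt)

lemma zeta_lt_alpha (hζδ : p.ζ < p.δ) : p.ζ < p.α := (hs.zeta_lt_beta hζδ).trans hs.switch.b_lt

variable (H : Payoff μ n h)
include H

lemma hasC1Deriv_openValue : HasC1Deriv W₁ DW₁ := by
  obtain ⟨value_delta, deriv_delta⟩ := match_delta (μ := μ) (n := n) (h := h) E hs.inner.x_pos
  obtain ⟨value_gamma, deriv_gamma⟩ := hs.match_gamma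
  obtain ⟨value_beta, deriv_beta⟩ := hs.match_beta
  refine (H.hasC1Deriv_piece _ _ _ _).glue ((H.hasC1Deriv_piece _ _ _ _).glue
    ((H.hasC1Deriv_piece _ _ _ _).glue (H.hasC1Deriv_piece _ _ _ _) value_beta deriv_beta)
    ?_ ?_) ?_ ?_
  · rwa [glue_of_le hs.g_lt.le]
  · rwa [glue_of_le hs.g_lt.le]
  · rwa [glue_of_le hs.inner.x_lt.le]
  · rwa [glue_of_le hs.inner.x_lt.le]

lemma hasC1Deriv_closedValue (hζα : p.ζ < p.α) : HasC1Deriv W₀ DW₀ := by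
  obtain ⟨value_zeta, deriv_zeta⟩ := match_zeta (μ := μ) (n := n) (h := h) E hs.z_pos
  obtain ⟨value_alpha, deriv_alpha⟩ := hs.match_alpha
  refine (H.hasC1Deriv_piece _ _ _ _).glue ((H.hasC1Deriv_piece _ _ _ _).glue
    (H.hasC1Deriv_piece _ _ _ _) value_alpha deriv_alpha) ?_ ?_
  · rwa [glue_of_le hζα.le]
  · rwa [glue_of_le hζα.le]

end SolvesSystem

section signs

variable {μ n : ℝ} {h : ℝ → ℝ} {E k₀ a x z : ℝ}

local notation "P" => lowMoment μ h
local notation "Q" => highMoment n h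

lemma HasMoments.rpow_mul_le (H : HasMoments μ n h) (hE : 0 ≤ E) (hz : 0 < z) (hzx : z ≤ x) :
    E * z ^ μ ≤ x ^ (n + μ) * (E * z ^ (-n)) := by
  rw [← rpow_add_mul_rpow_neg μ n hz, mul_left_comm]
  exact mul_le_mul_of_nonneg_right (H.rpow_le hz.le hzx)
    (mul_nonneg hE (Real.rpow_nonneg hz.le _))

lemma HasMoments.pieceDeriv_hom_nonneg (H : HasMoments μ n h) (hE : 0 ≤ E) (hz : 0 < z)
    (hzx : z ≤ x) : 0 ≤ pieceDeriv μ n h 0 (E * z ^ μ) (E * z ^ (-n)) x :=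
  mul_nonneg (Real.rpow_nonneg (hz.le.trans hzx) _) (by linarith [H.rpow_mul_le hE hz hzx])

variable (H : Payoff μ n h)
include H

lemma Payoff.pieceDeriv_inner_nonneg (hz : 0 < z) (hQ : Q (-E) z ≤ 0) (hzx : z ≤ x) :
    0 ≤ pieceDeriv μ n h 1 (-P (-E) z) (-Q (-E) z) x := by
  refine mul_nonneg (Real.rpow_nonneg (hz.le.trans hzx) _) ?_
  have slope_le := H.resolventSlope_mono hz hzx
  rw [resolventSlope_eq (-E) hz] at slope_le
  linarith [mul_le_mul_of_nonpos_right (H.rpow_le hz.le hzx) hQ]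

lemma Payoff.pieceDeriv_right_nonneg {b : ℝ} (hE : 0 ≤ E) (hz : 0 < z) (hzb : z ≤ b)
    (hbx : b ≤ x) (hQb : Q k₀ b = E * z ^ (-n)) :
    0 ≤ pieceDeriv μ n h 1 (E * z ^ μ - P k₀ b) 0 x := by
  have hb : 0 < b := hz.trans_le hzb
  refine mul_nonneg (Real.rpow_nonneg (hb.le.trans hbx) _) ?_
  have slope_le := H.resolventSlope_mono hb hbx
  rw [resolventSlope_eq k₀ hb, hQb] at slope_le
  linarith [H.rpow_mul_le hE hz hzb]

end signs

namespace SolvesSystem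

variable {μ n : ℝ} {h : ℝ → ℝ} {E k₀ k₁ : ℝ} {p : FreeBoundary} {x : ℝ}

local notation "P" => lowMoment μ h
local notation "Q" => highMoment n h
local notation "W₁" => openValue μ n h E k₀ p
local notation "DW₁" => openDeriv μ n h E k₀ p
local notation "W₀" => closedValue μ n h E k₀ k₁ p
local notation "DW₀" => closedDeriv μ n h E k₀ p

variable (hs : SolvesSystem μ n h E k₀ k₁ p.ζ p.δ p.γ p.β p.α) (H : Payoff μ n h)
  (hζδ : p.ζ < p.δ)
include hs H hζδ

lemma openDeriv_nonneg (hE : 0 ≤ E) (hQδ : Q (-E) p.δ ≤ 0) (x : ℝ) : 0 ≤ DW₁ x := by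
  rw [openDeriv]
  rcases le_or_gt x p.δ with hxδ | hδx
  · rw [glue_of_le hxδ, pieceDeriv_zero]
  rw [glue_of_lt hδx]
  rcases le_or_gt x p.γ with hxγ | hγx
  · rw [glue_of_le hxγ]
    exact H.pieceDeriv_inner_nonneg hs.inner.x_pos hQδ hδx.le
  rw [glue_of_lt hγx]
  rcases le_or_gt x p.β with hxβ | hβx
  · rw [glue_of_le hxβ]
    exact H.pieceDeriv_hom_nonneg hE hs.z_pos (hζδ.trans hδx).le
  · rw [glue_of_lt hβx]
    exact H.pieceDeriv_right_nonneg hE hs.z_pos (hs.zeta_lt_beta hζδ).le hβx.le hs.highMoment_b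

lemma closedDeriv_nonneg (hE : 0 ≤ E) (x : ℝ) : 0 ≤ DW₀ x := by
  rw [closedDeriv]
  rcases le_or_gt x p.ζ with hxζ | hζx
  · rw [glue_of_le hxζ, pieceDeriv_zero]
  rw [glue_of_lt hζx]
  rcases le_or_gt x p.α with hxα | hαx
  · rw [glue_of_le hxα]
    exact H.pieceDeriv_hom_nonneg hE hs.z_pos hζx.le
  · rw [glue_of_lt hαx]
    exact H.pieceDeriv_right_nonneg hE hs.z_pos (hs.zeta_lt_beta hζδ).le
      (hs.switch.b_lt.trans hαx).le hs.highMoment_b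

lemma openDeriv_le_closedDeriv (hE : 0 ≤ E) (hk : 0 < k₀ + k₁) (hx : 0 < x) (hxγ : x ≤ p.γ) :
    DW₁ x ≤ DW₀ x := by
  have hγα := hs.g_lt.trans hs.switch.b_lt
  rcases le_or_gt x p.δ with hxδ | hδx
  · rw [openDeriv, glue_of_le hxδ, pieceDeriv_zero]
    exact hs.closedDeriv_nonneg H hζδ hE x
  rw [← sub_nonneg, openDeriv, glue_of_lt hδx, glue_of_le hxγ, closedDeriv,
    glue_of_lt (hζδ.trans hδx), glue_of_le (hxγ.trans hγα.le), pieceDeriv_sub, sub_neg_eq_add,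
    sub_neg_eq_add, ← sub_eq_iff_eq_add.1 hs.inner.lowMoment_eq,
    ← sub_eq_iff_eq_add.1 hs.inner.highMoment_eq, ← mul_neg]
  refine mul_nonneg (Real.rpow_nonneg hx.le _) (neg_nonneg.2 ?_)
  rcases hxγ.eq_or_lt with rfl | hxγ
  · exact (lineGap_eq_zero hx rfl rfl).le
  · have hhβ := hs.switch.apply_b_lt H hk
    exact (H.lineGap_neg_left hx hxγ fun s hs' => by
      linarith [H.apply_le (hx.trans hs'.1) (hs'.2.le.trans hs.g_lt.le)]).le

lemma closedDeriv_le_openDeriv (hγx : p.γ ≤ x) : DW₀ x ≤ DW₁ x := by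
  have hβα := hs.switch.b_lt
  have hβ := hs.switch.b_pos
  have hζx := hζδ.trans (hs.inner.x_lt.trans_le hγx)
  have openDeriv_eq : DW₁ x = glue p.β (pieceDeriv μ n h 0 (E * p.ζ ^ μ) (E * p.ζ ^ (-n)))
      (pieceDeriv μ n h 1 (E * p.ζ ^ μ - P k₀ p.β) 0) x := by
    rw [openDeriv, glue_of_lt (hs.inner.x_lt.trans_le hγx)]
    exact glue_of_ge (by rw [glue_of_le hs.g_lt.le, hs.match_gamma.2]) hγx
  rw [openDeriv_eq, closedDeriv, glue_of_lt hζx]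
  rcases le_or_gt x p.β with hxβ | hβx
  · rw [glue_of_le hxβ, glue_of_le (hxβ.trans hβα.le)]
  rw [glue_of_lt hβx]
  rcases le_or_gt x p.α with hxα | hαx
  · rw [glue_of_le hxα, ← sub_nonpos, pieceDeriv_sub, sub_sub_cancel, sub_zero, neg_nonpos]
    refine mul_nonneg (Real.rpow_nonneg (hs.inner.g_pos.le.trans hγx) _)
      (H.lineGap_nonneg hβ hβx.le hxα ?_ ?_)
    · exact (lineGap_eq_zero hβ rfl hs.highMoment_b).ge
    · exact (lineGap_eq_zero hs.switch.a_pos hs.switch.lowMoment_eq.symm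
        (hs.switch.highMoment_eq.symm.trans hs.highMoment_b)).ge
  · rw [glue_of_lt hαx]

lemma closedValue_sub_openValue_of_mem_Icc (hx : x ∈ Icc p.γ p.β) :
    W₀ x - W₁ x = k₀ * (1 / μ + 1 / n) := by
  have hδx := hs.inner.x_lt.trans_le hx.1
  rw [openValue, glue_of_lt hδx,
    glue_of_ge (by rw [glue_of_le hs.g_lt.le, hs.match_gamma.1]) hx.1, glue_of_le hx.2,
    closedValue, glue_of_lt (hζδ.trans hδx), glue_of_le (hx.2.trans hs.switch.b_lt.le),
    piece_const H.mu_pos.ne' H.n_pos.ne' 0 _ _ (-k₀) 0 (hs.inner.g_pos.trans_le hx.1)]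
  ring

lemma closedValue_sub_openValue_of_le (hαx : p.α ≤ x) :
    W₀ x - W₁ x = -k₁ * (1 / μ + 1 / n) := by
  have hβx := hs.switch.b_lt.trans_le hαx
  have hγx := hs.g_lt.trans hβx
  rw [closedValue, glue_of_lt ((hs.zeta_lt_alpha hζδ).trans_le hαx),
    glue_of_ge hs.match_alpha.1 hαx, openValue, glue_of_lt (hs.inner.x_lt.trans hγx),
    glue_of_lt hγx, glue_of_lt hβx,
    piece_const H.mu_pos.ne' H.n_pos.ne' 1 _ _ (-k₁) 0 (hs.switch.a_pos.trans_le hαx)]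
  ring

lemma monotoneOn_closedValue_sub_openValue (hE : 0 ≤ E) (hk : 0 < k₀ + k₁) :
    MonotoneOn (fun x => W₀ x - W₁ x) (Ioc 0 p.γ) :=
  ((hs.hasC1Deriv_closedValue H (hs.zeta_lt_alpha hζδ)).sub (hs.hasC1Deriv_openValue H)).monotoneOn
    (convex_Ioc 0 p.γ) (fun _ hx => hx.1) fun _ hx =>
      sub_nonneg.2 (hs.openDeriv_le_closedDeriv H hζδ hE hk hx.1 hx.2)

lemma antitoneOn_closedValue_sub_openValue : AntitoneOn (fun x => W₀ x - W₁ x) (Ici p.γ) :=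
  ((hs.hasC1Deriv_closedValue H (hs.zeta_lt_alpha hζδ)).sub (hs.hasC1Deriv_openValue H)).antitoneOn
    (convex_Ici p.γ) (fun _ hx => hs.inner.g_pos.trans_le hx) fun _ hx =>
      sub_nonpos.2 (hs.closedDeriv_le_openDeriv H hζδ hx)

lemma closedValue_sub_openValue_le (hE : 0 ≤ E) (hk : 0 < k₀ + k₁) (hx : 0 < x) :
    W₀ x - W₁ x ≤ k₀ * (1 / μ + 1 / n) := by
  rw [← hs.closedValue_sub_openValue_of_mem_Icc H hζδ (left_mem_Icc.2 hs.g_lt.le)]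
  rcases le_total x p.γ with hxγ | hγx
  · exact hs.monotoneOn_closedValue_sub_openValue H hζδ hE hk ⟨hx, hxγ⟩
      (right_mem_Ioc.2 hs.inner.g_pos) hxγ
  · exact hs.antitoneOn_closedValue_sub_openValue H hζδ self_mem_Ici hγx hγx

lemma le_closedValue_sub_openValue (hE : 0 ≤ E) (hk₀ : 0 < k₀) (hk₁ : 0 < k₁) (hx : 0 < x) :
    -k₁ * (1 / μ + 1 / n) ≤ W₀ x - W₁ x := by
  rcases le_total x p.γ with hxγ | hγx
  · have hy : 0 < min x p.ζ := lt_min hx hs.z_pos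
    have sub_eq_zero : W₀ (min x p.ζ) - W₁ (min x p.ζ) = 0 := by
      rw [closedValue, glue_of_le (min_le_right _ _), openValue,
        glue_of_le ((min_le_right _ _).trans hζδ.le), sub_self]
    have hκ : 0 < k₁ * (1 / μ + 1 / n) :=
      mul_pos hk₁ (add_pos (one_div_pos.2 H.mu_pos) (one_div_pos.2 H.n_pos))
    calc -k₁ * (1 / μ + 1 / n) ≤ W₀ (min x p.ζ) - W₁ (min x p.ζ) := by linarith
      _ ≤ W₀ x - W₁ x := hs.monotoneOn_closedValue_sub_openValue H hζδ hE (add_pos hk₀ hk₁)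
        ⟨hy, (min_le_left _ _).trans hxγ⟩ ⟨hx, hxγ⟩ (min_le_left _ _)
  · rw [← hs.closedValue_sub_openValue_of_le H hζδ (le_max_right x p.α)]
    exact hs.antitoneOn_closedValue_sub_openValue H hζδ hγx (hγx.trans (le_max_left _ _))
      (le_max_left _ _)

lemma monotoneOn_openValue (hE : 0 ≤ E) (hQδ : Q (-E) p.δ ≤ 0) : MonotoneOn W₁ (Ioi 0) :=
  (hs.hasC1Deriv_openValue H).monotoneOn (convex_Ioi 0) (fun _ hx => hx) fun x _ =>
    hs.openDeriv_nonneg H hζδ hE hQδ x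

lemma monotoneOn_closedValue (hE : 0 ≤ E) : MonotoneOn W₀ (Ioi 0) :=
  (hs.hasC1Deriv_closedValue H (hs.zeta_lt_alpha hζδ)).monotoneOn (convex_Ioi 0)
    (fun _ hx => hx) fun x _ => hs.closedDeriv_nonneg H hζδ hE x

lemma le_openValue (hE : 0 ≤ E) (hQδ : Q (-E) p.δ ≤ 0) (hx : 0 < x) :
    E * (1 / μ + 1 / n) ≤ W₁ x := by
  have hy : 0 < min x p.δ := lt_min hx hs.inner.x_pos
  calc E * (1 / μ + 1 / n) = W₁ (min x p.δ) := by
        rw [openValue, glue_of_le (min_le_right _ _), piece_zero H.mu_pos.ne' H.n_pos.ne' E hy]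
    _ ≤ W₁ x := hs.monotoneOn_openValue H hζδ hE hQδ hy hx (min_le_left _ _)

lemma le_closedValue (hE : 0 ≤ E) (hx : 0 < x) : E * (1 / μ + 1 / n) ≤ W₀ x := by
  have hy : 0 < min x p.ζ := lt_min hx hs.z_pos
  calc E * (1 / μ + 1 / n) = W₀ (min x p.ζ) := by
        rw [closedValue, glue_of_le (min_le_right _ _), piece_zero H.mu_pos.ne' H.n_pos.ne' E hy]
    _ ≤ W₀ x := hs.monotoneOn_closedValue H hζδ hE hy hx (min_le_left _ _)

end SolvesSystem

/-- The function `f`, with derivative `f'`, is twice differentiable at `x` and solves there the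
Euler equation with roots `-μ`, `n` and right-hand side `-(n + μ) * (ε * h + c)`. -/
def SolvesEulerAt (μ n : ℝ) (h : ℝ → ℝ) (ε c : ℝ) (f f' : ℝ → ℝ) (x : ℝ) : Prop :=
  ∃ D, HasDerivAt f' D x ∧
    x ^ 2 * D + (1 + μ - n) * x * f' x - μ * n * f x = -((n + μ) * (ε * h x + c))

namespace SolvesEulerAt

variable {μ n : ℝ} {h : ℝ → ℝ} {ε c a x : ℝ} {f f' g g' : ℝ → ℝ}

lemma glue_left (hf : SolvesEulerAt μ n h ε c f f' x) (hx : x < a) :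
    SolvesEulerAt μ n h ε c (glue a f g) (glue a f' g') x := by
  obtain ⟨D, hD, heq⟩ := hf
  exact ⟨D, hD.congr_of_eventuallyEq (glue_eventuallyEq_left hx), by
    rwa [glue_of_le hx.le, glue_of_le hx.le]⟩

lemma glue_right (hg : SolvesEulerAt μ n h ε c g g' x) (hx : a < x) :
    SolvesEulerAt μ n h ε c (glue a f g) (glue a f' g') x := by
  obtain ⟨D, hD, heq⟩ := hg
  exact ⟨D, hD.congr_of_eventuallyEq (glue_eventuallyEq_right hx), by
    rwa [glue_of_lt hx, glue_of_lt hx]⟩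

lemma exists_variational {u v w : ℝ} (hf : SolvesEulerAt μ n h ε c f f' x) (hnμ : 0 < n + μ)
    (hu : u ≤ ε * h x + c) (hv : v ≤ 0) (hw : w ≤ 0)
    (heq : u = ε * h x + c ∨ v = 0 ∨ w = 0) :
    ∃ D, HasDerivAt f' D x ∧
      max (x ^ 2 * D + (1 + μ - n) * x * f' x - μ * n * f x + (n + μ) * u) (max v w) = 0 := by
  obtain ⟨D, hD, euler⟩ := hf
  refine ⟨D, hD, ?_⟩
  have hle := mul_le_mul_of_nonneg_left hu hnμ.le
  refine le_antisymm (max_le (by linarith) (max_le hv hw)) ?_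
  rcases heq with rfl | rfl | rfl
  · exact le_max_of_le_left (by linarith)
  · exact le_max_of_le_right (le_max_left _ _)
  · exact le_max_of_le_right (le_max_right _ _)

end SolvesEulerAt

namespace SolvesSystem

variable {μ n : ℝ} {h : ℝ → ℝ} {E k₀ k₁ : ℝ} {p : FreeBoundary} {x : ℝ}

local notation "Q" => highMoment n h
local notation "W₁" => openValue μ n h E k₀ p
local notation "DW₁" => openDeriv μ n h E k₀ p
local notation "W₀" => closedValue μ n h E k₀ k₁ p
local notation "DW₀" => closedDeriv μ n h E k₀ p

variable (hs : SolvesSystem μ n h E k₀ k₁ p.ζ p.δ p.γ p.β p.α) (H : Payoff μ n h)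
  (hE : 0 ≤ E) (hk₀ : 0 < k₀) (hk₁ : 0 < k₁) (hζδ : p.ζ < p.δ) (hx : 0 < x)
  (hc : ContinuousAt h x)
include hs H hE hk₀ hk₁ hζδ hx hc

lemma exists_variational_openValue (hQδ : highMoment n h (-E) p.δ ≤ 0) (hxδ : x ≠ p.δ)
    (hxγ : x ≠ p.γ) (hxβ : x ≠ p.β) :
    ∃ D, HasDerivAt DW₁ D x ∧
      max (x ^ 2 * D + (1 + μ - n) * x * DW₁ x - μ * n * W₁ x + (n + μ) * h x)
        (max (W₀ x - W₁ x - k₀ * (1 / μ + 1 / n)) (E * (1 / μ + 1 / n) - W₁ x)) = 0 := by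
  have hk := add_pos hk₀ hk₁
  have switch_le := sub_nonpos.2 (hs.closedValue_sub_openValue_le H hζδ hE hk hx)
  have abandon_le := sub_nonpos.2 (hs.le_openValue H hζδ hE hQδ hx)
  have euler : ∀ ε a b c, SolvesEulerAt μ n h ε c (piece μ n h ε a b c)
      (pieceDeriv μ n h ε a b) x := fun ε a b c => H.exists_hasDerivAt_pieceDeriv ε a b c hx hc
  rcases lt_or_gt_of_ne hxδ with hxδ | hδx
  · have hhδ : h p.δ < E := lt_of_not_ge fun hle =>
      hQδ.not_gt (H.highMoment_pos_of_le hs.inner.x_pos hle)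
    have value_eq : W₁ x = E * (1 / μ + 1 / n) := by
      rw [openValue, glue_of_le hxδ.le, piece_zero H.mu_pos.ne' H.n_pos.ne' E hx]
    exact ((euler _ _ _ _).glue_left hxδ).exists_variational H.add_pos
      (by linarith [H.apply_le hx hxδ.le]) switch_le abandon_le (by simp [value_eq])
  rcases lt_or_gt_of_ne hxγ with hxγ | hγx
  · exact (((euler _ _ _ _).glue_left hxγ).glue_right hδx).exists_variational H.add_pos
      (by linarith) switch_le abandon_le (Or.inl (by ring))
  rcases lt_or_gt_of_ne hxβ with hxβ | hβx
  · have hhβ := hs.switch.apply_b_lt H hk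
    have value_eq := hs.closedValue_sub_openValue_of_mem_Icc H hζδ ⟨hγx.le, hxβ.le⟩
    exact ((((euler _ _ _ _).glue_left hxβ).glue_right hγx).glue_right hδx).exists_variational
      H.add_pos (by linarith [H.apply_le hx hxβ.le]) switch_le abandon_le (by simp [value_eq])
  · exact ((((euler _ _ _ _).glue_right hβx).glue_right hγx).glue_right hδx).exists_variational
      H.add_pos (by linarith) switch_le abandon_le (Or.inl (by ring))

lemma exists_variational_closedValue (hxζ : x ≠ p.ζ) (hxα : x ≠ p.α) :
    ∃ D, HasDerivAt DW₀ D x ∧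
      max (x ^ 2 * D + (1 + μ - n) * x * DW₀ x - μ * n * W₀ x)
        (max (W₁ x - W₀ x - k₁ * (1 / μ + 1 / n)) (E * (1 / μ + 1 / n) - W₀ x)) = 0 := by
  suffices ∃ D, HasDerivAt DW₀ D x ∧
      max (x ^ 2 * D + (1 + μ - n) * x * DW₀ x - μ * n * W₀ x + (n + μ) * 0)
        (max (W₁ x - W₀ x - k₁ * (1 / μ + 1 / n)) (E * (1 / μ + 1 / n) - W₀ x)) = 0 by
    simpa only [mul_zero, add_zero] using this
  have switch_le : W₁ x - W₀ x - k₁ * (1 / μ + 1 / n) ≤ 0 := by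
    linarith [hs.le_closedValue_sub_openValue H hζδ hE hk₀ hk₁ hx]
  have abandon_le := sub_nonpos.2 (hs.le_closedValue H hζδ hE hx)
  have euler : ∀ ε a b c, SolvesEulerAt μ n h ε c (piece μ n h ε a b c)
      (pieceDeriv μ n h ε a b) x := fun ε a b c => H.exists_hasDerivAt_pieceDeriv ε a b c hx hc
  rcases lt_or_gt_of_ne hxζ with hxζ | hζx
  · have value_eq : W₀ x = E * (1 / μ + 1 / n) := by
      rw [closedValue, glue_of_le hxζ.le, piece_zero H.mu_pos.ne' H.n_pos.ne' E hx]
    exact ((euler _ _ _ _).glue_left hxζ).exists_variational H.add_pos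
      (by linarith) switch_le abandon_le (by simp [value_eq])
  rcases lt_or_gt_of_ne hxα with hxα | hαx
  · exact (((euler _ _ _ _).glue_left hxα).glue_right hζx).exists_variational H.add_pos
      (by linarith) switch_le abandon_le (Or.inl (by ring))
  · obtain ⟨t, htα, lt_h⟩ := hs.switch.exists_lt_apply H (add_pos hk₀ hk₁)
    have value_eq := hs.closedValue_sub_openValue_of_le H hζδ hαx.le
    exact (((euler _ _ _ _).glue_right hαx).glue_right hζx).exists_variational H.add_pos
      (by linarith [lt_h x (htα.trans hαx)]) switch_le abandon_le
      (Or.inr (Or.inl (by linarith)))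

end SolvesSystem

lemma exists_measurable_version {Ω : Type*} [MeasurableSpace Ω] {P : Measure Ω} {W : ℝ≥0 → Ω → ℝ}
    (hm : ∀ t, AEMeasurable (W t) P) (hc : ∀ᵐ ω ∂P, Continuous (W · ω)) :
    ∃ Y : ℝ≥0 × Ω → ℝ, Measurable Y ∧ ∀ᵐ ω ∂P, ∀ t, Y (t, ω) = W t ω := by
  obtain ⟨D, hD, hDdense⟩ := TopologicalSpace.exists_countable_dense ℝ≥0
  have hae : ∀ᵐ ω ∂P, Continuous (W · ω) ∧ ∀ d ∈ D, W d ω = (hm d).mk _ ω :=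
    hc.and ((ae_ball_iff hD).2 fun d _ => (hm d).ae_eq_mk)
  obtain ⟨G, hG, hGm, hGW⟩ := hae.exists_measurable_mem
  have hcont : ∀ ω, Continuous fun t => G.indicator (W t) ω := fun ω => by
    by_cases hω : ω ∈ G
    · simpa only [indicator_of_mem hω] using (hGW ω hω).1
    · simpa only [indicator_of_notMem hω] using continuous_const
  have hmeas_dense : ∀ d ∈ D, Measurable (G.indicator (W d)) := fun d hd => by
    rw [indicator_congr fun ω hω => (hGW ω hω).2 d hd]
    exact (hm d).measurable_mk.indicator hGm
  have hmeas : ∀ t, Measurable (G.indicator (W t)) := fun t => by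
    obtain ⟨d, hdD, hdt⟩ := mem_closure_iff_seq_limit.1 (hDdense t)
    exact measurable_of_tendsto_metrizable (fun k => hmeas_dense (d k) (hdD k))
      (tendsto_pi_nhds.2 fun ω => ((hcont ω).tendsto t).comp hdt)
  refine ⟨_, measurable_uncurry_of_continuous_of_measurable hcont hmeas, ?_⟩
  filter_upwards [hG] with ω hω t
  exact indicator_of_mem hω _

/-- The discounted density at `z` of the Gaussian variable `ν t + √2 σ W_t`.  Its integral over `t`
is the resolvent density of the Brownian motion with drift. -/
noncomputable def resolventIntegrand (ν σ r t z : ℝ) : ℝ :=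
  Real.exp (-r * t) * ((Real.sqrt (2 * Real.pi * (2 * σ ^ 2 * t)))⁻¹ *
    Real.exp (-(z - ν * t) ^ 2 / (2 * (2 * σ ^ 2 * t))))

lemma measurable_resolventIntegrand (ν σ r : ℝ) :
    Measurable fun x : ℝ × ℝ => resolventIntegrand ν σ r x.1 x.2 := by
  unfold resolventIntegrand
  fun_prop

lemma lintegral_discounted_brownian_at {Ω : Type*} [MeasurableSpace Ω] {P : Measure Ω}
    {W : ℝ≥0 → Ω → ℝ} (hW : IsBrownianReal W P) {ν σ r t : ℝ} (hσ : σ ≠ 0) (ht : 0 < t)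
    {φ : ℝ → ℝ≥0∞} (hφ : Measurable φ) :
    ∫⁻ ω, ENNReal.ofReal (Real.exp (-r * t)) * φ (ν * t + Real.sqrt 2 * σ * W t.toNNReal ω) ∂P =
      ∫⁻ z, ENNReal.ofReal (resolventIntegrand ν σ r t z) * φ z := by
  have hlaw := gaussianReal_const_add (gaussianReal_const_mul (hW.hasLaw_eval t.toNNReal)
    (Real.sqrt 2 * σ)) (ν * t)
  have hdensity : ∀ v : ℝ≥0, (v : ℝ) = 2 * σ ^ 2 * t →
      ∫⁻ z, ENNReal.ofReal (Real.exp (-r * t)) * φ z ∂gaussianReal (Real.sqrt 2 * σ * 0 + ν * t) v =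
      ∫⁻ z, ENNReal.ofReal (resolventIntegrand ν σ r t z) * φ z := by
    intro v hv
    have hv0 : v ≠ 0 := by
      rw [← NNReal.coe_ne_zero, hv]
      positivity
    rw [gaussianReal_of_var_ne_zero _ hv0,
      lintegral_withDensity_eq_lintegral_mul _ (measurable_gaussianPDF _ _) (hφ.const_mul _)]
    refine lintegral_congr fun z => ?_
    simp only [Pi.mul_apply, gaussianPDF, gaussianPDFReal, resolventIntegrand, hv]
    rw [ENNReal.ofReal_mul (Real.exp_nonneg _), mul_zero, zero_add]
    ring
  rw [hlaw.lintegral_comp (f := fun z => ENNReal.ofReal (Real.exp (-r * t)) * φ z)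
    (hφ.const_mul _).aemeasurable]
  refine hdensity _ ?_
  simp only [NNReal.coe_mul, NNReal.coe_mk, Real.coe_toNNReal _ ht.le, mul_pow,
    Real.sq_sqrt zero_le_two]

lemma lintegral_discounted_brownian {Ω : Type*} [MeasurableSpace Ω] {P : Measure Ω}
    {W : ℝ≥0 → Ω → ℝ} (hW : IsBrownianReal W P) {ν σ r : ℝ} (hσ : σ ≠ 0)
    {φ : ℝ → ℝ≥0∞} (hφ : Measurable φ) :
    ∫⁻ ω, (∫⁻ t in Ioi (0 : ℝ), ENNReal.ofReal (Real.exp (-r * t)) *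
        φ (ν * t + Real.sqrt 2 * σ * W t.toNNReal ω)) ∂P =
      ∫⁻ z, (∫⁻ t in Ioi (0 : ℝ), ENNReal.ofReal (resolventIntegrand ν σ r t z)) * φ z := by
  have := (hW.hasLaw_eval 0).isProbabilityMeasure
  obtain ⟨Y, hY, hYW⟩ := exists_measurable_version (fun t => hW.aemeasurable t) hW.cont
  have hversion : ∫⁻ ω, (∫⁻ t in Ioi (0 : ℝ), ENNReal.ofReal (Real.exp (-r * t)) *
        φ (ν * t + Real.sqrt 2 * σ * W t.toNNReal ω)) ∂P =
      ∫⁻ ω, (∫⁻ t in Ioi (0 : ℝ), ENNReal.ofReal (Real.exp (-r * t)) *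
        φ (ν * t + Real.sqrt 2 * σ * Y (t.toNNReal, ω))) ∂P := by
    refine lintegral_congr_ae ?_
    filter_upwards [hYW] with ω hω
    simp only [hω]
  have hat : ∀ t ∈ Ioi (0 : ℝ), ∫⁻ ω, ENNReal.ofReal (Real.exp (-r * t)) *
        φ (ν * t + Real.sqrt 2 * σ * Y (t.toNNReal, ω)) ∂P =
      ∫⁻ z, ENNReal.ofReal (resolventIntegrand ν σ r t z) * φ z := by
    intro t ht
    rw [← lintegral_discounted_brownian_at hW hσ ht hφ]
    refine lintegral_congr_ae ?_
    filter_upwards [hYW] with ω hω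
    rw [hω]
  have hm := measurable_resolventIntegrand ν σ r
  rw [hversion, lintegral_lintegral_swap (Measurable.aemeasurable (by fun_prop)),
    setLIntegral_congr_fun measurableSet_Ioi hat,
    lintegral_lintegral_swap (Measurable.aemeasurable (by fun_prop))]
  refine lintegral_congr fun z => ?_
  rw [lintegral_mul_const]
  exact (hm.comp (measurable_id.prodMk measurable_const)).ennreal_ofReal

section ResolventLowerBound

variable {ν σ r θ t z : ℝ}

lemma resolventIntegrand_eq (hσ : σ ≠ 0) (ht : 0 < t) (hθ : θ ^ 2 = ν ^ 2 + 4 * σ ^ 2 * r) :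
    resolventIntegrand ν σ r t z = (Real.sqrt (2 * Real.pi * (2 * σ ^ 2 * t)))⁻¹ *
      (Real.exp (-((θ * t - |z|) ^ 2 / (4 * σ ^ 2 * t))) *
        Real.exp ((ν * z - |z| * θ) / (2 * σ ^ 2))) := by
  have hsquare : -r * t + -(z - ν * t) ^ 2 / (2 * (2 * σ ^ 2 * t)) =
      -((θ * t - |z|) ^ 2 / (4 * σ ^ 2 * t)) + (ν * z - |z| * θ) / (2 * σ ^ 2) := by
    field_simp
    linear_combination (4 * t ^ 2) * hθ + 4 * sq_abs z
  rw [← Real.exp_add, ← hsquare, Real.exp_add, resolventIntegrand]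
  ring

lemma le_resolventIntegrand (hσ : σ ≠ 0) (hθ0 : 0 < θ) (hθ : θ ^ 2 = ν ^ 2 + 4 * σ ^ 2 * r)
    (hz : 1 ≤ |z|) (ht : t ∈ Icc (|z| / θ) (|z| / θ + Real.sqrt |z|)) :
    (Real.sqrt (2 * Real.pi * (2 * σ ^ 2 * (1 / θ + 1))) * Real.sqrt |z|)⁻¹ *
        (Real.exp (-(θ ^ 3 / (4 * σ ^ 2))) * Real.exp ((ν * z - |z| * θ) / (2 * σ ^ 2))) ≤
      resolventIntegrand ν σ r t z := by
  have := Real.pi_pos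
  have hsq : Real.sqrt |z| ^ 2 = |z| := Real.sq_sqrt (abs_nonneg z)
  have hsqrt_one : 1 ≤ Real.sqrt |z| := Real.one_le_sqrt.2 hz
  have ht0 : 0 < t := lt_of_lt_of_le (by positivity) ht.1
  have hlow : |z| ≤ θ * t := (div_le_iff₀' hθ0).1 ht.1
  have hup : θ * t - |z| ≤ θ * Real.sqrt |z| := by
    have := mul_le_mul_of_nonneg_left (sub_le_iff_le_add'.2 ht.2) hθ0.le
    rwa [mul_sub, mul_div_cancel₀ _ hθ0.ne'] at this
  have hexponent : (θ * t - |z|) ^ 2 / (4 * σ ^ 2 * t) ≤ θ ^ 3 / (4 * σ ^ 2) := by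
    rw [div_le_div_iff₀ (by positivity) (by positivity)]
    calc (θ * t - |z|) ^ 2 * (4 * σ ^ 2) ≤ (θ * Real.sqrt |z|) ^ 2 * (4 * σ ^ 2) := by
          gcongr
      _ = θ ^ 2 * |z| * (4 * σ ^ 2) := by rw [mul_pow, hsq]
      _ ≤ θ ^ 2 * (θ * t) * (4 * σ ^ 2) := by gcongr
      _ = θ ^ 3 * (4 * σ ^ 2 * t) := by ring
  have htime : t ≤ (1 / θ + 1) * |z| := by
    have hsqrt_le : Real.sqrt |z| ≤ |z| := by nlinarith
    calc t ≤ |z| / θ + |z| := ht.2.trans (by gcongr)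
      _ = (1 / θ + 1) * |z| := by ring
  have hnormalization : Real.sqrt (2 * Real.pi * (2 * σ ^ 2 * t)) ≤
      Real.sqrt (2 * Real.pi * (2 * σ ^ 2 * (1 / θ + 1))) * Real.sqrt |z| := by
    rw [← Real.sqrt_mul (by positivity), mul_assoc (2 * Real.pi), mul_assoc (2 * σ ^ 2)]
    gcongr
  rw [resolventIntegrand_eq hσ ht0 hθ]
  gcongr

/-- Completing the square in the exponent shows that `t` near `|z| / √(ν² + 4 σ² r)` gives the main
contribution; on a window of length `√|z|` there the Gaussian factor stays bounded below. -/
lemma exists_le_lintegral_resolventIntegrand (hσ : σ ≠ 0) (hr : 0 < r) :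
    ∃ C : ℝ, 0 < C ∧ ∀ z : ℝ, 1 ≤ |z| →
      ENNReal.ofReal (C * Real.exp ((ν * z - |z| * Real.sqrt (ν ^ 2 + 4 * σ ^ 2 * r)) /
        (2 * σ ^ 2))) ≤
      ∫⁻ t in Ioi (0 : ℝ), ENNReal.ofReal (resolventIntegrand ν σ r t z) := by
  set θ := Real.sqrt (ν ^ 2 + 4 * σ ^ 2 * r)
  have hθ : θ ^ 2 = ν ^ 2 + 4 * σ ^ 2 * r := Real.sq_sqrt (by positivity)
  have hθ0 : 0 < θ := Real.sqrt_pos.2 (by positivity)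
  have := Real.pi_pos
  set D := Real.sqrt (2 * Real.pi * (2 * σ ^ 2 * (1 / θ + 1)))
  have hD0 : 0 < D := Real.sqrt_pos.2 (by positivity)
  refine ⟨D⁻¹ * Real.exp (-(θ ^ 3 / (4 * σ ^ 2))), by positivity, fun z hz => ?_⟩
  have : 0 < Real.sqrt |z| := Real.sqrt_pos.2 (by linarith)
  have hwindow : Icc (|z| / θ) (|z| / θ + Real.sqrt |z|) ⊆ Ioi (0 : ℝ) := fun t ht =>
    lt_of_lt_of_le (div_pos (by linarith) hθ0) ht.1
  set c := (D * Real.sqrt |z|)⁻¹ *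
    (Real.exp (-(θ ^ 3 / (4 * σ ^ 2))) * Real.exp ((ν * z - |z| * θ) / (2 * σ ^ 2))) with hc
  calc ENNReal.ofReal (D⁻¹ * Real.exp (-(θ ^ 3 / (4 * σ ^ 2))) *
        Real.exp ((ν * z - |z| * θ) / (2 * σ ^ 2)))
      = ENNReal.ofReal (c * Real.sqrt |z|) := by
        rw [hc]
        congr 1
        field_simp
    _ = ∫⁻ _ in Icc (|z| / θ) (|z| / θ + Real.sqrt |z|), ENNReal.ofReal c := by
        rw [setLIntegral_const, Real.volume_Icc, add_sub_cancel_left,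
          ENNReal.ofReal_mul (by positivity)]
    _ ≤ ∫⁻ t in Icc (|z| / θ) (|z| / θ + Real.sqrt |z|),
          ENNReal.ofReal (resolventIntegrand ν σ r t z) :=
        setLIntegral_mono' measurableSet_Icc fun t ht =>
          ENNReal.ofReal_le_ofReal (le_resolventIntegrand hσ hθ0 hθ hz ht)
    _ ≤ ∫⁻ t in Ioi (0 : ℝ), ENNReal.ofReal (resolventIntegrand ν σ r t z) :=
        lintegral_mono_set hwindow

end ResolventLowerBound

lemma integrableOn_rpow_mul_of_monotoneOn {h : ℝ → ℝ} (hh : MonotoneOn h (Ioi 0)) (e : ℝ) {a b : ℝ}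
    (ha : 0 < a) : IntegrableOn (fun s => s ^ e * h s) (Icc a b) := by
  have hpos : ∀ x ∈ Icc a b, 0 < x := fun x hx => ha.trans_le hx.1
  exact ((hh.mono hpos).integrableOn_isCompact isCompact_Icc).continuousOn_mul
    (fun x hx => (Real.continuousAt_rpow_const x _ (Or.inl (hpos x hx).ne')).continuousWithinAt)
    isCompact_Icc

lemma integrableOn_rpow_mul_of_lintegral_comp_exp {h : ℝ → ℝ}
    (hh : Measurable fun z => h (Real.exp z)) {e C : ℝ} (hC : 0 < C) {S : Set ℝ}
    (hS : MeasurableSet S) {k : ℝ → ℝ≥0∞}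
    (hk : ∀ z ∈ S, ENNReal.ofReal (C * Real.exp (e * z)) ≤ k z)
    (hfin : ∫⁻ z, k z * ENNReal.ofReal |h (Real.exp z)| < ∞) :
    IntegrableOn (fun s => s ^ (e - 1) * h s) (Real.exp '' S) := by
  rw [integrableOn_image_iff_integrableOn_abs_deriv_smul hS
    (fun x _ => (Real.hasDerivAt_exp x).hasDerivWithinAt) Real.exp_injective.injOn]
  have hsubst : ∀ z : ℝ, |Real.exp z| • (Real.exp z ^ (e - 1) * h (Real.exp z)) =
      C⁻¹ * ((C * Real.exp (e * z)) * h (Real.exp z)) := by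
    intro z
    rw [abs_of_pos (Real.exp_pos z), smul_eq_mul, ← mul_assoc, ← Real.exp_mul, ← Real.exp_add,
      show z + z * (e - 1) = e * z by ring]
    field_simp
  simp only [hsubst]
  refine Integrable.const_mul ⟨(Measurable.mul (by fun_prop) hh).aestronglyMeasurable, ?_⟩ _
  refine lt_of_le_of_lt ?_ hfin
  refine le_trans (setLIntegral_mono' hS fun z hz => ?_) (setLIntegral_le_lintegral S _)
  rw [Pi.mul_apply, enorm_mul, Real.enorm_eq_ofReal (by positivity), Real.enorm_eq_ofReal_abs]
  gcongr
  exact hk z hz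

namespace SwitchingModel

variable {M : SwitchingModel}

section Exponents

variable (hσ : M.σ ≠ 0) (hr : 0 < M.r)
include hσ hr

lemma abs_lt_sqrt_discriminant :
    |M.σ ^ 2 - M.b| < Real.sqrt ((M.b - M.σ ^ 2) ^ 2 + 4 * M.σ ^ 2 * M.r) := by
  rw [← Real.sqrt_sq_eq_abs]
  refine Real.sqrt_lt_sqrt (by positivity) ?_
  have : 0 < M.σ ^ 2 * M.r := by positivity
  linarith

lemma m_neg : M.m < 0 := by
  have := abs_lt.1 (abs_lt_sqrt_discriminant hσ hr)
  exact div_neg_of_neg_of_pos (by linarith) (by positivity)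

lemma n_pos : 0 < M.n := by
  have := abs_lt.1 (abs_lt_sqrt_discriminant hσ hr)
  exact div_pos (by linarith) (by positivity)

lemma r_eq : M.r = M.σ ^ 2 * (-M.m * M.n) := by
  have hsq : Real.sqrt ((M.b - M.σ ^ 2) ^ 2 + 4 * M.σ ^ 2 * M.r) ^ 2 =
    (M.b - M.σ ^ 2) ^ 2 + 4 * M.σ ^ 2 * M.r := Real.sq_sqrt (by positivity)
  unfold m n
  set θ := Real.sqrt ((M.b - M.σ ^ 2) ^ 2 + 4 * M.σ ^ 2 * M.r)
  field_simp
  linear_combination -hsq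

omit hr in
lemma b_eq : M.b = M.σ ^ 2 * (1 + -M.m - M.n) := by
  unfold m n
  field_simp
  ring

end Exponents

section Moments

variable {Ω : Type*} [MeasurableSpace Ω] {P : Measure Ω} {W : ℝ≥0 → Ω → ℝ}
  (hW : IsBrownianReal W P) (hM : M.Standing P W)
include hW hM

lemma integrableOn_rpow_mul_image_exp {e : ℝ} {S : Set ℝ} (hS : MeasurableSet S)
    (hS1 : ∀ z ∈ S, 1 ≤ |z|)
    (he : ∀ z ∈ S, ((M.b - M.σ ^ 2) * z -
      |z| * Real.sqrt ((M.b - M.σ ^ 2) ^ 2 + 4 * M.σ ^ 2 * M.r)) / (2 * M.σ ^ 2) = e * z) :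
    IntegrableOn (fun s => s ^ (e - 1) * M.h s) (Real.exp '' S) := by
  have hmeas : Measurable fun z => M.h (Real.exp z) :=
    Monotone.measurable fun x y hxy =>
      hM.mono (Real.exp_pos x) (Real.exp_pos y) (Real.exp_le_exp.2 hxy)
  have hint := hM.integrable 1 one_pos
  simp only [X, one_mul, ENNReal.ofReal_mul (Real.exp_nonneg _)] at hint
  rw [lintegral_discounted_brownian hW hM.sigma_ne (ν := M.b - M.σ ^ 2) (r := M.r)
    (φ := fun z => ENNReal.ofReal |M.h (Real.exp z)|)
    (measurable_norm.comp hmeas).ennreal_ofReal] at hint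
  obtain ⟨C, hC, hk⟩ := exists_le_lintegral_resolventIntegrand (ν := M.b - M.σ ^ 2)
    hM.sigma_ne hM.r_pos
  refine integrableOn_rpow_mul_of_lintegral_comp_exp hmeas hC hS (fun z hz => ?_) hint
  rw [← he z hz]
  exact hk z (hS1 z hz)

lemma integrableOn_low_exp : IntegrableOn (fun s => s ^ (-M.m - 1) * M.h s)
    (Real.exp '' Iio (-1)) := by
  refine integrableOn_rpow_mul_image_exp hW hM measurableSet_Iio
    (fun z (hz : z < -1) => by rw [abs_of_neg (by linarith)]; linarith) fun z (hz : z < -1) => ?_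
  rw [abs_of_neg (by linarith), m]
  field_simp
  ring

lemma integrableOn_high_exp : IntegrableOn (fun s => s ^ (-M.n - 1) * M.h s)
    (Real.exp '' Ioi 1) := by
  refine integrableOn_rpow_mul_image_exp hW hM measurableSet_Ioi
    (fun z (hz : 1 < z) => by rw [abs_of_pos (by linarith)]; exact hz.le) fun z (hz : 1 < z) => ?_
  rw [abs_of_pos (by linarith), n]
  field_simp
  ring

/-- Up to a factor, `s ^ (-m - 1)` near `0` and `s ^ (-n - 1)` near `∞` are lower bounds of the
resolvent density of `X`, so that the standing integrability assumption yields both moments. -/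
lemma payoff : Payoff (-M.m) M.n M.h where
  mu_pos := neg_pos.2 (m_neg hM.sigma_ne hM.r_pos)
  n_pos := n_pos hM.sigma_ne hM.r_pos
  right_cont := hM.right_cont
  mono := hM.mono
  tendsto_top := hM.tendsto_top
  integrableOn_low x _ := by
    refine ((integrableOn_low_exp hW hM).union (integrableOn_rpow_mul_of_monotoneOn hM.mono _
      (b := x) (Real.exp_pos (-1)))).mono_set fun s hs => ?_
    rcases lt_or_ge s (Real.exp (-1)) with h | h
    · exact Or.inl ⟨Real.log s, (Real.log_lt_iff_lt_exp hs.1).2 h, Real.exp_log hs.1⟩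
    · exact Or.inr ⟨h, hs.2⟩
  integrableOn_high x hx := by
    refine ((integrableOn_high_exp hW hM).union (integrableOn_rpow_mul_of_monotoneOn hM.mono _
      (b := Real.exp 1) hx)).mono_set fun s hs => ?_
    have hs0 : 0 < s := hx.trans hs
    rcases lt_or_ge (Real.exp 1) s with h | h
    · exact Or.inl ⟨Real.log s, (Real.lt_log_iff_exp_lt hs0).2 h, Real.exp_log hs0⟩
    · exact Or.inr ⟨le_of_lt hs, h⟩

end Moments

end SwitchingModel

namespace SwitchingModel

/-- The running payoff `-r K`, whose total discounted value is the abandonment payoff `-K`. -/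
noncomputable def exitFlow (M : SwitchingModel) : ℝ := -(M.r * M.K)

section CriticalValues

variable {M : SwitchingModel} {K₀ K₁ d k k' k₀ y y' ζ α x a b : ℝ} {p : FreeBoundary}

local notation "P" => lowMoment (-M.m) M.h
local notation "Q" => highMoment M.n M.h
local notation "G" => lineGap (-M.m) M.n M.h (lowMoment (-M.m) M.h (-(M.r * K₁)) α)
  (highMoment M.n M.h (-(M.r * K₁)) α)

lemma exitFlow_pos_iff (hr : 0 < M.r) : 0 < M.exitFlow ↔ M.K < 0 := by
  rw [exitFlow, ← mul_neg, mul_pos_iff_of_pos_left hr, neg_pos]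

lemma lt_hZero_iff (hm : MonotoneOn M.h (Ioi 0)) {e : ℝ} :
    M.hZero < (e : EReal) ↔ ∃ x, 0 < x ∧ M.h x < e := by
  have htends := M.tendsto_hZero hm
  constructor
  · intro hlt
    obtain ⟨x, hxe, hx⟩ := ((htends.eventually (gt_mem_nhds hlt)).and self_mem_nhdsWithin).exists
    exact ⟨x, hx, EReal.coe_lt_coe_iff.1 hxe⟩
  · rintro ⟨x, hx, hxe⟩
    refine (le_of_tendsto htends ?_).trans_lt (EReal.coe_lt_coe_iff.2 hxe)
    filter_upwards [Ioo_mem_nhdsGT hx] with y hy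
    exact EReal.coe_le_coe_iff.2 (hm hy.1 hx hy.2.le)

lemma IsSignChange.unique (hy : M.IsSignChange d K₁ α y) (hy' : M.IsSignChange d K₁ α y') :
    y = y' := by
  have not_lt_of_isSignChange : ∀ {y y'}, M.IsSignChange d K₁ α y → M.IsSignChange d K₁ α y' →
      ¬ y < y' := by
    rintro y y' ⟨hdy, -, -, right⟩ ⟨-, hyα', left', -⟩ hyy'
    obtain ⟨x, hyx, hxy'⟩ := exists_between hyy'
    exact lt_asymm (left' x (hdy.trans hyx).le hxy') (right x hyx (hxy'.trans hyα'))
  exact le_antisymm (not_lt.1 (not_lt_of_isSignChange hy' hy))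
    (not_lt.1 (not_lt_of_isSignChange hy hy'))

lemma IsK₁Dagger.unique (hpair : ∀ K₁, 0 < K₁ → ∃ ζ α, M.IsNoSwitchOutPair d K₁ ζ α)
    (hk : M.IsK₁Dagger d k) (hk' : M.IsK₁Dagger d k') : k = k' := by
  have not_lt_of_isK₁Dagger : ∀ {k k'}, M.IsK₁Dagger d k → M.IsK₁Dagger d k' → ¬ k < k' := by
    rintro k k' ⟨hk0, hk⟩ ⟨-, hk'⟩ hkk'
    obtain ⟨K₁, hkK, hKk'⟩ := exists_between hkk'
    obtain ⟨ζ, α, hp⟩ := hpair K₁ (hk0.trans hkK)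
    exact lt_asymm ((hk K₁ (hk0.trans hkK) ζ α hp).2 hkK) ((hk' K₁ (hk0.trans hkK) ζ α hp).1 hKk')
  exact le_antisymm (not_lt.1 (not_lt_of_isK₁Dagger hk' hk))
    (not_lt.1 (not_lt_of_isK₁Dagger hk hk'))

variable (H : Payoff (-M.m) M.n M.h)
include H

lemma m_mul_integral (c : ℝ) (ha : 0 ≤ a) (hb : 0 ≤ b) :
    M.m * ∫ s in a..b, s ^ (-M.m - 1) * (M.h s + c) = P c a - P c b := by
  have hsub := H.lowMoment_sub c ha hb
  simp only [mul_assoc, intervalIntegral.integral_const_mul] at hsub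
  linarith

lemma n_mul_integral (c : ℝ) (ha : 0 < a) (hb : 0 < b) :
    M.n * ∫ s in a..b, s ^ (-M.n - 1) * (M.h s + c) = Q c a - Q c b := by
  rw [H.highMoment_sub c ha hb]
  simp only [mul_assoc, intervalIntegral.integral_const_mul]

lemma n_mul_integral_Ioi (c : ℝ) (hx : 0 < x) :
    M.n * ∫ s in Ioi x, s ^ (-M.n - 1) * (M.h s + c) = Q c x := by
  rw [H.highMoment_eq_integral c hx]
  simp only [mul_assoc, integral_const_mul]

lemma isDeltaDagger_iff : M.IsDeltaDagger d ↔ 0 < d ∧ Q (-M.exitFlow) d = 0 := by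
  refine and_congr_right fun hd => ?_
  rw [exitFlow, neg_neg, ← n_mul_integral_Ioi H _ hd, mul_eq_zero, or_iff_right H.n_pos.ne']

lemma isNoSwitchOutPair_iff (hd : 0 < d) (hQd : Q (-M.exitFlow) d = 0) :
    M.IsNoSwitchOutPair d K₁ ζ α ↔
      IsEntryPair (-M.m) M.n M.h M.exitFlow (M.r * K₁) d ζ α := by
  have lowMoment_d := lowMoment_eq_add (μ := -M.m) (h := M.h) (-M.exitFlow) (-(M.r * K₁)) d
  have highMoment_d := highMoment_eq_add (n := M.n) (h := M.h) (-M.exitFlow) (-(M.r * K₁)) d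
  rw [exitFlow] at *
  constructor
  · rintro ⟨hζ, hζα, hdα, eq_low, eq_high⟩
    simp only [sub_eq_add_neg (M.h _)] at eq_low eq_high
    rw [m_mul_integral H _ hd.le (hd.trans hdα).le] at eq_low
    rw [neg_mul, n_mul_integral H _ hd (hd.trans hdα)] at eq_high
    exact ⟨hζ, hζα, hdα, by linarith, by linarith⟩
  · rintro ⟨hζ, hζα, hdα, eq_low, eq_high⟩
    refine ⟨hζ, hζα, hdα, ?_, ?_⟩ <;> simp only [sub_eq_add_neg (M.h _)]
    · rw [m_mul_integral H _ hd.le (hd.trans hdα).le]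
      linarith
    · rw [neg_mul, n_mul_integral H _ hd (hd.trans hdα)]
      linarith

lemma m_mul_integral_add_eq_zero_iff (ha : 0 ≤ a) (hb : 0 ≤ b) :
    M.m * (∫ s in a..b, s ^ (-M.m - 1) * M.h s) + k * a ^ (-M.m) + k' * b ^ (-M.m) = 0 ↔
      P k a = P (-k') b := by
  have hsub := m_mul_integral H 0 ha hb
  simp only [add_zero] at hsub
  rw [hsub, lowMoment_eq_add k 0 a, lowMoment_eq_add (-k') 0 b]
  constructor <;> intro heq <;> linarith

lemma n_mul_integral_add_eq_zero_iff (ha : 0 < a) (hb : 0 < b) :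
    M.n * (∫ s in a..b, s ^ (-M.n - 1) * M.h s) + k * a ^ (-M.n) + k' * b ^ (-M.n) = 0 ↔
      Q k a = Q (-k') b := by
  have hsub := n_mul_integral H 0 ha hb
  simp only [add_zero] at hsub
  rw [hsub, highMoment_eq_add k 0 a, highMoment_eq_add (-k') 0 b]
  constructor <;> intro heq <;> linarith

lemma isSolution_iff : M.IsSolution K₁ K₀ p ↔
    SolvesSystem (-M.m) M.n M.h M.exitFlow (M.r * K₀) (M.r * K₁) p.ζ p.δ p.γ p.β p.α := by
  have low_of_zero : ∀ c {x : ℝ}, 0 < x →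
      M.m * (∫ s in (0 : ℝ)..x, s ^ (-M.m - 1) * (M.h s + c)) = -P c x := fun c x hx => by
    rw [m_mul_integral H c le_rfl hx.le, H.lowMoment_zero, zero_sub]
  constructor
  · rintro ⟨hζ, hδ, hδγ, hγβ, hβα, eq1, eq2, eq3, eq4, eq5⟩
    have hγ := hδ.trans hδγ
    have hβ := hγ.trans hγβ
    have hα := hβ.trans hβα
    rw [n_mul_integral_Ioi H _ hδ, n_mul_integral H _ hγ hβ] at eq3
    rw [n_mul_integral_Ioi H _ hβ] at eq4
    rw [low_of_zero _ hγ, low_of_zero _ hδ] at eq5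
    exact ⟨hζ, ⟨hδ, hδγ, by rw [exitFlow, neg_neg]; linarith, by rw [exitFlow, neg_neg]; linarith⟩,
      hγβ, ⟨hβ, hβα, (m_mul_integral_add_eq_zero_iff H hβ.le hα.le).1 eq1,
        (n_mul_integral_add_eq_zero_iff H hβ hα).1 eq2⟩, by rw [exitFlow]; linarith⟩
  · rintro ⟨hζ, ⟨hδ, hδγ, inner_low, inner_high⟩, hγβ, ⟨hβ, hβα, switch_low, switch_high⟩, eq_β⟩
    have hγ := hδ.trans hδγ
    have hα := hβ.trans hβα
    rw [exitFlow, neg_neg] at inner_low inner_high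
    rw [exitFlow] at eq_β
    refine ⟨hζ, hδ, hδγ, hγβ, hβα, (m_mul_integral_add_eq_zero_iff H hβ.le hα.le).2 switch_low,
      (n_mul_integral_add_eq_zero_iff H hβ hα).2 switch_high, ?_, ?_, ?_⟩
    · rw [n_mul_integral_Ioi H _ hδ, n_mul_integral H _ hγ hβ]
      linarith
    · rw [n_mul_integral_Ioi H _ hβ]
      linarith
    · rw [low_of_zero _ hγ, low_of_zero _ hδ]
      linarith

lemma gapDeriv_eq (hx : 0 < x) (hα : 0 < α) :
    M.gapDeriv K₁ α x = -(x ^ (M.m - 1) / (M.σ ^ 2 * (M.n - M.m)) * G x) := by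
  have : x ^ (M.n - 1) = x ^ (M.m - 1) * x ^ (M.n + -M.m) := by
    rw [← Real.rpow_add hx]; ring_nf
  have low := m_mul_integral H (-(M.r * K₁)) hx.le hα.le
  have high := n_mul_integral H (-(M.r * K₁)) hx hα
  rw [lineGap_eq (-(M.r * K₁)) _ _ hx, gapDeriv, this]
  simp only [sub_eq_add_neg (M.h _)]
  linear_combination x ^ (M.m - 1) / (M.σ ^ 2 * (M.n - M.m)) * (low - x ^ (M.n + -M.m) * high)

lemma gapDeriv_pos_iff (hσ : M.σ ≠ 0) (hx : 0 < x) (hα : 0 < α) :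
    0 < M.gapDeriv K₁ α x ↔ G x < 0 := by
  have hscale : 0 < x ^ (M.m - 1) / (M.σ ^ 2 * (M.n - M.m)) :=
    div_pos (Real.rpow_pos_of_pos hx _)
      (mul_pos (by positivity) (by linarith [H.mu_pos, H.n_pos]))
  rw [gapDeriv_eq H hx hα, ← mul_neg, mul_pos_iff_of_pos_left hscale, neg_pos]

lemma gapDeriv_neg_iff (hσ : M.σ ≠ 0) (hx : 0 < x) (hα : 0 < α) :
    M.gapDeriv K₁ α x < 0 ↔ 0 < G x := by
  have hscale : 0 < x ^ (M.m - 1) / (M.σ ^ 2 * (M.n - M.m)) :=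
    div_pos (Real.rpow_pos_of_pos hx _)
      (mul_pos (by positivity) (by linarith [H.mu_pos, H.n_pos]))
  rw [gapDeriv_eq H hx hα, neg_lt_zero, mul_pos_iff_of_pos_left hscale]

lemma eq_sub_mul_integral_iff (hr : 0 < M.r) (hy : 0 < y) (hα : 0 < α) :
    k = -K₁ - M.n * y ^ M.n / M.r * ∫ s in y..α, s ^ (-M.n - 1) * (M.h s - M.r * K₁) ↔
      Q (M.r * k) y = Q (-(M.r * K₁)) α := by
  have : 0 < y ^ M.n := Real.rpow_pos_of_pos hy _
  have high := n_mul_integral H (-(M.r * K₁)) hy hα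
  rw [highMoment_eq_add (M.r * k) (-(M.r * K₁)) y, Real.rpow_neg hy.le]
  simp only [sub_eq_add_neg (M.h _)]
  rw [mul_comm M.n, mul_div_right_comm, mul_assoc, high]
  field_simp
  constructor <;> intro heq <;> linarith

lemma isK₀Dagger_iff (hr : 0 < M.r) (hE : 0 < M.exitFlow) (hK₁ : 0 < K₁) (hd : M.IsDeltaDagger d)
    (hp : M.IsNoSwitchOutPair d K₁ ζ α) (hy : M.IsSignChange d K₁ α y)
    (hQy : Q k₀ y = Q (-(M.r * K₁)) α) : M.IsK₀Dagger d K₁ k ↔ M.r * k = k₀ := by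
  have hy0 : 0 < y := hd.1.trans hy.1
  have hα : 0 < α := hy0.trans hy.2.1
  have value_iff : k = -K₁ - M.n * y ^ M.n / M.r *
      ∫ s in y..α, s ^ (-M.n - 1) * (M.h s - M.r * K₁) ↔ M.r * k = k₀ := by
    rw [eq_sub_mul_integral_iff H hr hy0 hα, ← hQy, highMoment_eq_add (M.r * k) k₀ y,
      add_eq_left, mul_eq_zero, or_iff_left (Real.rpow_pos_of_pos hy0 _).ne', sub_eq_zero]
  refine ⟨fun ⟨ζ', α', y', hp', hy', hk⟩ => ?_, fun hk => ⟨ζ, α, y, hp, hy, value_iff.2 hk⟩⟩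
  obtain ⟨hd, hQd⟩ := (isDeltaDagger_iff H).1 hd
  obtain ⟨rfl, rfl⟩ := ((isNoSwitchOutPair_iff H hd hQd).1 hp).unique H hE (mul_pos hr hK₁) hd hQd
    ((isNoSwitchOutPair_iff H hd hQd).1 hp')
  obtain rfl := hy.unique hy'
  exact value_iff.1 hk

lemma isK₁Dagger_of_isEntryPair_self (hr : 0 < M.r) (hE : 0 < M.exitFlow) (hk : 0 < k) (hd : 0 < d)
    (hQd : Q (-M.exitFlow) d = 0) (hp : IsEntryPair (-M.m) M.n M.h M.exitFlow (M.r * k) d d a) :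
    M.IsK₁Dagger d k := by
  refine ⟨hk, fun K₁ hK₁ ζ α hpair => ⟨fun hlt => ?_, fun hlt => ?_⟩⟩ <;>
    have hp' := (isNoSwitchOutPair_iff H hd hQd).1 hpair
  · exact (hp'.lt_and_lt H hE (mul_pos hr hK₁) hd hQd hp (mul_lt_mul_of_pos_left hlt hr)).1
  · exact (hp.lt_and_lt H hE (mul_pos hr hk) hd hQd hp' (mul_lt_mul_of_pos_left hlt hr)).1

end CriticalValues

end SwitchingModel

namespace HasC1Deriv

variable {f f' g : ℝ → ℝ} {D x : ℝ}

lemma const_mul (hf : HasC1Deriv f f') (c : ℝ) :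
    HasC1Deriv (fun x => c * f x) (fun x => c * f' x) :=
  ⟨fun x hx => (hf.hasDerivAt x hx).const_mul c, continuousOn_const.mul hf.continuousOn⟩

lemma congr (hf : HasC1Deriv f f') (hgf : EqOn g f (Ioi 0)) : HasC1Deriv g f' :=
  ⟨fun x hx => (hf.hasDerivAt x hx).congr_of_eventuallyEq
    (hgf.eventuallyEq_of_mem (Ioi_mem_nhds hx)), hf.continuousOn⟩

lemma contDiffOn (hf : HasC1Deriv f f') : ContDiffOn ℝ 1 f (Ioi 0) := by
  rw [contDiffOn_one_iff_derivWithin (uniqueDiffOn_Ioi 0)]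
  refine ⟨fun x hx => (hf.hasDerivAt x hx).differentiableAt.differentiableWithinAt,
    hf.continuousOn.congr fun x hx => ?_⟩
  rw [derivWithin_of_isOpen isOpen_Ioi hx, (hf.hasDerivAt x hx).deriv]

lemma hasDerivAt_deriv (hf : HasC1Deriv f f') (hx : 0 < x) (hD : HasDerivAt f' D x) :
    HasDerivAt (deriv f) D x :=
  hD.congr_of_eventuallyEq <|
    EqOn.eventuallyEq_of_mem (fun y hy => (hf.hasDerivAt y hy).deriv) (Ioi_mem_nhds hx)

end HasC1Deriv

lemma max_mul_max_mul_eq_zero {s t a b c : ℝ} (hs : 0 ≤ s) (ht : 0 ≤ t)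
    (h : max a (max b c) = 0) : max (s * a) (max (t * b) (t * c)) = 0 := by
  have hle : a ≤ 0 ∧ b ≤ 0 ∧ c ≤ 0 := by simpa only [max_le_iff] using h.le
  refine le_antisymm (max_le (mul_nonpos_of_nonneg_of_nonpos hs hle.1) (max_le
    (mul_nonpos_of_nonneg_of_nonpos ht hle.2.1) (mul_nonpos_of_nonneg_of_nonpos ht hle.2.2))) ?_
  rcases le_max_iff.1 h.ge with ha | hbc
  · exact le_max_of_le_left (mul_nonneg hs ha)
  rcases le_max_iff.1 hbc with hb | hc
  · exact le_max_of_le_right (le_max_of_le_left (mul_nonneg ht hb))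
  · exact le_max_of_le_right (le_max_of_le_right (mul_nonneg ht hc))

namespace SwitchingModel

/-- The constant `c = 1 / (σ² (n - m))` of the model, by which `openValue` and `closedValue` have to
be multiplied to give `w₁` and `w₀`. -/
noncomputable def scale (M : SwitchingModel) : ℝ := 1 / (M.σ ^ 2 * (M.n - M.m))

section Verification

variable {M : SwitchingModel} {K₀ K₁ d x : ℝ} {p : FreeBoundary}

local notation "P" => lowMoment (-M.m) M.h
local notation "Q" => highMoment M.n M.h
local notation "W₁" => openValue (-M.m) M.n M.h M.exitFlow (M.r * K₀) p
local notation "DW₁" => openDeriv (-M.m) M.n M.h M.exitFlow (M.r * K₀) p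
local notation "W₀" => closedValue (-M.m) M.n M.h M.exitFlow (M.r * K₀) (M.r * K₁) p
local notation "DW₀" => closedDeriv (-M.m) M.n M.h M.exitFlow (M.r * K₀) p

lemma scale_pos (hσ : M.σ ≠ 0) (hr : 0 < M.r) : 0 < M.scale :=
  one_div_pos.2 (mul_pos (by positivity) (by linarith [m_neg hσ hr, n_pos hσ hr]))

lemma sq_mul_scale_mul (hσ : M.σ ≠ 0) (hr : 0 < M.r) :
    M.σ ^ 2 * M.scale * (M.n + -M.m) = 1 := by
  have : M.n - M.m ≠ 0 := by linarith [m_neg hσ hr, n_pos hσ hr]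
  rw [scale, ← sub_eq_add_neg]
  field_simp

lemma scale_mul_const (hσ : M.σ ≠ 0) (hr : 0 < M.r) (c : ℝ) :
    M.scale * (M.r * c * (1 / -M.m + 1 / M.n)) = c := by
  have hm := (m_neg hσ hr).ne
  have hn := (n_pos hσ hr).ne'
  have heq := sq_mul_scale_mul hσ hr
  rw [r_eq hσ hr]
  field_simp
  linear_combination c * heq

lemma scale_mul_piece (hσ : M.σ ≠ 0) (hr : 0 < M.r) (ε a b c : ℝ) (hx : 0 < x) :
    M.scale * piece (-M.m) M.n M.h ε a b c x = ε * M.R x + M.scale * a / -M.m * x ^ M.m +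
      M.scale * b / M.n * x ^ M.n + M.scale * (c * (1 / -M.m + 1 / M.n)) := by
  have hm := (m_neg hσ hr).ne
  have hn := (n_pos hσ hr).ne'
  rw [piece_const (neg_ne_zero.2 hm) hn ε a b c 0 hx, piece, R, ← scale]
  simp only [lowMoment, highMoment, neg_neg]
  field_simp
  ring

lemma Gamma₁_eq (H : Payoff (-M.m) M.n M.h) (hδ : 0 < p.δ) :
    M.Gamma₁ p = M.scale * -P (-M.exitFlow) p.δ / -M.m := by
  have hm := H.mu_pos.ne'
  have hP := m_mul_integral H (M.r * M.K) le_rfl hδ.le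
  rw [H.lowMoment_zero, zero_sub] at hP
  rw [Gamma₁, ← scale, exitFlow, neg_neg, eq_div_iff hm, ← hP]
  ring

lemma Gamma₂_eq (H : Payoff (-M.m) M.n M.h) (hδ : 0 < p.δ) :
    M.Gamma₂ p = M.scale * -Q (-M.exitFlow) p.δ / M.n := by
  rw [Gamma₂, ← scale, exitFlow, neg_neg, eq_div_iff H.n_pos.ne', ← n_mul_integral_Ioi H _ hδ]
  ring

lemma Delta₁_eq : M.Delta₁ p = M.scale * (M.exitFlow * p.ζ ^ (-M.m)) / -M.m := by
  rw [Delta₁, scale, exitFlow, div_neg, neg_mul, mul_neg, neg_div, neg_neg, one_div_mul_eq_div,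
    div_div, mul_right_comm (M.σ ^ 2)]

lemma Delta₂_eq : M.Delta₂ p = M.scale * (M.exitFlow * p.ζ ^ (-M.n)) / M.n := by
  rw [Delta₂, scale, exitFlow, neg_mul, mul_neg, neg_div, one_div_mul_eq_div, div_div,
    mul_right_comm (M.σ ^ 2)]

section solution

variable (H : Payoff (-M.m) M.n M.h)
  (hs : SolvesSystem (-M.m) M.n M.h M.exitFlow (M.r * K₀) (M.r * K₁) p.ζ p.δ p.γ p.β p.α)
include H hs

lemma A_eq :
    M.A K₁ p = M.scale * (M.exitFlow * p.ζ ^ (-M.m) - P (M.r * K₀) p.β) / -M.m := by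
  have hm := H.mu_pos.ne'
  have hP := m_mul_integral H (-(M.r * K₁)) le_rfl hs.switch.a_pos.le
  rw [H.lowMoment_zero, zero_sub, ← hs.switch.lowMoment_eq] at hP
  rw [A, ← scale, Delta₁_eq, eq_div_iff hm, sub_mul, div_mul_cancel₀ _ hm]
  simp only [sub_eq_add_neg (M.h _)]
  linear_combination M.scale * hP

lemma w₁_eq (hσ : M.σ ≠ 0) (hr : 0 < M.r) (hx : 0 < x) :
    M.w₁ K₁ K₀ p x = M.scale * W₁ x := by
  have cost_eq := scale_mul_const hσ hr K₀
  have exit_eq := scale_mul_const hσ hr M.K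
  have hx_piece := fun ε a b c => scale_mul_piece (M := M) hσ hr ε a b c hx
  rw [w₁, openValue]
  split_ifs with hxδ hxγ hxβ
  · rw [glue_of_le hxδ, hx_piece, exitFlow]
    simp only [mul_zero, zero_div, zero_mul]
    linarith
  · rw [glue_of_lt (not_le.1 hxδ), glue_of_le hxγ.le, hx_piece, Gamma₁_eq H hs.inner.x_pos,
      Gamma₂_eq H hs.inner.x_pos]
    ring
  · rw [glue_of_lt (not_le.1 hxδ),
      glue_of_ge (by rw [glue_of_le hs.g_lt.le, hs.match_gamma.1]) (not_lt.1 hxγ),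
      glue_of_le hxβ, hx_piece, Delta₁_eq, Delta₂_eq]
    linarith
  · have hβx := not_le.1 hxβ
    rw [glue_of_lt (not_le.1 hxδ), glue_of_lt (hs.g_lt.trans hβx), glue_of_lt hβx, hx_piece,
      A_eq H hs]
    ring

lemma w₀_eq (hσ : M.σ ≠ 0) (hr : 0 < M.r) (hx : 0 < x) :
    M.w₀ K₁ p x = M.scale * W₀ x := by
  have cost_eq := scale_mul_const hσ hr K₁
  have exit_eq := scale_mul_const hσ hr M.K
  have hx_piece := fun ε a b c => scale_mul_piece (M := M) hσ hr ε a b c hx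
  rw [w₀, closedValue]
  split_ifs with hxζ hxα
  · rw [glue_of_le hxζ, hx_piece, exitFlow]
    simp only [mul_zero, zero_div, zero_mul]
    linarith
  · rw [glue_of_lt (not_le.1 hxζ), glue_of_le hxα.le, hx_piece, Delta₁_eq, Delta₂_eq]
    ring
  · rw [glue_of_lt (not_le.1 hxζ), glue_of_ge hs.match_alpha.1 (not_lt.1 hxα), hx_piece, A_eq H hs]
    simp only [mul_zero, zero_div, zero_mul]
    linarith

section signs

variable (hσ : M.σ ≠ 0) (hr : 0 < M.r)
include hσ hr

lemma exitFlow_pos_of_Delta₁_pos (hΔ : 0 < M.Delta₁ p) : 0 < M.exitFlow := by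
  rw [Delta₁_eq, div_pos_iff_of_pos_right H.mu_pos,
    mul_pos_iff_of_pos_left (scale_pos hσ hr)] at hΔ
  exact pos_of_mul_pos_left hΔ (Real.rpow_nonneg hs.z_pos.le _)

lemma Delta₁_pos (hE : 0 < M.exitFlow) : 0 < M.Delta₁ p := by
  rw [Delta₁_eq]
  exact div_pos (mul_pos (scale_pos hσ hr) (mul_pos hE (Real.rpow_pos_of_pos hs.z_pos _))) H.mu_pos

lemma Delta₂_pos (hE : 0 < M.exitFlow) : 0 < M.Delta₂ p := by
  rw [Delta₂_eq]
  exact div_pos (mul_pos (scale_pos hσ hr) (mul_pos hE (Real.rpow_pos_of_pos hs.z_pos _))) H.n_pos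

lemma Gamma₁_pos (hQδ : Q (-M.exitFlow) p.δ < 0) : 0 < M.Gamma₁ p := by
  have hδ := hs.inner.x_pos
  have hhδ : M.h p.δ < M.exitFlow := lt_of_not_ge fun hle =>
    hQδ.not_gt (H.highMoment_pos_of_le hδ hle)
  have hPδ : P (-M.exitFlow) p.δ < 0 := by
    rw [← H.lowMoment_zero (-M.exitFlow)]
    exact H.lowMoment_lt_of_neg le_rfl hδ fun s hsδ => by linarith [H.apply_le hsδ.1 hsδ.2.le]
  rw [Gamma₁_eq H hδ]
  exact div_pos (mul_pos (scale_pos hσ hr) (neg_pos.2 hPδ)) H.mu_pos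

lemma Gamma₂_pos (hQδ : Q (-M.exitFlow) p.δ < 0) : 0 < M.Gamma₂ p := by
  rw [Gamma₂_eq H hs.inner.x_pos]
  exact div_pos (mul_pos (scale_pos hσ hr) (neg_pos.2 hQδ)) H.n_pos

lemma A_pos (hE : 0 < M.exitFlow) (hK₀ : 0 < K₀) (hK₁ : 0 < K₁) (hd : 0 < d)
    (hQd : Q (-M.exitFlow) d = 0) : 0 < M.A K₁ p := by
  have hPβ := hs.inner.lowMoment_lt
    (hs.isInnerData H hE (mul_pos hr hK₀) (mul_pos hr hK₁) hd hQd) H hs.g_lt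
  have hPd : P (-M.exitFlow) d < 0 := by
    rw [← H.lowMoment_zero (-M.exitFlow)]
    exact H.lowMoment_lt_of_neg le_rfl hd fun s hsd => by
      linarith [H.apply_le hsd.1 hsd.2.le, H.lt_of_highMoment_eq_zero hd hQd]
  rw [A_eq H hs]
  exact div_pos (mul_pos (scale_pos hσ hr) (by linarith)) H.mu_pos

end signs

variable (hσ : M.σ ≠ 0) (hr : 0 < M.r)
include hσ hr

lemma hasC1Deriv_w₁ : HasC1Deriv (M.w₁ K₁ K₀ p) (fun x => M.scale * DW₁ x) :=
  ((hs.hasC1Deriv_openValue H).const_mul _).congr fun _ hx => w₁_eq H hs hσ hr hx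

lemma hasC1Deriv_w₀ (hζδ : p.ζ < p.δ) : HasC1Deriv (M.w₀ K₁ p) (fun x => M.scale * DW₀ x) :=
  ((hs.hasC1Deriv_closedValue H (hs.zeta_lt_alpha hζδ)).const_mul _).congr
    fun _ hx => w₀_eq H hs hσ hr hx

variable (hE : 0 < M.exitFlow) (hζδ : p.ζ < p.δ)
include hE hζδ

lemma monotoneOn_w₁ (hQδ : Q (-M.exitFlow) p.δ ≤ 0) : MonotoneOn (M.w₁ K₁ K₀ p) (Ioi 0) :=
  fun x hx y hy hxy => by
  rw [w₁_eq H hs hσ hr hx, w₁_eq H hs hσ hr hy]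
  exact mul_le_mul_of_nonneg_left (hs.monotoneOn_openValue H hζδ hE.le hQδ hx hy hxy)
    (scale_pos hσ hr).le

lemma monotoneOn_w₀ : MonotoneOn (M.w₀ K₁ p) (Ioi 0) :=
  fun x hx y hy hxy => by
  rw [w₀_eq (K₀ := K₀) H hs hσ hr hx, w₀_eq (K₀ := K₀) H hs hσ hr hy]
  exact mul_le_mul_of_nonneg_left (hs.monotoneOn_closedValue H hζδ hE.le hx hy hxy)
    (scale_pos hσ hr).le

variable (hK₀ : 0 < K₀) (hK₁ : 0 < K₁) (hx : 0 < x) (hc : ContinuousAt M.h x)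
include hK₀ hK₁ hx hc

lemma variational_w₁ (hQδ : highMoment M.n M.h (-M.exitFlow) p.δ ≤ 0) (hxδ : x ≠ p.δ)
    (hxγ : x ≠ p.γ) (hxβ : x ≠ p.β) :
    DifferentiableAt ℝ (deriv (M.w₁ K₁ K₀ p)) x ∧
      max (M.σ ^ 2 * x ^ 2 * deriv (deriv (M.w₁ K₁ K₀ p)) x + M.b * x * deriv (M.w₁ K₁ K₀ p) x -
        M.r * M.w₁ K₁ K₀ p x + M.h x)
        (max (M.w₀ K₁ p x - M.w₁ K₁ K₀ p x - K₀) (-M.w₁ K₁ K₀ p x - M.K)) = 0 := by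
  obtain ⟨D, hD, heq⟩ := hs.exists_variational_openValue H hE.le (mul_pos hr hK₀)
    (mul_pos hr hK₁) hζδ hx hc hQδ hxδ hxγ hxβ
  have hw := hasC1Deriv_w₁ H hs hσ hr
  have hscale := (scale_pos hσ hr).le
  have hD' := hw.hasDerivAt_deriv hx (hD.const_mul M.scale)
  refine ⟨hD'.differentiableAt, ?_⟩
  rw [hD'.deriv, (hw.hasDerivAt x hx).deriv, w₁_eq H hs hσ hr hx, w₀_eq H hs hσ hr hx]
  convert max_mul_max_mul_eq_zero (mul_nonneg (sq_nonneg M.σ) hscale) hscale heq using 2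
  · rw [b_eq hσ]
    linear_combination -(M.scale * W₁ x) * r_eq hσ hr - M.h x * sq_mul_scale_mul hσ hr
  · congr 1
    · linear_combination scale_mul_const hσ hr K₀
    · rw [exitFlow]
      linear_combination scale_mul_const hσ hr M.K

lemma variational_w₀ (hxζ : x ≠ p.ζ) (hxα : x ≠ p.α) :
    DifferentiableAt ℝ (deriv (M.w₀ K₁ p)) x ∧
      max (M.σ ^ 2 * x ^ 2 * deriv (deriv (M.w₀ K₁ p)) x + M.b * x * deriv (M.w₀ K₁ p) x -
        M.r * M.w₀ K₁ p x)
        (max (M.w₁ K₁ K₀ p x - M.w₀ K₁ p x - K₁) (-M.w₀ K₁ p x - M.K)) = 0 := by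
  obtain ⟨D, hD, heq⟩ := hs.exists_variational_closedValue H hE.le (mul_pos hr hK₀)
    (mul_pos hr hK₁) hζδ hx hc hxζ hxα
  have hw := hasC1Deriv_w₀ H hs hσ hr hζδ
  have hscale := (scale_pos hσ hr).le
  have hD' := hw.hasDerivAt_deriv hx (hD.const_mul M.scale)
  refine ⟨hD'.differentiableAt, ?_⟩
  rw [hD'.deriv, (hw.hasDerivAt x hx).deriv, w₁_eq H hs hσ hr hx, w₀_eq H hs hσ hr hx]
  convert max_mul_max_mul_eq_zero (mul_nonneg (sq_nonneg M.σ) hscale) hscale heq using 2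
  · rw [b_eq hσ]
    linear_combination -(M.scale * W₀ x) * r_eq hσ hr
  · congr 1
    · linear_combination scale_mul_const hσ hr K₁
    · rw [exitFlow]
      linear_combination scale_mul_const hσ hr M.K

omit hx hc in
lemma solvesHJB (hQδ : highMoment M.n M.h (-M.exitFlow) p.δ ≤ 0) :
    M.SolvesHJB K₁ K₀ (M.w₁ K₁ K₀ p) (M.w₀ K₁ p) where
  contDiff_one := (hasC1Deriv_w₁ H hs hσ hr).contDiffOn
  contDiff_zero := (hasC1Deriv_w₀ H hs hσ hr hζδ).contDiffOn
  eqn := by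
    refine ⟨{p.ζ, p.δ, p.γ, p.β, p.α}, toFinite _, fun x hx hxF hc => ?_⟩
    simp only [mem_insert_iff, mem_singleton_iff, not_or] at hxF
    obtain ⟨hxζ, hxδ, hxγ, hxβ, hxα⟩ := hxF
    obtain ⟨diff₁, eq₁⟩ :=
      variational_w₁ H hs hσ hr hE hζδ hK₀ hK₁ hx hc hQδ hxδ hxγ hxβ
    obtain ⟨diff₀, eq₀⟩ := variational_w₀ H hs hσ hr hE hζδ hK₀ hK₁ hx hc hxζ hxα
    exact ⟨diff₁, diff₀, eq₁, eq₀⟩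

end solution

end Verification

end SwitchingModel

namespace SwitchingModel

section Characterisation

variable {M : SwitchingModel} {K₀ K₁ d k k₀ y α ζ : ℝ} {p q : FreeBoundary}

local notation "P" => lowMoment (-M.m) M.h
local notation "Q" => highMoment M.n M.h

variable (H : Payoff (-M.m) M.n M.h)
include H

lemma existsUnique_isDeltaDagger (hx : 0 < y) (hhy : M.h y < M.exitFlow) :
    ∃! d, M.IsDeltaDagger d := by
  obtain ⟨d, hd, hQd⟩ := H.exists_highMoment_eq_zero hx hhy
  refine ⟨d, (isDeltaDagger_iff H).2 ⟨hd, hQd⟩, fun d' hd' => ?_⟩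
  obtain ⟨hd'_pos, hQd'⟩ := (isDeltaDagger_iff H).1 hd'
  exact H.eq_of_highMoment_eq_zero hd hQd hd'_pos hQd'

variable (hr : 0 < M.r) (hE : 0 < M.exitFlow)
include hr hE

lemma existsUnique_isNoSwitchOutPair (hd : M.IsDeltaDagger d) (hK₁ : 0 < K₁) :
    ∃! q : ℝ × ℝ, M.IsNoSwitchOutPair d K₁ q.1 q.2 := by
  obtain ⟨hd, hQd⟩ := (isDeltaDagger_iff H).1 hd
  obtain ⟨ζ, α, hp, -⟩ := H.exists_isEntryPair_and_unique hE (mul_pos hr hK₁) hd hQd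
  refine ⟨(ζ, α), (isNoSwitchOutPair_iff H hd hQd).2 hp, fun q hq => ?_⟩
  obtain ⟨hζ, hα⟩ :=
    hp.unique H hE (mul_pos hr hK₁) hd hQd ((isNoSwitchOutPair_iff H hd hQd).1 hq)
  exact Prod.ext hζ.symm hα.symm

lemma exists_isNoSwitchOutPair (hd : M.IsDeltaDagger d) (hK₁ : 0 < K₁) :
    ∃ ζ α, M.IsNoSwitchOutPair d K₁ ζ α :=
  let ⟨q, hq, _⟩ := existsUnique_isNoSwitchOutPair H hr hE hd hK₁
  ⟨q.1, q.2, hq⟩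

lemma exists_isK₁Dagger_and_pair_self (hd : M.IsDeltaDagger d) (hhd : M.h d < 0) :
    ∃ k α, M.IsK₁Dagger d k ∧ M.IsNoSwitchOutPair d k d α := by
  obtain ⟨hd, hQd⟩ := (isDeltaDagger_iff H).1 hd
  obtain ⟨k, α, hk, hp⟩ := H.exists_isEntryPair_self hE hd hQd hhd
  rw [← mul_div_cancel₀ k hr.ne'] at hp
  exact ⟨k / M.r, α, isK₁Dagger_of_isEntryPair_self H hr hE (div_pos hk hr) hd hQd hp,
    (isNoSwitchOutPair_iff H hd hQd).2 hp⟩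

lemma existsUnique_isK₁Dagger (hd : M.IsDeltaDagger d) (hhd : M.h d < 0) :
    ∃! k, M.IsK₁Dagger d k := by
  obtain ⟨k, -, hk, -⟩ := exists_isK₁Dagger_and_pair_self H hr hE hd hhd
  exact ⟨k, hk, fun k' hk' =>
    hk'.unique (fun K₁ hK₁ => exists_isNoSwitchOutPair H hr hE hd hK₁) hk⟩

lemma IsNoSwitchOutPair.zeta_lt_iff (hp : M.IsNoSwitchOutPair d K₁ ζ α) (hd : M.IsDeltaDagger d)
    (hhd : M.h d < 0) (hk : M.IsK₁Dagger d k) (hK₁ : 0 < K₁) : ζ < d ↔ K₁ < k := by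
  obtain ⟨k', α', hk', hself⟩ := exists_isK₁Dagger_and_pair_self H hr hE hd hhd
  obtain rfl := hk.unique (fun K₁ hK₁ => exists_isNoSwitchOutPair H hr hE hd hK₁) hk'
  refine ⟨fun hζd => lt_of_not_ge fun hle => ?_, (hk.2 K₁ hK₁ ζ α hp).1⟩
  rcases hle.eq_or_lt with rfl | hlt
  · have hpair := (existsUnique_isNoSwitchOutPair H hr hE hd hK₁).unique
      (y₁ := (ζ, α)) (y₂ := (d, α')) hp hself
    exact hζd.ne (congrArg Prod.fst hpair)
  · exact hζd.not_gt ((hk.2 K₁ hK₁ ζ α hp).2 hlt)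

lemma IsSolution.unique (hp : M.IsSolution K₁ K₀ p) (hq : M.IsSolution K₁ K₀ q)
    (hd : M.IsDeltaDagger d) (hK₁ : 0 < K₁) (hK₀ : 0 < K₀) : q = p := by
  obtain ⟨hd, hQd⟩ := (isDeltaDagger_iff H).1 hd
  obtain ⟨hζ, hδ, hγ, hβ, hα⟩ := ((isSolution_iff H).1 hp).unique H hE (mul_pos hr hK₀)
    (mul_pos hr hK₁) hd hQd ((isSolution_iff H).1 hq)
  exact FreeBoundary.ext hζ.symm hδ.symm hγ.symm hβ.symm hα.symm

lemma IsSolution.exists_isDeltaDagger (hp : M.IsSolution K₁ K₀ p) (hK₁ : 0 < K₁) (hK₀ : 0 < K₀) :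
    0 < p.β ∧ M.h p.β < -(M.r * K₀) ∧ ∃ d, M.IsDeltaDagger d ∧ M.h d < 0 := by
  have hs := (isSolution_iff H).1 hp
  have hk₀ := mul_pos hr hK₀
  have hk₁ := mul_pos hr hK₁
  have hhβ : M.h p.β + M.r * K₀ < 0 := hs.switch.apply_b_lt H (add_pos hk₀ hk₁)
  obtain ⟨d, hd, hQd⟩ := H.exists_highMoment_eq_zero hs.switch.b_pos
    (show M.h p.β < M.exitFlow by linarith)
  refine ⟨hs.switch.b_pos, by linarith, d, (isDeltaDagger_iff H).2 ⟨hd, hQd⟩, ?_⟩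
  linarith [H.apply_le hd (hs.d_lt_b H hE hk₀ hk₁ hd hQd).le]

variable (hσ : M.σ ≠ 0) (hK₁ : 0 < K₁) (hd : M.IsDeltaDagger d)
include hσ hK₁ hd

lemma IsNoSwitchOutPair.exists_isSignChange (hp : M.IsNoSwitchOutPair d K₁ ζ α) (hζd : ζ < d) :
    ∃ y k₀, M.IsSignChange d K₁ α y ∧ 0 < k₀ ∧ P k₀ y = P (-(M.r * K₁)) α ∧
      Q k₀ y = Q (-(M.r * K₁)) α ∧ ∀ s, 0 < s → s < y → M.h s + k₀ ≤ 0 := by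
  obtain ⟨hd, hQd⟩ := (isDeltaDagger_iff H).1 hd
  obtain ⟨y, k₀, hdy, hyα, neg, pos, hk₀, hP, hQ, hle⟩ :=
    ((isNoSwitchOutPair_iff H hd hQd).1 hp).exists_signChange H hE hd hQd hζd (mul_pos hr hK₁)
  have hα := (hd.trans hdy).trans hyα
  exact ⟨y, k₀, ⟨hdy, hyα,
    fun x hdx hxy => (gapDeriv_pos_iff H hσ (hd.trans_le hdx) hα).2 (neg x hdx hxy),
    fun x hyx hxα => (gapDeriv_neg_iff H hσ ((hd.trans hdy).trans hyx) hα).2 (pos x hyx hxα)⟩,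
    hk₀, hP, hQ, hle⟩

lemma existsUnique_isK₀Dagger (hhd : M.h d < 0) (hk : M.IsK₁Dagger d k) (hK₁k : K₁ < k) :
    (∃! k₀, M.IsK₀Dagger d K₁ k₀) ∧ ∀ k₀, M.IsK₀Dagger d K₁ k₀ → 0 < k₀ := by
  obtain ⟨ζ, α, hp⟩ := exists_isNoSwitchOutPair H hr hE hd hK₁
  have hζd := (hp.zeta_lt_iff H hr hE hd hhd hk hK₁).2 hK₁k
  obtain ⟨y, k₀, hy, hk₀, -, hQy, -⟩ := hp.exists_isSignChange H hr hE hσ hK₁ hd hζd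
  have dagger_iff : ∀ {k}, M.IsK₀Dagger d K₁ k ↔ M.r * k = k₀ :=
    isK₀Dagger_iff H hr hE hK₁ hd hp hy hQy
  refine ⟨⟨k₀ / M.r, dagger_iff.2 (mul_div_cancel₀ k₀ hr.ne'), fun k' hk' => ?_⟩, fun k' hk' => ?_⟩
  · exact eq_div_of_mul_eq hr.ne' ((mul_comm _ _).trans (dagger_iff.1 hk'))
  · exact pos_of_mul_pos_right ((dagger_iff.1 hk').symm ▸ hk₀) hr.le

variable (hK₀ : 0 < K₀)
include hK₀

lemma IsSolution.verification (hp : M.IsSolution K₁ K₀ p) :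
    0 < M.Gamma₁ p ∧ 0 < M.Gamma₂ p ∧ 0 < M.A K₁ p ∧ 0 < M.Delta₁ p ∧ 0 < M.Delta₂ p ∧
      MonotoneOn (M.w₁ K₁ K₀ p) (Ioi 0) ∧ MonotoneOn (M.w₀ K₁ p) (Ioi 0) ∧
      M.SolvesHJB K₁ K₀ (M.w₁ K₁ K₀ p) (M.w₀ K₁ p) := by
  have hs := (isSolution_iff H).1 hp
  obtain ⟨hd, hQd⟩ := (isDeltaDagger_iff H).1 hd
  have D := hs.isInnerData H hE (mul_pos hr hK₀) (mul_pos hr hK₁) hd hQd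
  have hζδ : p.ζ < p.δ := hs.inner.z_lt_x D H hs.g_lt.le
  have hQδ : Q (-M.exitFlow) p.δ < 0 :=
    H.highMoment_neg_of_lt hd hQd hs.inner.x_pos (hs.inner.x_lt_d D H hs.g_lt)
  exact ⟨Gamma₁_pos H hs hσ hr hQδ, Gamma₂_pos H hs hσ hr hQδ, A_pos H hs hσ hr hE hK₀ hK₁ hd hQd,
    Delta₁_pos H hs hσ hr hE, Delta₂_pos H hs hσ hr hE, monotoneOn_w₁ H hs hσ hr hE hζδ hQδ.le,
    monotoneOn_w₀ H hs hσ hr hE hζδ, solvesHJB H hs hσ hr hE hζδ hK₀ hK₁ hQδ.le⟩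

lemma IsSolution.lt_daggers (hs : M.IsSolution K₁ K₀ p) (hhd : M.h d < 0) :
    ∃ k₁, M.IsK₁Dagger d k₁ ∧ K₁ < k₁ ∧ ∃ k₀, M.IsK₀Dagger d K₁ k₀ ∧ K₀ < k₀ := by
  have hs := (isSolution_iff H).1 hs
  obtain ⟨hd_pos, hQd⟩ := (isDeltaDagger_iff H).1 hd
  obtain ⟨ζ, α, hp⟩ := exists_isNoSwitchOutPair H hr hE hd hK₁
  have hpair := (isNoSwitchOutPair_iff H hd_pos hQd).1 hp
  have hk₀ := mul_pos hr hK₀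
  have hk₁ := mul_pos hr hK₁
  have hζd : ζ < d := hs.entry_lt_d H hE hk₀ hk₁ hd_pos hQd hpair
  obtain ⟨k, hk, -⟩ := existsUnique_isK₁Dagger H hr hE hd hhd
  obtain ⟨y, k₀, hy, -, hPy, hQy, -⟩ := hp.exists_isSignChange H hr hE hσ hK₁ hd hζd
  refine ⟨k, hk, (hp.zeta_lt_iff H hr hE hd hhd hk hK₁).1 hζd, k₀ / M.r,
    (isK₀Dagger_iff H hr hE hK₁ hd hp hy hQy).2 (mul_div_cancel₀ k₀ hr.ne'), ?_⟩
  have hα := hd_pos.trans hp.d_lt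
  have hneg := fun x hdx hxy =>
    (gapDeriv_pos_iff H hσ (hd_pos.trans_le hdx) hα).1 (hy.2.2.1 x hdx hxy)
  rw [lt_div_iff₀' hr]
  exact hs.k₀_lt H hE hk₀ hk₁ hd_pos hQd hpair hneg (hd_pos.trans hy.1) hPy hQy

lemma exists_isSolution {k₁ : ℝ} (hhd : M.h d < 0) (hdag₁ : M.IsK₁Dagger d k₁) (hK₁k : K₁ < k₁)
    (hdag₀ : M.IsK₀Dagger d K₁ k) (hK₀k : K₀ < k) : ∃ p, M.IsSolution K₁ K₀ p := by
  obtain ⟨ζ, α, hp⟩ := exists_isNoSwitchOutPair H hr hE hd hK₁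
  have hζd := (hp.zeta_lt_iff H hr hE hd hhd hdag₁ hK₁).2 hK₁k
  obtain ⟨y, k₀, hy, -, hPy, hQy, hle⟩ := hp.exists_isSignChange H hr hE hσ hK₁ hd hζd
  obtain rfl := (isK₀Dagger_iff H hr hE hK₁ hd hp hy hQy).1 hdag₀
  obtain ⟨hd, hQd⟩ := (isDeltaDagger_iff H).1 hd
  obtain ⟨z, x, g, b, a, hs⟩ := ((isNoSwitchOutPair_iff H hd hQd).1 hp).exists_solvesSystem H hE
    (mul_pos hr hK₀) (mul_pos hr hK₁) hd hQd hy.1 hle hPy hQy (mul_lt_mul_of_pos_left hK₀k hr)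
  exact ⟨⟨z, x, g, b, a⟩, (isSolution_iff H).2 hs⟩

end Characterisation

end SwitchingModel

theorem mainTheorem9 {Ω : Type*} [MeasurableSpace Ω] (P : Measure Ω) [IsProbabilityMeasure P]
    (W : ℝ≥0 → Ω → ℝ) (hW : IsBrownianReal W P) (M : SwitchingModel) (hM : M.Standing P W) :
    -- the critical values are well defined
    (M.hZero < ((-(M.r * M.K) : ℝ) : EReal) → ∃! d, M.IsDeltaDagger d) ∧
    (M.K < 0 → M.hZero < ((-(M.r * M.K) : ℝ) : EReal) → ∀ d, M.IsDeltaDagger d →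
      (∀ K₁, 0 < K₁ → ∃! q : ℝ × ℝ, M.IsNoSwitchOutPair d K₁ q.1 q.2) ∧
      (M.h d < 0 →
        (∃! k₁, M.IsK₁Dagger d k₁) ∧
        ∀ k₁, M.IsK₁Dagger d k₁ → ∀ K₁, 0 < K₁ → K₁ < k₁ →
          (∃! k₀, M.IsK₀Dagger d K₁ k₀) ∧ ∀ k₀, M.IsK₀Dagger d K₁ k₀ → 0 < k₀)) ∧
    -- the characterisation
    ∀ K₁ K₀ : ℝ, 0 < K₁ → 0 < K₀ →
      ((∃ p : FreeBoundary, M.IsSolution K₁ K₀ p ∧ (∀ q, M.IsSolution K₁ K₀ q → q = p) ∧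
          0 < M.Gamma₁ p ∧ 0 < M.Gamma₂ p ∧ 0 < M.A K₁ p ∧ 0 < M.Delta₁ p ∧ 0 < M.Delta₂ p ∧
          MonotoneOn (M.w₁ K₁ K₀ p) (Ioi 0) ∧ MonotoneOn (M.w₀ K₁ p) (Ioi 0) ∧
          M.SolvesHJB K₁ K₀ (M.w₁ K₁ K₀ p) (M.w₀ K₁ p)) ↔
        M.K < 0 ∧ M.hZero < ((-(M.r * K₀) : ℝ) : EReal) ∧
          ∃ d, M.IsDeltaDagger d ∧ M.h d < 0 ∧
            ∃ k₁, M.IsK₁Dagger d k₁ ∧ K₁ < k₁ ∧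
              ∃ k₀, M.IsK₀Dagger d K₁ k₀ ∧ K₀ < k₀) := by
  have H := SwitchingModel.payoff hW hM
  have hσ := hM.sigma_ne
  have hr := hM.r_pos
  have hE_iff := SwitchingModel.exitFlow_pos_iff hr
  refine ⟨fun h0 => ?_, fun hK _ d hd => ?_, fun K₁ K₀ hK₁ hK₀ => ⟨?_, ?_⟩⟩
  · obtain ⟨x, hx, hhx⟩ := (SwitchingModel.lt_hZero_iff hM.mono).1 h0
    exact SwitchingModel.existsUnique_isDeltaDagger H hx hhx
  · have hE := hE_iff.2 hK
    exact ⟨fun K₁ => SwitchingModel.existsUnique_isNoSwitchOutPair H hr hE hd,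
      fun hhd => ⟨SwitchingModel.existsUnique_isK₁Dagger H hr hE hd hhd, fun k₁ hk₁ K₁ hK₁ =>
        SwitchingModel.existsUnique_isK₀Dagger H hr hE hσ hK₁ hd hhd hk₁⟩⟩
  · rintro ⟨p, hp, -, -, -, -, hΔ₁, -⟩
    have hE := SwitchingModel.exitFlow_pos_of_Delta₁_pos H
      ((SwitchingModel.isSolution_iff H).1 hp) hσ hr hΔ₁
    obtain ⟨hβ, hhβ, d, hd, hhd⟩ := hp.exists_isDeltaDagger H hr hE hK₁ hK₀
    exact ⟨hE_iff.1 hE, (SwitchingModel.lt_hZero_iff hM.mono).2 ⟨p.β, hβ, hhβ⟩, d, hd, hhd,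
      hp.lt_daggers H hr hE hσ hK₁ hd hK₀ hhd⟩
  · rintro ⟨hK, -, d, hd, hhd, k₁, hk₁, hlt₁, k₀, hk₀, hlt₀⟩
    have hE := hE_iff.2 hK
    obtain ⟨p, hp⟩ :=
      SwitchingModel.exists_isSolution H hr hE hσ hK₁ hd hK₀ hhd hk₁ hlt₁ hk₀ hlt₀
    exact ⟨p, hp, fun q hq => hp.unique H hr hE hq hd hK₁ hK₀,
      hp.verification H hr hE hσ hK₁ hd hK₀⟩
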